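/- **Setting (two-stage dynamic treatment regime).** States $X_1,X_2$, treatments $A_1,A_2$, real rewards $Y_1,Y_2$ and an unmeasured confounder $U$ are generated as follows ($X_2$ and $U$ take values in standard Borel spaces, the other states and the treatments in arbitrary measurable spaces). In the *observational process* $X_1\sim p_{\rm ob}(x_1)$ and $U\sim p(u)$ are independent, $A_1\sim\pi_{\rm ob,1}(\cdot\mid X_1)$, $X_2\sim p(\cdot\mid X_1,A_1,U)$, $Y_1\sim p(\cdot\mid X_1,A_1,X_2)$, $A_2\sim\pi_{\rm ob,2}(\cdot\mid X_1,A_1,X_2,Y_1,U)$ and $Y_2=f(X_1,A_1,X_2,A_2)+\varepsilon$ with $\varepsilon\sim p(\cdot\mid U,X_1,X_2)$ integrable. Indicators $R_{X_1}\sim p(\cdot\mid X_1,A_1)$ and $R_{X_2}\sim p(\cdot\mid X_1,A_1,X_2,A_2)$ are drawn independently; $X_i$ is recorded iff $R_{X_i}=1$, while $A,Y$ are always recorded and $U$ never. Write $X=(X_1,X_2)$, $A=(A_1,A_2)$, $Y=(Y_1,Y_2)$, $P_{\rm ob}$ for the observational law, $\mu_1=P_{\rm ob}$, $\mu_2=P_{\rm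 ob}(\cdot\mid R_{X_1}=R_{X_2}=1)$. In the *interventional process* under a policy $\pi=(\pi_1(a_1\mid x_1),\pi_2(a_2\mid x_1,a_1,x_2))$ the law of $X_1$ is replaced by $\tilde p$ and the treatments are drawn from $\pi$; the law of $(X,A)$ is then $\nu_\pi=\tilde p(x_1)\,\pi_1(a_1\mid x_1)\,p_{\rm ob}(x_2\mid x_1,a_1)\,\pi_2(a_2\mid x_1,a_1,x_2)$. Let $v^\pi$ be the mean of $Y_2$ in this process, $v(g,\pi)=\int g\,d\nu_\pi$, $\Pi$ a set of policies with $Y_2$ integrable under each, $\pi^*\in\Pi$ a maximizer of $v^\pi$ over $\Pi$, and $\mathrm{SubOpt}(\pi)=v^{\pi^*}-v^\pi$. The CATE is $\mathbb E_{\rm ob}[Y_2\mid x_1,a_1,x_2,\mathrm{do}(a_2)]$, the average of $Y_2$ over $U\sim p_{\rm ob}(u\mid x_1,a_1,x_2)$ and $\varepsilon\sim p(\cdot\mid U,x_1,x_2)$. **Assumptions.** 1. $Y_1$ is complete over $(X,A)$: for $\sigma(X,A)$ integrable, $\mathbb E_{\rm ob}[\sigma(X,A)\mid Y_1]=0$ a.s.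 iff $\sigma(X,A)=0$ a.s. 2. (Linear bridge functions.) $\phi_1(a,y)\in\mathbb R^{m_1}$, $\phi_2(x,a)\in\mathbb R^{m_2}$ are measurable with norm at most $1$, $\mathcal H_1=\{w^\top\phi_1:\|w\|_2\le C_1\}$, $\mathcal G=\{w^\top\phi_2:\|w\|_2\le C_2\}$, $\mathcal H=\mathcal H_1\times\mathcal G$. Some $(h_1^*,g^*)\in\mathcal H$ solves $\mathbb E_{\rm ob}[h_1(A,Y)-Y_2\mid Y_1]=0$ and $\mathbb E_{\mu_2}[g(X,A)-h_1(A,Y)\mid X,A,Y_1]=0$. Moreover, for each $\pi\in\Pi$, $g^*$ equals the CATE almost everywhere for the part of $\nu_\pi$ singular to the observational law of $(X,A)$ (void if $\nu_\pi$ is absolutely continuous with respect to it). 3. (Linear conditional moments.) $\psi_1(y_1)\in\mathbb R^{d_1}$, $\psi_2(x,a,y_1)\in\mathbb R^{d_2}$ are measurable with norm at most $1$, and for some matrices $W_1,W_2,W_3$: $\mathbb E_{\rm ob}[\phi_1(A,Y)\mid Y_1]=W_1\psi_1(Y_1)$, $\mathbb E_{\mu_2}[\phi_1(A,Y)\mid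 X,A,Y_1]=W_2\psi_2(X,A,Y_1)$, $\mathbb E_{\mu_2}[\phi_2(X,A)\mid X,A,Y_1]=W_3\psi_2(X,A,Y_1)$. Put $\Theta_k=\{\beta^\top\psi_k:\|\beta\|_2\le D_k\}$ with $D_1>2C_1\|W_1\|_F$, $D_2>2(C_1\|W_2\|_F+C_2\|W_3\|_F)$. 4. With $\alpha_1(h)=h_1(A,Y)-Y_2$ and $\alpha_2(h)=g(X,A)-h_1(A,Y)$ for $h=(h_1,g)$, there is $L_\alpha>0$ such that $|\alpha_k(h)|\le L_\alpha$ $\mu_k$-a.s. for all $h\in\mathcal H$, $k=1,2$. 5. (Shift functions.) $\nu_{\pi^*}$ is absolutely continuous with respect to the observational law of $(X,A)$, and a measurable $b_1:\mathbb R\to\mathbb R$ satisfies $$\mathbb E_{\rm ob}[b_1(Y_1)\mid X=x,A=a]=\frac{\tilde p(x_1)\,p_{\rm ob}(x_2\mid x_1,a_1)\,\pi_1^*(a_1\mid x_1)\,\pi_2^*(a_2\mid x_1,a_1,x_2)}{p_{\rm ob}(x_1,a_1,x_2,a_2)}.$$ The law of $(X,A,Y_1)$ under $\mu_1$ is absolutely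 continuous with respect to that under $\mu_2$, and $b_2(x,a,y_1)=b_1(y_1)\,p_{\rm ob}(x,a,y_1)/p_{\rm ob}(x,a,y_1\mid R_{X_1}=R_{X_2}=1)$. Put $B=\|b_1\|_{\mu_1,2}+\|b_2\|_{\mu_2,2}\in[0,\infty]$. **Algorithm (CAP).** Let $\mathcal D=\mathcal D_1$ be the records of $T$ i.i.d. observational trials and $\mathcal D_2\subseteq\mathcal D$ the $T_2$ records with no missing state; put $T_1=T$. With $\mathcal L_{\mathcal D}(h)=\sum_{k=1}^2\sup_{\theta\in\Theta_k}\{\mathbb E_{\mathcal D_k}[\alpha_k(h)\theta]-\tfrac12\|\theta\|_{\mathcal D_k,2}^2\}$ and a threshold $e_{\mathcal D}$, let $\mathrm{CI}=\{g:(h_1,g)\in\mathcal H,\ \mathcal L_{\mathcal D}(h_1,g)\le\inf_{\mathcal H}\mathcal L_{\mathcal D}+e_{\mathcal D}\}$ and let $\hat\pi\in\Pi$ be any maximizer over $\Pi$ of $\inf_{g\in\mathrm{CI}}v(g,\pi)$. **Critical radius.** For a class $F$ bounded by $c$, $\delta>0$ is a critical radius on $\{z_1,\dots,z_n\}$ if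 $\mathbb E_\epsilon\sup\{\frac1n\sum_i\epsilon_i q(z_i): q\in F,\ \frac1n\sum_i q(z_i)^2\le\delta^2\}\le\delta^2/c$, with i.i.d. uniform signs $\epsilon_i$. Let $\mathcal Q_k=\{\alpha_k(h)\theta: h\in\mathcal H,\theta\in\Theta_k\}$, with the bounds $L_\alpha D_k$ for $\mathcal Q_k$ and $D_k$ for $\Theta_k$. Given a constant $K$ and $\xi\in(0,1)$, say that $\eta_k$ *bounds the critical radius* if $T_k\ge1$ and $\eta_k\ge K\big(\delta_k+\sqrt{\log(K/\xi)/T_k}\big)$ for a common critical radius $\delta_k$ of $\mathcal Q_k$ and $\Theta_k$ on $\mathcal D_k$. **Conclusion.** There are a universal constant $C>0$ and, for all $C_1,C_2,D_1,D_2$ and $L_\alpha>0$, a constant $K\ge1$ depending only on these five numbers, such that under the assumptions above, for all $T$ and all $\xi\in(0,1)$: (a) With probability at least $1-4\xi$: for all $\eta_1,\eta_2$ that bound the critical radii and all $e_{\mathcal D}>(2L_\alpha^2+\tfrac54)\eta^2$, where $\eta=\sqrt{\eta_1^2+\eta_2^2}$, every CAP output $\hat\pi$ with threshold $e_{\mathcal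 D}$ satisfies $$\mathrm{SubOpt}(\hat\pi)\le C\,B\,\big(\sqrt{e_{\mathcal D}}+\eta\big).$$ (b) Almost surely, if $T\ge2$, $K\sqrt{(m_1+d_1+1)\log T/T}$ is a critical radius of $\mathcal Q_1$ and of $\Theta_1$ on $\mathcal D_1$; and if $T_2\ge2$, $K\sqrt{(m_1+m_2+d_2+1)\log T_2/T_2}$ is a critical radius of $\mathcal Q_2$ and of $\Theta_2$ on $\mathcal D_2$. (c) With probability at least $1-4\xi$: if $T_2\ge2$, every CAP output $\hat\pi$ with threshold $e_{\mathcal D}=K r$, where $r=\big((m_1+m_2+d_1+d_2+1)\log T_2+\log(1/\xi)\big)/T_2$, satisfies $\mathrm{SubOpt}(\hat\pi)\le K\,B\,\sqrt r$, that is, a rate $\tilde O(T_2^{-1/2})$. -/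

import Mathlib

open MeasureTheory ProbabilityTheory

noncomputable section

/-- The states and treatments `(((x₁, a₁), x₂), a₂)` of the two stages. -/
abbrev DTRHist (𝒳₁ 𝒜₁ 𝒳₂ 𝒜₂ : Type*) := ((𝒳₁ × 𝒜₁) × 𝒳₂) × 𝒜₂

/-- A full trajectory `((((((x₁, u), a₁), x₂), y₁), a₂), ε)`, in order of generation. -/
abbrev DTRPath (𝒳₁ 𝒜₁ 𝒳₂ 𝒜₂ 𝒰 : Type*) := (((((𝒳₁ × 𝒰) × 𝒜₁) × 𝒳₂) × ℝ) × 𝒜₂) × ℝ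

/-- A trajectory together with its two missingness indicators (`true` means observed). -/
abbrev DTRTrial (𝒳₁ 𝒜₁ 𝒳₂ 𝒜₂ 𝒰 : Type*) := DTRPath 𝒳₁ 𝒜₁ 𝒳₂ 𝒜₂ 𝒰 × (Bool × Bool)

/-- What the learner sees of a trial: a context is `none` if it is missing. -/
structure DTRRecord (𝒳₁ 𝒜₁ 𝒳₂ 𝒜₂ : Type*) where
  x₁ : Option 𝒳₁
  a₁ : 𝒜₁
  x₂ : Option 𝒳₂
  a₂ : 𝒜₂
  y₁ : ℝ
  y₂ : ℝ

/-- A two-stage dynamic treatment regime with an unmeasured confounder `U` of stage two,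
given by its causal mechanisms. Every variable is drawn from its causes:
`X₁`, `U` are exogenous and independent, `A₁ ← X₁`, `X₂ ← (X₁, A₁, U)`, `Y₁ ← (X₁, A₁, X₂)`,
`A₂ ← (X₁, A₁, X₂, Y₁, U)`, `Y₂ = f (X₁, A₁, X₂, A₂) + ε` with `ε ← (U, X₁, X₂)`,
`R_{X₁} ← (X₁, A₁)` and `R_{X₂} ← (X₁, A₁, X₂, A₂)`. -/
structure TwoStageDTR (𝒳₁ 𝒜₁ 𝒳₂ 𝒜₂ 𝒰 : Type*) [MeasurableSpace 𝒳₁] [MeasurableSpace 𝒜₁]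
    [MeasurableSpace 𝒳₂] [MeasurableSpace 𝒜₂] [MeasurableSpace 𝒰] where
  /-- law of `X₁` in the observational process -/
  ctx : Measure 𝒳₁
  /-- law of `X₁` in the interventional process -/
  ctxNew : Measure 𝒳₁
  /-- law of the confounder -/
  conf : Measure 𝒰
  /-- observational policy, stage one -/
  behav₁ : Kernel 𝒳₁ 𝒜₁
  /-- transition to the second state -/
  trans : Kernel (𝒳₁ × 𝒜₁ × 𝒰) 𝒳₂
  /-- first-stage reward -/
  reward₁ : Kernel (𝒳₁ × 𝒜₁ × 𝒳₂) ℝ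
  /-- observational policy, stage two (confounded) -/
  behav₂ : Kernel (𝒳₁ × 𝒜₁ × 𝒳₂ × ℝ × 𝒰) 𝒜₂
  /-- structural part of the second-stage reward -/
  f : DTRHist 𝒳₁ 𝒜₁ 𝒳₂ 𝒜₂ → ℝ
  /-- noise of the second-stage reward -/
  noise : Kernel (𝒰 × 𝒳₁ × 𝒳₂) ℝ
  /-- missingness of `X₁` -/
  miss₁ : Kernel (𝒳₁ × 𝒜₁) Bool
  /-- missingness of `X₂` -/
  miss₂ : Kernel (𝒳₁ × 𝒜₁ × 𝒳₂ × 𝒜₂) Bool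
  prob_ctx : IsProbabilityMeasure ctx
  prob_ctxNew : IsProbabilityMeasure ctxNew
  prob_conf : IsProbabilityMeasure conf
  markov_behav₁ : IsMarkovKernel behav₁
  markov_trans : IsMarkovKernel trans
  markov_reward₁ : IsMarkovKernel reward₁
  markov_behav₂ : IsMarkovKernel behav₂
  measurable_f : Measurable f
  markov_noise : IsMarkovKernel noise
  markov_miss₁ : IsMarkovKernel miss₁
  markov_miss₂ : IsMarkovKernel miss₂

/-- An interventional policy `(π₁(a₁ | x₁), π₂(a₂ | x₁, a₁, x₂))`. -/
structure DTRPolicy (𝒳₁ 𝒜₁ 𝒳₂ 𝒜₂ : Type*) [MeasurableSpace 𝒳₁] [MeasurableSpace 𝒜₁]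
    [MeasurableSpace 𝒳₂] [MeasurableSpace 𝒜₂] where
  fst : Kernel 𝒳₁ 𝒜₁
  snd : Kernel (𝒳₁ × 𝒜₁ × 𝒳₂) 𝒜₂
  markov_fst : IsMarkovKernel fst
  markov_snd : IsMarkovKernel snd

attribute [instance] TwoStageDTR.prob_ctx TwoStageDTR.prob_ctxNew TwoStageDTR.prob_conf
  TwoStageDTR.markov_behav₁ TwoStageDTR.markov_trans TwoStageDTR.markov_reward₁
  TwoStageDTR.markov_behav₂ TwoStageDTR.markov_noise TwoStageDTR.markov_miss₁
  TwoStageDTR.markov_miss₂ DTRPolicy.markov_fst DTRPolicy.markov_snd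

/-! ### Coordinates of a trial -/

namespace DTRPath

variable {𝒳₁ 𝒜₁ 𝒳₂ 𝒜₂ 𝒰 : Type*}

/-- `(X₁, A₁, X₂, A₂)` -/
def hist (p : DTRPath 𝒳₁ 𝒜₁ 𝒳₂ 𝒜₂ 𝒰) : DTRHist 𝒳₁ 𝒜₁ 𝒳₂ 𝒜₂ :=
  (((p.1.1.1.1.1.1, p.1.1.1.1.2), p.1.1.1.2), p.1.2)

/-- `Y₁` -/
def y₁ (p : DTRPath 𝒳₁ 𝒜₁ 𝒳₂ 𝒜₂ 𝒰) : ℝ := p.1.1.2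

/-- `ε` -/
def eps (p : DTRPath 𝒳₁ 𝒜₁ 𝒳₂ 𝒜₂ 𝒰) : ℝ := p.2

end DTRPath

namespace TwoStageDTR

variable {𝒳₁ 𝒜₁ 𝒳₂ 𝒜₂ 𝒰 : Type*} [MeasurableSpace 𝒳₁] [MeasurableSpace 𝒜₁]
  [MeasurableSpace 𝒳₂] [MeasurableSpace 𝒜₂] [MeasurableSpace 𝒰]
  (M : TwoStageDTR 𝒳₁ 𝒜₁ 𝒳₂ 𝒜₂ 𝒰)

/-- `Y₂ = f(X₁, A₁, X₂, A₂) + ε` -/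
def y₂ (p : DTRPath 𝒳₁ 𝒜₁ 𝒳₂ 𝒜₂ 𝒰) : ℝ := M.f p.hist + p.eps

/-- The law of a trajectory when `X₁` has law `q` and treatments are assigned by `k₁`, `k₂`,
all other mechanisms being those of the model. -/
def pathLaw (q : Measure 𝒳₁) (k₁ : Kernel 𝒳₁ 𝒜₁) (k₂ : Kernel (𝒳₁ × 𝒜₁ × 𝒳₂ × ℝ × 𝒰) 𝒜₂) :
    Measure (DTRPath 𝒳₁ 𝒜₁ 𝒳₂ 𝒜₂ 𝒰) :=
  (((((q.prod M.conf)
    ⊗ₘ k₁.comap (fun p : 𝒳₁ × 𝒰 => p.1) (by fun_prop))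
    ⊗ₘ M.trans.comap
      (fun p : (𝒳₁ × 𝒰) × 𝒜₁ => (p.1.1, p.2, p.1.2)) (by fun_prop))
    ⊗ₘ M.reward₁.comap
      (fun p : ((𝒳₁ × 𝒰) × 𝒜₁) × 𝒳₂ => (p.1.1.1, p.1.2, p.2)) (by fun_prop))
    ⊗ₘ k₂.comap
      (fun p : (((𝒳₁ × 𝒰) × 𝒜₁) × 𝒳₂) × ℝ =>
        (p.1.1.1.1, p.1.1.2, p.1.2, p.2, p.1.1.1.2)) (by fun_prop))
    ⊗ₘ M.noise.comap
      (fun p : ((((𝒳₁ × 𝒰) × 𝒜₁) × 𝒳₂) × ℝ) × 𝒜₂ =>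
        (p.1.1.1.1.2, p.1.1.1.1.1, p.1.1.2)) (by fun_prop)

/-- The observational law of a trial. -/
def obsLaw : Measure (DTRTrial 𝒳₁ 𝒜₁ 𝒳₂ 𝒜₂ 𝒰) :=
  M.pathLaw M.ctx M.behav₁ M.behav₂ ⊗ₘ
    ((M.miss₁.comap (fun p : DTRPath 𝒳₁ 𝒜₁ 𝒳₂ 𝒜₂ 𝒰 => (p.hist.1.1.1, p.hist.1.1.2))
        (by unfold DTRPath.hist; fun_prop)) ×ₖ
      (M.miss₂.comap (fun p : DTRPath 𝒳₁ 𝒜₁ 𝒳₂ 𝒜₂ 𝒰 =>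
        (p.hist.1.1.1, p.hist.1.1.2, p.hist.1.2, p.hist.2))
        (by unfold DTRPath.hist; fun_prop)))

/-- The event that no context is missing. -/
def complete : Set (DTRTrial 𝒳₁ 𝒜₁ 𝒳₂ 𝒜₂ 𝒰) := {ω | ω.2 = (true, true)}

/-- `μ₂`: the observational law given that no context is missing (`μ₁` is `obsLaw`). -/
def completeLaw : Measure (DTRTrial 𝒳₁ 𝒜₁ 𝒳₂ 𝒜₂ 𝒰) := cond M.obsLaw complete

/-- The interventional law of a trajectory under the policy `π`. -/
def intLaw (π : DTRPolicy 𝒳₁ 𝒜₁ 𝒳₂ 𝒜₂) : Measure (DTRPath 𝒳₁ 𝒜₁ 𝒳₂ 𝒜₂ 𝒰) :=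
  M.pathLaw M.ctxNew π.fst
    (π.snd.comap (fun p : 𝒳₁ × 𝒜₁ × 𝒳₂ × ℝ × 𝒰 => (p.1, p.2.1, p.2.2.1)) (by fun_prop))

/-- The value `v^π`: mean of `Y₂` in the interventional process. -/
def value (π : DTRPolicy 𝒳₁ 𝒜₁ 𝒳₂ 𝒜₂) : ℝ := ∫ p, M.y₂ p ∂(M.intLaw π)

/-- The joint conditional law of `(X₂, U)` given `(X₁, A₁)`; both processes share it, as `U` does
not influence the first stage. -/
def stateConf : Kernel (𝒳₁ × 𝒜₁) (𝒳₂ × 𝒰) :=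
  (Kernel.const (𝒳₁ × 𝒜₁) M.conf ⊗ₖ
    M.trans.comap (fun p : (𝒳₁ × 𝒜₁) × 𝒰 => (p.1.1, p.1.2, p.2)) (by fun_prop)).swapRight

/-- `p_ob(x₂ | x₁, a₁)` -/
def stateTrans : Kernel (𝒳₁ × 𝒜₁) 𝒳₂ := M.stateConf.fst

/-- The law `p̃(x₁) π₁(a₁ | x₁) p_ob(x₂ | x₁, a₁) π₂(a₂ | x₁, a₁, x₂)` of `(X, A)` under `π`. -/
def visitLaw (π : DTRPolicy 𝒳₁ 𝒜₁ 𝒳₂ 𝒜₂) : Measure (DTRHist 𝒳₁ 𝒜₁ 𝒳₂ 𝒜₂) :=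
  ((M.ctxNew ⊗ₘ π.fst) ⊗ₘ M.stateTrans) ⊗ₘ
    π.snd.comap (fun p : (𝒳₁ × 𝒜₁) × 𝒳₂ => (p.1.1, p.1.2, p.2)) (by fun_prop)

/-- The average reward function `v(g, π)`. -/
def modelValue (g : DTRHist 𝒳₁ 𝒜₁ 𝒳₂ 𝒜₂ → ℝ) (π : DTRPolicy 𝒳₁ 𝒜₁ 𝒳₂ 𝒜₂) : ℝ :=
  ∫ s, g s ∂(M.visitLaw π)

instance : IsMarkovKernel M.stateConf := by unfold stateConf; infer_instance

/-- The conditional average treatment effect `E[Y₂ | x₁, a₁, x₂, do(a₂)]`: average `Y₂` over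
`U ∼ p_ob(u | x₁, a₁, x₂)` and `ε ∼ p(ε | u, x₁, x₂)`. -/
def cate [StandardBorelSpace 𝒳₂] [StandardBorelSpace 𝒰] [Nonempty 𝒰]
    (s : DTRHist 𝒳₁ 𝒜₁ 𝒳₂ 𝒜₂) : ℝ :=
  ∫ u, (∫ e, (M.f s + e) ∂(M.noise (u, s.1.1.1, s.1.2))) ∂(M.stateConf.condKernel s.1)

/-- Marginal observational law of `(X, A)`. -/
def histLaw : Measure (DTRHist 𝒳₁ 𝒜₁ 𝒳₂ 𝒜₂) := M.obsLaw.map (fun ω => ω.1.hist)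

/-- `σ(Y₁)` -/
abbrev sigmaIV : MeasurableSpace (DTRTrial 𝒳₁ 𝒜₁ 𝒳₂ 𝒜₂ 𝒰) :=
  MeasurableSpace.comap (fun ω => ω.1.y₁) inferInstance

/-- `σ(X, A)` -/
abbrev sigmaHist : MeasurableSpace (DTRTrial 𝒳₁ 𝒜₁ 𝒳₂ 𝒜₂ 𝒰) :=
  MeasurableSpace.comap (fun ω => ω.1.hist) inferInstance

/-- `σ(X, A, Y₁)` -/
abbrev sigmaHistIV : MeasurableSpace (DTRTrial 𝒳₁ 𝒜₁ 𝒳₂ 𝒜₂ 𝒰) :=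
  MeasurableSpace.comap (fun ω => (ω.1.hist, ω.1.y₁)) inferInstance

/-- The argument `(A, Y) = ((A₁, A₂), (Y₁, Y₂))` of the bridge function `h₁`. -/
def ay (ω : DTRTrial 𝒳₁ 𝒜₁ 𝒳₂ 𝒜₂ 𝒰) : (𝒜₁ × 𝒜₂) × (ℝ × ℝ) :=
  ((ω.1.hist.1.1.2, ω.1.hist.2), (ω.1.y₁, M.y₂ ω.1))

/-- `Y₁` is complete over `(X, A)`. -/
def IVComplete : Prop :=
  ∀ σ : DTRHist 𝒳₁ 𝒜₁ 𝒳₂ 𝒜₂ → ℝ, Measurable σ →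
    Integrable (fun ω => σ ω.1.hist) M.obsLaw →
    (M.obsLaw[fun ω => σ ω.1.hist | sigmaIV] =ᵐ[M.obsLaw] 0 ↔
      (fun ω => σ ω.1.hist) =ᵐ[M.obsLaw] 0)

/-- `(h₁, g)` solves the integral equation system
`E[h₁(A, Y) - Y₂ | Y₁] = 0`, `E[g(X, A) - h₁(A, Y) | X, A, Y₁, R = (1, 1)] = 0`. -/
def SolvesIES (h₁ : (𝒜₁ × 𝒜₂) × (ℝ × ℝ) → ℝ) (g : DTRHist 𝒳₁ 𝒜₁ 𝒳₂ 𝒜₂ → ℝ) : Prop :=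
  M.obsLaw[fun ω => h₁ (M.ay ω) - M.y₂ ω.1 | sigmaIV] =ᵐ[M.obsLaw] 0 ∧
  M.completeLaw[fun ω => g ω.1.hist - h₁ (M.ay ω) | sigmaHistIV] =ᵐ[M.completeLaw] 0

/-- What is recorded of a trial. -/
def observe (ω : DTRTrial 𝒳₁ 𝒜₁ 𝒳₂ 𝒜₂ 𝒰) : DTRRecord 𝒳₁ 𝒜₁ 𝒳₂ 𝒜₂ where
  x₁ := if ω.2.1 then some ω.1.hist.1.1.1 else none
  a₁ := ω.1.hist.1.1.2
  x₂ := if ω.2.2 then some ω.1.hist.1.2 else none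
  a₂ := ω.1.hist.2
  y₁ := ω.1.y₁
  y₂ := M.y₂ ω.1

/-- `b₁` is a shift function for `π`: `E[b₁(Y₁) | X, A]` is the density of the law of `(X, A)` under
`π` with respect to the observational one (which in particular exists). -/
def IsShift (π : DTRPolicy 𝒳₁ 𝒜₁ 𝒳₂ 𝒜₂) (b₁ : ℝ → ℝ) : Prop :=
  M.visitLaw π ≪ M.histLaw ∧
  M.obsLaw[fun ω => b₁ ω.1.y₁ | sigmaHist] =ᵐ[M.obsLaw]
    fun ω => ((M.visitLaw π).rnDeriv M.histLaw ω.1.hist).toReal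

/-- `b₂(x, a, y₁) = b₁(y₁) p_ob(x, a, y₁) / p_ob(x, a, y₁ | R = (1, 1))` -/
def shift₂ (b₁ : ℝ → ℝ) (s : DTRHist 𝒳₁ 𝒜₁ 𝒳₂ 𝒜₂ × ℝ) : ℝ :=
  b₁ s.2 * ((M.obsLaw.map (fun ω => (ω.1.hist, ω.1.y₁))).rnDeriv
    (M.completeLaw.map (fun ω => (ω.1.hist, ω.1.y₁))) s).toReal

/-- `‖b₁‖_{μ₁,2} + ‖b₂‖_{μ₂,2}`, possibly infinite. -/
def shiftNorm (b₁ : ℝ → ℝ) : ENNReal :=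
  eLpNorm (fun ω => b₁ ω.1.y₁) 2 M.obsLaw +
    eLpNorm (fun ω => M.shift₂ b₁ (ω.1.hist, ω.1.y₁)) 2 M.completeLaw

end TwoStageDTR

/-! ### Function classes, empirical quantities, critical radius -/

/-- `{w ⬝ φ(·) : ‖w‖₂ ≤ C}` -/
def linClass {α : Type*} {m : ℕ} (φ : α → EuclideanSpace ℝ (Fin m)) (C : ℝ) : Set (α → ℝ) :=
  {h | ∃ w : EuclideanSpace ℝ (Fin m), ‖w‖ ≤ C ∧ h = fun x => inner ℝ w (φ x)}

/-- Frobenius norm. -/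
def frobNorm {m d : ℕ} (W : Matrix (Fin m) (Fin d) ℝ) : ℝ := √(∑ i, ∑ j, W i j ^ 2)

section Empirical

variable {ρ : Type*} {T : ℕ}

/-- Average of `q` over the records of `D` with index in `S`. -/
def empMean (D : Fin T → ρ) (S : Finset (Fin T)) (q : ρ → ℝ) : ℝ :=
  (∑ t ∈ S, q (D t)) / (S.card : ℝ)

/-- Localized empirical Rademacher complexity of `F` on the records of `D` with index in `S`
(the expectation over uniform random signs is a finite average). -/
def localRademacher (D : Fin T → ρ) (S : Finset (Fin T)) (F : Set (ρ → ℝ)) (η : ℝ) : ℝ :=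
  (∑ s : Fin T → ℤˣ, sSup ((fun q : ρ → ℝ =>
      (∑ t ∈ S, ((s t : ℤ) : ℝ) * q (D t)) / (S.card : ℝ)) ''
        {q ∈ F | √(empMean D S fun r => q r ^ 2) ≤ η})) / (2 : ℝ) ^ T

/-- `δ` is a critical radius of the class `F`, whose members take values in `[-c, c]`. -/
def IsCriticalRadius (D : Fin T → ρ) (S : Finset (Fin T)) (F : Set (ρ → ℝ)) (c δ : ℝ) : Prop :=
  0 < δ ∧ localRademacher D S F δ ≤ δ ^ 2 / c

/-- With respect to the confidence parameter `ξ`, `η` bounds the critical radius of the classes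
`Q` (bounded by `c`) and `Θ` (bounded by `c'`) on a nonempty data set, including the deviation term:
`η ≥ K (δ + √(log (K / ξ) / n))` for a common critical radius `δ` of `Q` and `Θ`. -/
def BoundsCriticalRadius (K ξ : ℝ) (D : Fin T → ρ) (S : Finset (Fin T)) (Q Θ : Set (ρ → ℝ))
    (c c' η : ℝ) : Prop :=
  S.Nonempty ∧ ∃ δ, IsCriticalRadius D S Q c δ ∧ IsCriticalRadius D S Θ c' δ ∧
    K * (δ + √(Real.log (K / ξ) / (S.card : ℝ))) ≤ η

end Empirical

/-! ### The CAP algorithm for linear classes -/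

/-- Features and radii of the linear hypothesis classes `𝓗₁ = {w ⬝ φ₁}`, `𝓖 = {w ⬝ φ₂}` and dual
classes `Θ₁ = {β ⬝ ψ₁}`, `Θ₂ = {β ⬝ ψ₂}`. -/
structure DTRFeatures (𝒳₁ 𝒜₁ 𝒳₂ 𝒜₂ : Type*) (m₁ m₂ d₁ d₂ : ℕ) where
  φ₁ : (𝒜₁ × 𝒜₂) × (ℝ × ℝ) → EuclideanSpace ℝ (Fin m₁)
  φ₂ : DTRHist 𝒳₁ 𝒜₁ 𝒳₂ 𝒜₂ → EuclideanSpace ℝ (Fin m₂)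
  ψ₁ : ℝ → EuclideanSpace ℝ (Fin d₁)
  ψ₂ : DTRHist 𝒳₁ 𝒜₁ 𝒳₂ 𝒜₂ × ℝ → EuclideanSpace ℝ (Fin d₂)
  C₁ : ℝ
  C₂ : ℝ
  D₁ : ℝ
  D₂ : ℝ

namespace DTRRecord

variable {𝒳₁ 𝒜₁ 𝒳₂ 𝒜₂ : Type*}

/-- `(A, Y)` of a record. -/
def ay (r : DTRRecord 𝒳₁ 𝒜₁ 𝒳₂ 𝒜₂) : (𝒜₁ × 𝒜₂) × (ℝ × ℝ) := ((r.a₁, r.a₂), (r.y₁, r.y₂))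

/-- `(X, A)` of a record, if no context is missing. -/
def hist? (r : DTRRecord 𝒳₁ 𝒜₁ 𝒳₂ 𝒜₂) : Option (DTRHist 𝒳₁ 𝒜₁ 𝒳₂ 𝒜₂) :=
  match r.x₁, r.x₂ with
  | some x₁, some x₂ => some (((x₁, r.a₁), x₂), r.a₂)
  | _, _ => none

/-- The value of `F` at `(X, A)`; the value `0` at incomplete records is never used. -/
def onHist (F : DTRHist 𝒳₁ 𝒜₁ 𝒳₂ 𝒜₂ → ℝ) (r : DTRRecord 𝒳₁ 𝒜₁ 𝒳₂ 𝒜₂) : ℝ :=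
  (r.hist?.map F).getD 0

/-- The indices `𝓓₂` of the records without missing context. -/
def completeSet {T : ℕ} (D : Fin T → DTRRecord 𝒳₁ 𝒜₁ 𝒳₂ 𝒜₂) : Finset (Fin T) :=
  Finset.univ.filter fun t => (D t).hist?.isSome = true

end DTRRecord

namespace DTRFeatures

variable {𝒳₁ 𝒜₁ 𝒳₂ 𝒜₂ : Type*} {m₁ m₂ d₁ d₂ : ℕ} (L : DTRFeatures 𝒳₁ 𝒜₁ 𝒳₂ 𝒜₂ m₁ m₂ d₁ d₂)

/-- The hypothesis space `𝓗 = 𝓗₁ × 𝓖`. -/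
def hyp : Set (((𝒜₁ × 𝒜₂) × (ℝ × ℝ) → ℝ) × (DTRHist 𝒳₁ 𝒜₁ 𝒳₂ 𝒜₂ → ℝ)) :=
  linClass L.φ₁ L.C₁ ×ˢ linClass L.φ₂ L.C₂

/-- `α₁(h, ·) = h₁(A, Y) - Y₂` on a record. -/
def α₁ (h : ((𝒜₁ × 𝒜₂) × (ℝ × ℝ) → ℝ) × (DTRHist 𝒳₁ 𝒜₁ 𝒳₂ 𝒜₂ → ℝ))
    (r : DTRRecord 𝒳₁ 𝒜₁ 𝒳₂ 𝒜₂) : ℝ := h.1 r.ay - r.y₂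

/-- `α₂(h, ·) = g(X, A) - h₁(A, Y)` on a record without missing context. -/
def α₂ (h : ((𝒜₁ × 𝒜₂) × (ℝ × ℝ) → ℝ) × (DTRHist 𝒳₁ 𝒜₁ 𝒳₂ 𝒜₂ → ℝ))
    (r : DTRRecord 𝒳₁ 𝒜₁ 𝒳₂ 𝒜₂) : ℝ := r.onHist (fun s => h.2 s - h.1 r.ay)

/-- The dual class `Θ₁`, as functions of a record. -/
def Θ₁ : Set (DTRRecord 𝒳₁ 𝒜₁ 𝒳₂ 𝒜₂ → ℝ) :=
  (fun θ r => θ r.y₁) '' linClass L.ψ₁ L.D₁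

/-- The dual class `Θ₂`, as functions of a record without missing context. -/
def Θ₂ : Set (DTRRecord 𝒳₁ 𝒜₁ 𝒳₂ 𝒜₂ → ℝ) :=
  (fun θ r => r.onHist (fun s => θ (s, r.y₁))) '' linClass L.ψ₂ L.D₂

/-- `𝓠₁ = {α₁(h, ·) θ₁}` -/
def Q₁ : Set (DTRRecord 𝒳₁ 𝒜₁ 𝒳₂ 𝒜₂ → ℝ) :=
  Set.image2 (fun h θ r => α₁ h r * θ r) L.hyp L.Θ₁

/-- `𝓠₂ = {α₂(h, ·) θ₂}` -/
def Q₂ : Set (DTRRecord 𝒳₁ 𝒜₁ 𝒳₂ 𝒜₂ → ℝ) :=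
  Set.image2 (fun h θ r => α₂ h r * θ r) L.hyp L.Θ₂

variable {T : ℕ}

/-- The empirical loss `𝓛_𝓓(h)`; `𝓓₁` is the whole data set, `𝓓₂` its complete records. -/
def loss (D : Fin T → DTRRecord 𝒳₁ 𝒜₁ 𝒳₂ 𝒜₂)
    (h : ((𝒜₁ × 𝒜₂) × (ℝ × ℝ) → ℝ) × (DTRHist 𝒳₁ 𝒜₁ 𝒳₂ 𝒜₂ → ℝ)) : ℝ :=
  sSup ((fun θ : DTRRecord 𝒳₁ 𝒜₁ 𝒳₂ 𝒜₂ → ℝ =>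
      empMean D Finset.univ (fun r => α₁ h r * θ r)
        - empMean D Finset.univ (fun r => θ r ^ 2) / 2) '' L.Θ₁) +
  sSup ((fun θ : DTRRecord 𝒳₁ 𝒜₁ 𝒳₂ 𝒜₂ → ℝ =>
      empMean D (DTRRecord.completeSet D) (fun r => α₂ h r * θ r)
        - empMean D (DTRRecord.completeSet D) (fun r => θ r ^ 2) / 2) '' L.Θ₂)

/-- The confidence set for the CATE with threshold `e`. -/
def confSet (D : Fin T → DTRRecord 𝒳₁ 𝒜₁ 𝒳₂ 𝒜₂) (e : ℝ) :
    Set (DTRHist 𝒳₁ 𝒜₁ 𝒳₂ 𝒜₂ → ℝ) :=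
  Prod.snd '' {h ∈ L.hyp | L.loss D h ≤ sInf (L.loss D '' L.hyp) + e}

variable {𝒰 : Type*} [MeasurableSpace 𝒳₁] [MeasurableSpace 𝒜₁] [MeasurableSpace 𝒳₂]
  [MeasurableSpace 𝒜₂] [MeasurableSpace 𝒰]

/-- The pessimistic value `inf_{g ∈ CI} v(g, π)`. -/
def pessValue (M : TwoStageDTR 𝒳₁ 𝒜₁ 𝒳₂ 𝒜₂ 𝒰) (D : Fin T → DTRRecord 𝒳₁ 𝒜₁ 𝒳₂ 𝒜₂) (e : ℝ)
    (π : DTRPolicy 𝒳₁ 𝒜₁ 𝒳₂ 𝒜₂) : ℝ :=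
  sInf ((fun g => M.modelValue g π) '' L.confSet D e)

/-- `π` is an output of CAP on the data `D` with threshold `e` and policy class `Pol`. -/
def IsCAP (M : TwoStageDTR 𝒳₁ 𝒜₁ 𝒳₂ 𝒜₂ 𝒰) (Pol : Set (DTRPolicy 𝒳₁ 𝒜₁ 𝒳₂ 𝒜₂))
    (D : Fin T → DTRRecord 𝒳₁ 𝒜₁ 𝒳₂ 𝒜₂) (e : ℝ) (π : DTRPolicy 𝒳₁ 𝒜₁ 𝒳₂ 𝒜₂) : Prop :=
  π ∈ Pol ∧ ∀ π' ∈ Pol, L.pessValue M D e π' ≤ L.pessValue M D e π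

/-- The features are measurable and have Euclidean norm at most one. -/
structure Regular : Prop where
  measurable_φ₁ : Measurable L.φ₁
  measurable_φ₂ : Measurable L.φ₂
  measurable_ψ₁ : Measurable L.ψ₁
  measurable_ψ₂ : Measurable L.ψ₂
  norm_φ₁ : ∀ s, ‖L.φ₁ s‖ ≤ 1
  norm_φ₂ : ∀ s, ‖L.φ₂ s‖ ≤ 1
  norm_ψ₁ : ∀ s, ‖L.ψ₁ s‖ ≤ 1
  norm_ψ₂ : ∀ s, ‖L.ψ₂ s‖ ≤ 1

/-- The conditional means of the features are linear in the dual features, through matrices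
`W₁`, `W₂`, `W₃`, and the dual radii are large enough. -/
def LinearMoments (M : TwoStageDTR 𝒳₁ 𝒜₁ 𝒳₂ 𝒜₂ 𝒰) : Prop :=
  ∃ (W₁ : Matrix (Fin m₁) (Fin d₁) ℝ) (W₂ : Matrix (Fin m₁) (Fin d₂) ℝ)
    (W₃ : Matrix (Fin m₂) (Fin d₂) ℝ),
    (M.obsLaw[fun ω => L.φ₁ (M.ay ω) | TwoStageDTR.sigmaIV] =ᵐ[M.obsLaw]
      fun ω => W₁.toEuclideanLin (L.ψ₁ ω.1.y₁)) ∧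
    (M.completeLaw[fun ω => L.φ₁ (M.ay ω) | TwoStageDTR.sigmaHistIV] =ᵐ[M.completeLaw]
      fun ω => W₂.toEuclideanLin (L.ψ₂ (ω.1.hist, ω.1.y₁))) ∧
    (M.completeLaw[fun ω => L.φ₂ ω.1.hist | TwoStageDTR.sigmaHistIV] =ᵐ[M.completeLaw]
      fun ω => W₃.toEuclideanLin (L.ψ₂ (ω.1.hist, ω.1.y₁))) ∧
    2 * (L.C₁ * frobNorm W₁) < L.D₁ ∧
    2 * (L.C₁ * frobNorm W₂ + L.C₂ * frobNorm W₃) < L.D₂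

/-- `Lα` bounds the moment functions `α₁ = h₁(A, Y) - Y₂` and `α₂ = g(X, A) - h₁(A, Y)` over the
hypothesis space, almost surely; for `h₁ = 0` this says that the reward `Y₂` is bounded. -/
def BoundsMoments (M : TwoStageDTR 𝒳₁ 𝒜₁ 𝒳₂ 𝒜₂ 𝒰) (Lα : ℝ) : Prop :=
  ∀ h ∈ L.hyp, (∀ᵐ ω ∂M.obsLaw, |h.1 (M.ay ω) - M.y₂ ω.1| ≤ Lα) ∧
    ∀ᵐ ω ∂M.completeLaw, |h.2 ω.1.hist - h.1 (M.ay ω)| ≤ Lα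

/-- The bridge functions exist and are linear: some `h = (h₁, g)` in the hypothesis space solves
the integral equation system. On policies in `Pol` that leave the support of the observational law,
where the system says nothing, `g` is required to be the CATE (this is void for policies whose
law of `(X, A)` is dominated by the observational one). -/
def LinearBridge [StandardBorelSpace 𝒳₂] [StandardBorelSpace 𝒰] [Nonempty 𝒰]
    (M : TwoStageDTR 𝒳₁ 𝒜₁ 𝒳₂ 𝒜₂ 𝒰) (Pol : Set (DTRPolicy 𝒳₁ 𝒜₁ 𝒳₂ 𝒜₂)) : Prop :=
  ∃ h ∈ L.hyp, M.SolvesIES h.1 h.2 ∧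
    ∀ π ∈ Pol, h.2 =ᵐ[(M.visitLaw π).singularPart M.histLaw] M.cate

end DTRFeatures

end

noncomputable section

/-! ### Sums of independent identically distributed vectors -/

/-! The proof combines identification of the CATE, pessimism, and a concentration bound whose error
level is visible in the data.

Identification. Missingness depends only on (X, A), so a moment that vanishes given (X, A, Y₁) among
complete trials vanishes among all trials, as the domination of laws makes the probability of
completeness positive almost everywhere (`condExp_eq_zero_of_completeLaw`). Given (X₁, A₁, X₂), the
reward Y₁ is independent of (U, ε). Hence g* minus the CATE has conditional mean zero given Y₁, and
completeness of Y₁ forces it to vanish (`bridge_ae_eq_cate`). So v^π = v(g*, π) for every policy of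
the class (`value_eq_modelValue`).

Transfer of errors. Let T₁, T₂ be the conditional moments of α₁(h), α₂(h); they are linear in ψ₁, ψ₂
and vanish at the bridge functions. The difference v(g*, π*) - v(g, π*) is a pairing of T₁, T₂ with
the shift functions, so Cauchy-Schwarz bounds it by ‖T₁‖‖b₁‖ + ‖T₂‖‖b₂‖ (`shift_bound`).

Pessimism. If the empirical moments are accurate up to levels s₁, s₂ with s₁ + s₂ ≤ e, the empirical
loss is comparable to ‖T₁‖² + ‖T₂‖² up to s₁ + s₂. Then g* lies in the confidence set and every
member of it has ‖T₁‖², ‖T₂‖² ≤ 9e. The pessimistic value of the output is at most its true value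
and at least that of π*, which is close to v^{π*} (`subOpt_le`).

Concentration. All moments are bilinear in a weight w and a dual coefficient β. After whitening ψ by
its second moment plus l times the identity, they are inner products with one bounded random tensor.
The Hilbert space Bernstein inequality `measure_pi_norm_sum_ge_le` controls its sum through the weak
variance alone, provided the effective dimension at level l is at most c²nl/2. `exists_level` picks
an essentially minimal such l. Either l is the deviation level 16τ/(c²n), or the effective dimension
is of order c²nl; in the latter case Khintchine's inequality on the sample shows that every
empirical critical radius δ of the dual class (radius r) satisfies c²lr² ≤ 256δ²
(`level_le_of_isCriticalRadius`). The good event involves no η and no threshold, so (a) holds for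
all of them at once. As the effective dimension is at most d, the level is also of order (τ + d)/n,
which gives (c). Given which trials are complete, these are independent draws from μ₂
(`measure_pi_selected_bad_le`).

Part (b) is a grid approximation with Massart's bound (`isCriticalRadius_of_lipschitz`). -/

theorem lintegral_pi_sum_le {ι Ω H : Type*} [Fintype ι] [MeasurableSpace Ω] (μ : Measure Ω)
    [IsProbabilityMeasure μ] [AddCommMonoid H] [MeasurableSpace H] [MeasurableAdd₂ H]
    {V : Ω → H} (hV : Measurable V) {Φ : H → ENNReal} (hΦ : Measurable Φ) (c : ENNReal)
    (h : ∀ u, ∫⁻ x, Φ (u + V x) ∂μ ≤ c * Φ u) :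
    ∫⁻ ω, Φ (∑ t, V (ω t)) ∂(Measure.pi fun _ : ι => μ) ≤ c ^ Fintype.card ι * Φ 0 := by
  classical
  have hm : ∀ s : Finset ι, Measurable fun ω : ι → Ω => Φ (∑ t ∈ s, V (ω t)) := fun s =>
    hΦ.comp (Finset.measurable_fun_sum s fun t _ => hV.comp (measurable_pi_apply t))
  -- The coordinates are integrated out one at a time; each costs a factor `c` by the one-step
  -- hypothesis. This replaces a supermartingale argument.
  have key : ∀ (s : Finset ι) (x : ι → Ω),
      lmarginal (fun _ => μ) s (fun ω => Φ (∑ t ∈ s, V (ω t))) x ≤ c ^ s.card * Φ 0 := by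
    intro s
    induction s using Finset.induction_on with
    | empty => intro x; simp
    | insert i s hi ih =>
      intro x
      rw [lmarginal_insert' _ (hm _) hi]
      calc _ ≤ lmarginal (fun _ => μ) s (fun ω => c * Φ (∑ t ∈ s, V (ω t))) x := by
            refine lmarginal_mono (fun ω => ?_) x
            refine le_trans (le_of_eq ?_) (h (∑ t ∈ s, V (ω t)))
            refine lintegral_congr fun y => ?_
            rw [Finset.sum_insert hi, add_comm]
            congr 2
            · refine Finset.sum_congr rfl fun t ht => ?_
              rw [Function.update_of_ne (fun (h : t = i) => hi (h ▸ ht))]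
            · simp
        _ = c * lmarginal (fun _ => μ) s (fun ω => Φ (∑ t ∈ s, V (ω t))) x := by
            simp only [lmarginal]
            rw [lintegral_const_mul]
            exact (hm s).comp (measurable_updateFinset)
        _ ≤ c * (c ^ s.card * Φ 0) := by gcongr; exact ih x
        _ = _ := by rw [Finset.card_insert_of_notMem hi, pow_succ]; ring
  by_cases hne : Nonempty (ι → Ω)
  · obtain ⟨x⟩ := hne
    have := key Finset.univ x
    rwa [lmarginal_univ, Finset.card_univ] at this
  · rw [not_nonempty_iff] at hne
    simp [Measure.eq_zero_of_isEmpty]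

theorem exp_le_one_add_add_sq {x : ℝ} (hx : |x| ≤ 1) : Real.exp x ≤ 1 + x + x ^ 2 := by
  have := Real.abs_exp_sub_one_sub_id_le hx
  linarith [abs_le.1 this]

/-- Increment of `√(R² + ‖s‖²)`. -/
theorem sqrt_add_norm_sq_add_le {H : Type*} [NormedAddCommGroup H] [InnerProductSpace ℝ H]
    {R : ℝ} (hR : 0 < R) (s x : H) :
    √(R ^ 2 + ‖s + x‖ ^ 2) ≤ √(R ^ 2 + ‖s‖ ^ 2)
      + (inner ℝ ((√(R ^ 2 + ‖s‖ ^ 2))⁻¹ • s) x + ‖x‖ ^ 2 / (2 * R)) := by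
  set G := √(R ^ 2 + ‖s‖ ^ 2) with hG
  have hG2 : G ^ 2 = R ^ 2 + ‖s‖ ^ 2 := Real.sq_sqrt (by positivity)
  have hGR : R ≤ G := Real.le_sqrt_of_sq_le (by nlinarith [sq_nonneg ‖s‖])
  have hG0 : 0 < G := hR.trans_le hGR
  rw [real_inner_smul_left]
  have h1 : √(R ^ 2 + ‖s + x‖ ^ 2) ≤ G + (G⁻¹ * inner ℝ s x + ‖x‖ ^ 2 / (2 * G)) := by
    have e : G + (G⁻¹ * inner ℝ s x + ‖x‖ ^ 2 / (2 * G))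
        = (2 * G ^ 2 + 2 * inner ℝ s x + ‖x‖ ^ 2) / (2 * G) := by
      field_simp
      ring
    have hsq : ‖s + x‖ ^ 2 = ‖s‖ ^ 2 + 2 * inner ℝ s x + ‖x‖ ^ 2 := norm_add_sq_real s x
    rw [e, show 2 * G ^ 2 + 2 * inner ℝ s x + ‖x‖ ^ 2 = G ^ 2 + (R ^ 2 + ‖s + x‖ ^ 2) by
      rw [hsq]; linarith]
    -- What remains is the tangent bound for the square root: a square of a difference is
    -- nonnegative.
    rw [le_div_iff₀ (by positivity)]
    nlinarith [sq_nonneg (√(R ^ 2 + ‖s + x‖ ^ 2) - G),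
      Real.sq_sqrt (show 0 ≤ R ^ 2 + ‖s + x‖ ^ 2 by positivity)]
  refine h1.trans ?_
  have : ‖x‖ ^ 2 / (2 * G) ≤ ‖x‖ ^ 2 / (2 * R) := by gcongr
  linarith

/-- One step of the exponential supermartingale for sums in a Hilbert space. -/
theorem integral_exp_sqrt_step {Ω H : Type*} [MeasurableSpace Ω] (μ : Measure Ω)
    [IsProbabilityMeasure μ] [NormedAddCommGroup H] [InnerProductSpace ℝ H] [CompleteSpace H]
    [MeasurableSpace H] [BorelSpace H] [SecondCountableTopology H]
    {X : Ω → H} (hX : Measurable X) (hb : ∀ᵐ x ∂μ, ‖X x‖ ≤ 2) (h0 : ∫ x, X x ∂μ = 0)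
    {l V R b : ℝ} (hl : ∀ B : H, ∫ x, inner ℝ B (X x) ^ 2 ∂μ ≤ l * ‖B‖ ^ 2)
    (hV : ∫ x, ‖X x‖ ^ 2 ∂μ ≤ V) (hl0 : 0 ≤ l) (hR : 1 ≤ R) (hb0 : 0 ≤ b) (hb1 : b ≤ 1 / 4) (u : H) :
    ∫⁻ x, ENNReal.ofReal (Real.exp (b * √(R ^ 2 + ‖u + X x‖ ^ 2))) ∂μ
      ≤ ENNReal.ofReal (Real.exp (b * V / (2 * R) + 2 * b ^ 2 * l + 2 * b ^ 2 * V / R ^ 2))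
        * ENNReal.ofReal (Real.exp (b * √(R ^ 2 + ‖u‖ ^ 2))) := by
  have hR0 : 0 < R := by linarith
  set G := √(R ^ 2 + ‖u‖ ^ 2) with hG
  have hG2 : G ^ 2 = R ^ 2 + ‖u‖ ^ 2 := Real.sq_sqrt (by positivity)
  have hG0 : 0 < G := Real.sqrt_pos.2 (by positivity)
  set v : H := G⁻¹ • u with hv
  have hv1 : ‖v‖ ≤ 1 := by
    rw [hv, norm_smul, norm_inv, Real.norm_of_nonneg hG0.le, inv_mul_le_iff₀ hG0, mul_one]
    nlinarith [norm_nonneg u]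
  have hXi : Integrable X μ := Integrable.of_bound hX.aestronglyMeasurable 2 hb
  have hin : Integrable (fun x => inner ℝ v (X x)) μ := hXi.const_inner v
  have hin2 : Integrable (fun x => inner ℝ v (X x) ^ 2) μ := by
    refine Integrable.of_bound (by fun_prop) 4 ?_
    filter_upwards [hb] with x hx
    have := abs_real_inner_le_norm v (X x)
    have h2 : |inner ℝ v (X x)| ≤ 2 := by nlinarith [norm_nonneg v, norm_nonneg (X x)]
    rw [Real.norm_eq_abs, abs_pow]
    nlinarith [abs_nonneg (inner ℝ v (X x))]
  have hn2 : Integrable (fun x => ‖X x‖ ^ 2) μ := by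
    refine Integrable.of_bound (by fun_prop) 4 ?_
    filter_upwards [hb] with x hx
    rw [Real.norm_eq_abs, abs_pow, abs_norm]
    nlinarith [norm_nonneg (X x)]
  -- The increment is at most `p + q / (2R)`, of absolute value at most 4, so `b ≤ 1/4` keeps the
  -- exponent in `[-1, 1]`, where exp x ≤ 1 + x + x². After integration the linear term vanishes,
  -- `p²` costs only the weak variance `l`, and the strong variance `V` appears divided by `R` or
  -- `R²`.
  have hpt : ∀ᵐ x ∂μ, Real.exp (b * √(R ^ 2 + ‖u + X x‖ ^ 2)) ≤
      Real.exp (b * G) * (1 + (b * inner ℝ v (X x) + b / (2 * R) * ‖X x‖ ^ 2)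
        + (2 * b ^ 2 * inner ℝ v (X x) ^ 2 + 2 * b ^ 2 / R ^ 2 * ‖X x‖ ^ 2)) := by
    filter_upwards [hb] with x hx
    have hstep := sqrt_add_norm_sq_add_le hR0 u (X x)
    rw [← hG, ← hv] at hstep
    set p := inner ℝ v (X x) with hp
    set q := ‖X x‖ ^ 2 with hq
    have hq4 : q ≤ 4 := by rw [hq]; nlinarith [norm_nonneg (X x)]
    have hq0 : 0 ≤ q := by positivity
    have hp2 : |p| ≤ 2 := by
      have := abs_real_inner_le_norm v (X x)
      nlinarith [norm_nonneg v, norm_nonneg (X x)]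
    have hqR : q / (2 * R) ≤ 2 := by
      rw [div_le_iff₀ (by positivity)]; nlinarith
    have hqR0 : 0 ≤ q / (2 * R) := by positivity
    have hy : |b * (p + q / (2 * R))| ≤ 1 := by
      rw [abs_mul, abs_of_nonneg hb0]
      have : |p + q / (2 * R)| ≤ 4 := by
        refine (abs_add_le _ _).trans ?_
        rw [abs_of_nonneg hqR0]; linarith
      nlinarith [abs_nonneg (p + q / (2 * R))]
    calc Real.exp (b * √(R ^ 2 + ‖u + X x‖ ^ 2))
        ≤ Real.exp (b * G + b * (p + q / (2 * R))) := by
          apply Real.exp_le_exp.2; nlinarith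
      _ = Real.exp (b * G) * Real.exp (b * (p + q / (2 * R))) := Real.exp_add _ _
      _ ≤ Real.exp (b * G) * (1 + b * (p + q / (2 * R)) + (b * (p + q / (2 * R))) ^ 2) := by
          gcongr; exact exp_le_one_add_add_sq hy
      _ ≤ _ := by
          gcongr ?_ * ?_
          have e1 : b * (p + q / (2 * R)) = b * p + b / (2 * R) * q := by ring
          have e2 : (q / (2 * R)) ^ 2 ≤ q / R ^ 2 := by
            rw [div_pow, div_le_div_iff₀ (by positivity) (by positivity)]
            nlinarith [mul_nonneg hq0 (sq_nonneg R), mul_nonneg (mul_nonneg hq0 (sq_nonneg R)) (sub_nonneg.2 hq4)]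
          have e3 : (b * (p + q / (2 * R))) ^ 2 ≤ 2 * b ^ 2 * p ^ 2 + 2 * b ^ 2 * (q / R ^ 2) := by
            nlinarith [sq_nonneg (p - q / (2 * R)), sq_nonneg b,
              mul_nonneg (sq_nonneg b) (sq_nonneg (p - q / (2 * R))),
              mul_nonneg (sq_nonneg b) (sub_nonneg.2 e2)]
          have e4 : 2 * b ^ 2 / R ^ 2 * q = 2 * b ^ 2 * (q / R ^ 2) := by ring
          rw [e1, e4]
          rw [e1] at e3
          linarith
  have hint : Integrable (fun x => Real.exp (b * G) * (1 + (b * inner ℝ v (X x) + b / (2 * R) * ‖X x‖ ^ 2)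
        + (2 * b ^ 2 * inner ℝ v (X x) ^ 2 + 2 * b ^ 2 / R ^ 2 * ‖X x‖ ^ 2))) μ :=
    (((integrable_const _).add ((hin.const_mul _).add (hn2.const_mul _))).add
      ((hin2.const_mul _).add (hn2.const_mul _))).const_mul _
  calc ∫⁻ x, ENNReal.ofReal (Real.exp (b * √(R ^ 2 + ‖u + X x‖ ^ 2))) ∂μ
      ≤ ∫⁻ x, ENNReal.ofReal (Real.exp (b * G) * (1 + (b * inner ℝ v (X x) + b / (2 * R) * ‖X x‖ ^ 2)
        + (2 * b ^ 2 * inner ℝ v (X x) ^ 2 + 2 * b ^ 2 / R ^ 2 * ‖X x‖ ^ 2))) ∂μ :=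
        lintegral_mono_ae (hpt.mono fun x hx => ENNReal.ofReal_le_ofReal hx)
    _ = ENNReal.ofReal (∫ x, Real.exp (b * G) * (1 + (b * inner ℝ v (X x) + b / (2 * R) * ‖X x‖ ^ 2)
        + (2 * b ^ 2 * inner ℝ v (X x) ^ 2 + 2 * b ^ 2 / R ^ 2 * ‖X x‖ ^ 2)) ∂μ) := by
        rw [ofReal_integral_eq_lintegral_ofReal hint]
        filter_upwards [hpt] with x hx
        exact (Real.exp_pos _).le.trans hx
    _ ≤ _ := by
        rw [← ENNReal.ofReal_mul (Real.exp_pos _).le]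
        apply ENNReal.ofReal_le_ofReal
        rw [integral_const_mul, integral_add ((integrable_const _).fun_add
          ((hin.const_mul _).fun_add (hn2.const_mul _))) ((hin2.const_mul _).fun_add (hn2.const_mul _)),
          integral_add (integrable_const _) ((hin.const_mul _).fun_add (hn2.const_mul _)),
          integral_add (hin.const_mul _) (hn2.const_mul _),
          integral_add (hin2.const_mul _) (hn2.const_mul _)]
        simp only [integral_const_mul, integral_const, probReal_univ, one_smul]
        rw [integral_inner hXi, h0, inner_zero_right, mul_comm (Real.exp _)]
        gcongr ?_ * _
        have hlv := hl v
        have hlv' : l * ‖v‖ ^ 2 ≤ l := by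
          have : ‖v‖ ^ 2 ≤ 1 := by nlinarith [norm_nonneg v]
          nlinarith
        refine le_trans ?_ (Real.add_one_le_exp _)
        have t1 : b / (2 * R) * ∫ x, ‖X x‖ ^ 2 ∂μ ≤ b * V / (2 * R) := by
          rw [mul_div_right_comm]
          exact mul_le_mul_of_nonneg_left hV (by positivity)
        have t2 : 2 * b ^ 2 / R ^ 2 * ∫ x, ‖X x‖ ^ 2 ∂μ ≤ 2 * b ^ 2 * V / R ^ 2 := by
          rw [show 2 * b ^ 2 * V / R ^ 2 = 2 * b ^ 2 / R ^ 2 * V by ring]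
          exact mul_le_mul_of_nonneg_left hV (by positivity)
        have t3 : 2 * b ^ 2 * ∫ x, inner ℝ v (X x) ^ 2 ∂μ ≤ 2 * b ^ 2 * l := by
          gcongr; linarith
        linarith

/-- A Bernstein inequality for sums of independent vectors in a Hilbert space that involves only the
weak variance `l`, provided that the effective dimension is small. -/
theorem measure_pi_norm_sum_ge_le {ι Ω H : Type*} [Fintype ι] [MeasurableSpace Ω] (μ : Measure Ω)
    [IsProbabilityMeasure μ] [NormedAddCommGroup H] [InnerProductSpace ℝ H] [CompleteSpace H]
    [MeasurableSpace H] [BorelSpace H] [SecondCountableTopology H]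
    {W : Ω → H} (hW : Measurable W) (hb : ∀ᵐ x ∂μ, ‖W x‖ ≤ 1)
    {l V c : ℝ} (hl : ∀ B : H, ∫ x, inner ℝ B (W x) ^ 2 ∂μ ≤ l * ‖B‖ ^ 2)
    (hV : ∫ x, ‖W x‖ ^ 2 ∂μ ≤ V) (hl0 : 0 ≤ l) (hc : 0 < c) (hc1 : c ≤ 1)
    (hR : 1 ≤ c * (Fintype.card ι * l)) (hVl : Fintype.card ι * V ≤ c ^ 2 / 2 * (Fintype.card ι * l) ^ 2) :
    (Measure.pi fun _ : ι => μ)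
        {ω | 3 * (c * (Fintype.card ι * l)) ≤ ‖∑ t, (W (ω t) - ∫ x, W x ∂μ)‖}
      ≤ ENNReal.ofReal (Real.exp (-(c ^ 2 * (Fintype.card ι * l) / 4))) := by
  set n : ℝ := (Fintype.card ι : ℝ) with hn
  -- With `b = c/4` the three exponents of the one-step bound, summed over the sample, are at most
  -- bR/4, bR/2 and bR/4. The starting value contributes bR and Markov's inequality is applied at
  -- 3bR, which leaves -bR, that is -c²nl/4.
  set R := c * (n * l) with hRdef
  set b := c / 4 with hbdef
  have hWi : Integrable W μ := Integrable.of_bound hW.aestronglyMeasurable 1 hb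
  set X : Ω → H := fun x => W x - ∫ x, W x ∂μ with hXdef
  have hX : Measurable X := hW.sub_const _
  have hEW : ‖∫ x, W x ∂μ‖ ≤ 1 := by
    refine (norm_integral_le_of_norm_le_const hb).trans (by simp)
  have hXb : ∀ᵐ x ∂μ, ‖X x‖ ≤ 2 := by
    filter_upwards [hb] with x hx
    exact (norm_sub_le _ _).trans (by linarith)
  have hX0 : ∫ x, X x ∂μ = 0 := by
    rw [hXdef, integral_sub hWi (integrable_const _)]; simp
  have hXl : ∀ B : H, ∫ x, inner ℝ B (X x) ^ 2 ∂μ ≤ l * ‖B‖ ^ 2 := by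
    intro B
    refine le_trans ?_ (hl B)
    have hi : Integrable (fun x => inner ℝ B (W x)) μ := hWi.const_inner B
    have hi2 : Integrable (fun x => inner ℝ B (W x) ^ 2) μ := by
      refine Integrable.of_bound (by fun_prop) (‖B‖ ^ 2) ?_
      filter_upwards [hb] with x hx
      rw [Real.norm_eq_abs, abs_pow]
      have := abs_real_inner_le_norm B (W x)
      have h2 : |inner ℝ B (W x)| ≤ ‖B‖ := by nlinarith [norm_nonneg B, norm_nonneg (W x)]
      gcongr
    have e : ∀ x, inner ℝ B (X x) ^ 2 = inner ℝ B (W x) ^ 2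
        - 2 * inner ℝ B (∫ x, W x ∂μ) * inner ℝ B (W x) + inner ℝ B (∫ x, W x ∂μ) ^ 2 := by
      intro x; simp only [hXdef, inner_sub_right]; ring
    simp only [e]
    rw [integral_add (hi2.sub' (hi.const_mul _)) (integrable_const _), integral_sub hi2 (hi.const_mul _),
      integral_const_mul, integral_inner hWi]
    simp
    nlinarith [sq_nonneg (inner ℝ B (∫ x, W x ∂μ))]
  have hXV : ∫ x, ‖X x‖ ^ 2 ∂μ ≤ V := by
    refine le_trans ?_ hV
    have hi2 : Integrable (fun x => ‖W x‖ ^ 2) μ := by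
      refine Integrable.of_bound (by fun_prop) 1 ?_
      filter_upwards [hb] with x hx
      rw [Real.norm_eq_abs, abs_pow, abs_norm]
      nlinarith [norm_nonneg (W x)]
    have hi : Integrable (fun x => inner ℝ (∫ x, W x ∂μ) (W x)) μ := hWi.const_inner _
    have e : ∀ x, ‖X x‖ ^ 2 = ‖W x‖ ^ 2 - 2 * inner ℝ (∫ x, W x ∂μ) (W x) + ‖∫ x, W x ∂μ‖ ^ 2 := by
      intro x; simp only [hXdef]; rw [norm_sub_sq_real, real_inner_comm]
    simp only [e]
    rw [integral_add (hi2.sub' (hi.const_mul _)) (integrable_const _), integral_sub hi2 (hi.const_mul _),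
      integral_const_mul, integral_inner hWi]
    simp
    linarith [sq_nonneg ‖∫ x, W x ∂μ‖]
  have hb0 : 0 < b := by positivity
  have hb1 : b ≤ 1 / 4 := by rw [hbdef]; linarith
  have hR0 : 0 < R := by linarith
  have hV0 : 0 ≤ V := le_trans (integral_nonneg fun x => by positivity) hV
  have key := lintegral_pi_sum_le (ι := ι) μ hX
    (Φ := fun u => ENNReal.ofReal (Real.exp (b * √(R ^ 2 + ‖u‖ ^ 2)))) (by fun_prop) _
    (integral_exp_sqrt_step μ hX hXb hX0 hXl hXV hl0 hR hb0.le hb1)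
  rw [← ENNReal.ofReal_pow (Real.exp_pos _).le, ← Real.exp_nat_mul, ← ENNReal.ofReal_mul (Real.exp_pos _).le,
    ← Real.exp_add, norm_zero, ← hn] at key
  have hsub : {ω : ι → Ω | 3 * R ≤ ‖∑ t, X (ω t)‖} ⊆
      {ω | ENNReal.ofReal (Real.exp (b * (3 * R))) ≤
        ENNReal.ofReal (Real.exp (b * √(R ^ 2 + ‖∑ t, X (ω t)‖ ^ 2)))} := by
    intro ω hω
    simp only [Set.mem_ofPred_eq] at hω ⊢
    refine ENNReal.ofReal_le_ofReal (Real.exp_le_exp.2 ?_)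
    gcongr
    refine Real.le_sqrt_of_sq_le ?_
    nlinarith
  have hmeas : Measurable fun ω : ι → Ω => ∑ t, X (ω t) :=
    Finset.measurable_fun_sum _ fun t _ => hX.comp (measurable_pi_apply t)
  have hmark := mul_meas_ge_le_lintegral₀ (μ := Measure.pi fun _ : ι => μ)
    (f := fun ω => ENNReal.ofReal (Real.exp (b * √(R ^ 2 + ‖∑ t, X (ω t)‖ ^ 2))))
    (((((hmeas.norm.pow_const 2).const_add _).sqrt.const_mul b).exp).ennreal_ofReal.aemeasurable)
    (ENNReal.ofReal (Real.exp (b * (3 * R))))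
  have h1 := (mul_le_mul_right (measure_mono (μ := Measure.pi fun _ : ι => μ) hsub)
    (ENNReal.ofReal (Real.exp (b * (3 * R))))).trans (hmark.trans key)
  have h2 := mul_le_mul_right h1 (ENNReal.ofReal (Real.exp (-(b * (3 * R)))))
  rw [← mul_assoc, ← ENNReal.ofReal_mul (Real.exp_pos _).le, ← Real.exp_add, neg_add_cancel,
    Real.exp_zero, ENNReal.ofReal_one, one_mul, ← ENNReal.ofReal_mul (Real.exp_pos _).le,
    ← Real.exp_add] at h2
  refine h2.trans (ENNReal.ofReal_le_ofReal (Real.exp_le_exp.2 ?_))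
  have e0 : √(R ^ 2 + 0 ^ 2) = R := by
    rw [zero_pow two_ne_zero, add_zero, Real.sqrt_sq hR0.le]
  rw [e0]
  have hnV : n * V ≤ R ^ 2 / 2 := by rw [hRdef]; nlinarith
  have hnl : n * l = R / c := by rw [hRdef]; field_simp
  have t1 : n * (b * V / (2 * R)) ≤ b * R / 4 := by
    rw [show n * (b * V / (2 * R)) = b * (n * V) / (2 * R) by ring, div_le_iff₀ (by positivity)]
    nlinarith
  have t2 : n * (2 * b ^ 2 * l) = b * R / 2 := by
    rw [show n * (2 * b ^ 2 * l) = 2 * b ^ 2 * (n * l) by ring, hnl, hbdef]; field_simp; ring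
  have t3 : n * (2 * b ^ 2 * V / R ^ 2) ≤ b * R / 4 := by
    rw [show n * (2 * b ^ 2 * V / R ^ 2) = 2 * b ^ 2 * (n * V) / R ^ 2 by ring,
      div_le_iff₀ (by positivity)]
    have : 2 * b ^ 2 * (n * V) ≤ b ^ 2 * R ^ 2 := by nlinarith [sq_nonneg b]
    have h4 : b ^ 2 * R ^ 2 ≤ b * (1 / 4) * R ^ 2 := by
      have : b ^ 2 ≤ b * (1 / 4) := by nlinarith
      gcongr
    have h5 : b * (1 / 4) * R ^ 2 ≤ b * R / 4 * R ^ 2 := by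
      have : b * (1 / 4) ≤ b * R / 4 := by nlinarith
      gcongr
    linarith
  have t4 : c ^ 2 * (n * l) / 4 = b * R := by rw [hRdef, hbdef]; ring
  rw [t4]
  nlinarith

/-! ### Whitened features -/

/-- The operator v ↦ ∫ ⟨ψ, v⟩ ψ is symmetric, so an eigenbasis makes the coordinates of ψ orthogonal
in L². The eigenvalues are integrals of squares. -/
theorem exists_orthonormalBasis_second_moment {Ω : Type*} [MeasurableSpace Ω] (μ : Measure Ω)
    [IsProbabilityMeasure μ] {d : ℕ} {ψ : Ω → EuclideanSpace ℝ (Fin d)} (hψ : Measurable ψ)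
    (hb : ∀ x, ‖ψ x‖ ≤ 1) :
    ∃ (e : OrthonormalBasis (Fin d) ℝ (EuclideanSpace ℝ (Fin d))) (s : Fin d → ℝ),
      (∀ i, 0 ≤ s i) ∧
      ∀ i j, ∫ x, inner ℝ (e i) (ψ x) * inner ℝ (e j) (ψ x) ∂μ = if i = j then s i else 0 := by
  have hint : ∀ v, Integrable (fun x => inner ℝ (ψ x) v • ψ x) μ := by
    intro v
    refine Integrable.of_bound (by fun_prop) (‖v‖) (Filter.Eventually.of_forall fun x => ?_)
    rw [norm_smul]
    have := norm_inner_le_norm (𝕜 := ℝ) (ψ x) v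
    have h1 := hb x
    have : ‖inner ℝ (ψ x) v‖ ≤ ‖v‖ := by nlinarith [norm_nonneg v, norm_nonneg (ψ x)]
    nlinarith [norm_nonneg (inner ℝ (ψ x) v), norm_nonneg (ψ x)]
  let G : EuclideanSpace ℝ (Fin d) →ₗ[ℝ] EuclideanSpace ℝ (Fin d) :=
    { toFun := fun v => ∫ x, inner ℝ (ψ x) v • ψ x ∂μ
      map_add' := fun v w => by
        rw [← integral_add (hint v) (hint w)]
        simp only [inner_add_right, add_smul]
      map_smul' := fun a v => by
        simp only [inner_smul_right, mul_smul, RingHom.id_apply]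
        rw [integral_smul] }
  have hG : ∀ v w, inner ℝ v (G w) = ∫ x, inner ℝ v (ψ x) * inner ℝ w (ψ x) ∂μ := by
    intro v w
    change inner ℝ v (∫ x, inner ℝ (ψ x) w • ψ x ∂μ) = _
    rw [← integral_inner (hint w)]
    refine integral_congr_ae (Filter.Eventually.of_forall fun x => ?_)
    simp only [inner_smul_right, real_inner_comm w (ψ x)]
    ring
  have hsym : G.IsSymmetric := by
    intro v w
    rw [real_inner_comm, hG, hG]
    simp only [mul_comm]
  have hn : Module.finrank ℝ (EuclideanSpace ℝ (Fin d)) = d := by simp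
  refine ⟨hsym.eigenvectorBasis hn, hsym.eigenvalues hn, fun i => ?_, fun i j => ?_⟩
  · have h1 : inner ℝ (hsym.eigenvectorBasis hn i) (G (hsym.eigenvectorBasis hn i))
        = hsym.eigenvalues hn i := by
      rw [hsym.apply_eigenvectorBasis hn i, inner_smul_right, real_inner_self_eq_norm_sq]
      simp
    rw [← h1, hG]
    exact integral_nonneg fun x => mul_self_nonneg _
  · rw [← hG, hsym.apply_eigenvectorBasis hn j, inner_smul_right,
      (hsym.eigenvectorBasis hn).inner_eq_ite]
    split_ifs with h
    · simp [h]
    · simp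

section Whitening

variable {d : ℕ} (e : OrthonormalBasis (Fin d) ℝ (EuclideanSpace ℝ (Fin d))) (s : Fin d → ℝ) (l : ℝ)

/-- The feature `v` in the coordinates that make `∫ ⟪β, ψ⟫² + l ‖β‖²` the Euclidean norm. -/
def whiten (v : EuclideanSpace ℝ (Fin d)) : EuclideanSpace ℝ (Fin d) :=
  WithLp.toLp 2 fun j => inner ℝ (e j) v / √(s j + l)

/-- The coefficient vector dual to `whiten`. -/
def coWhiten (β : EuclideanSpace ℝ (Fin d)) : EuclideanSpace ℝ (Fin d) :=
  WithLp.toLp 2 fun j => √(s j + l) * inner ℝ (e j) β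

/-- The effective dimension of a covariance with eigenvalues `s` at level `l`. -/
def effDim {d : ℕ} (s : Fin d → ℝ) (l : ℝ) : ℝ := ∑ j, s j / (s j + l)

theorem measurable_whiten : Measurable (whiten e s l) := by
  unfold whiten
  refine (WithLp.measurable_toLp 2 _).comp (measurable_pi_lambda _ fun j => ?_)
  fun_prop

variable {s l}

theorem inner_coWhiten_whiten (hs : ∀ i, 0 ≤ s i) (hl : 0 < l) (β v : EuclideanSpace ℝ (Fin d)) :
    inner ℝ (coWhiten e s l β) (whiten e s l v) = inner ℝ β v := by
  rw [← e.sum_inner_mul_inner β v, PiLp.inner_apply]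
  refine Finset.sum_congr rfl fun j _ => ?_
  have : √(s j + l) ≠ 0 := (Real.sqrt_pos.2 (by linarith [hs j])).ne'
  simp only [whiten, coWhiten, RCLike.inner_apply, conj_trivial]
  rw [real_inner_comm β (e j)]
  field_simp

/-- Lets the dual coefficient be prescribed in whitened coordinates, as needed to align it with a
Rademacher sum. -/
theorem coWhiten_surjective (hs : ∀ i, 0 ≤ s i) (hl : 0 < l) :
    Function.Surjective (coWhiten e s l) := by
  intro b
  refine ⟨∑ j, (b j / √(s j + l)) • e j, ?_⟩
  ext j
  have : √(s j + l) ≠ 0 := (Real.sqrt_pos.2 (by linarith [hs j])).ne'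
  simp only [coWhiten, e.orthonormal.inner_right_fintype]
  field_simp

theorem norm_whiten_sq_le (hs : ∀ i, 0 ≤ s i) (hl : 0 < l) (v : EuclideanSpace ℝ (Fin d)) :
    l * ‖whiten e s l v‖ ^ 2 ≤ ‖v‖ ^ 2 := by
  rw [EuclideanSpace.norm_sq_eq, ← e.sum_sq_norm_inner_right v, Finset.mul_sum]
  refine Finset.sum_le_sum fun j _ => ?_
  have h0 : 0 < s j + l := by linarith [hs j]
  simp only [whiten, norm_div, div_pow]
  rw [Real.norm_of_nonneg (Real.sqrt_nonneg _), Real.sq_sqrt h0.le, mul_div_assoc',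
    div_le_iff₀ h0]
  nlinarith [hs j, sq_nonneg ‖inner ℝ (e j) v‖]

section Moments

variable {Ω : Type*} [MeasurableSpace Ω] {μ : Measure Ω} [IsProbabilityMeasure μ]
  {ψ : Ω → EuclideanSpace ℝ (Fin d)}

theorem integrable_inner_mul_inner {d₁ d₂ : Type*} [Fintype d₁] [Fintype d₂]
    {φ : Ω → EuclideanSpace ℝ d₁} {χ : Ω → EuclideanSpace ℝ d₂} (hφ : Measurable φ)
    (hχ : Measurable χ) {C D : ℝ} (hC : ∀ᵐ x ∂μ, ‖φ x‖ ≤ C) (hD : ∀ᵐ x ∂μ, ‖χ x‖ ≤ D)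
    (v : EuclideanSpace ℝ d₁) (w : EuclideanSpace ℝ d₂) :
    Integrable (fun x => inner ℝ v (φ x) * inner ℝ w (χ x)) μ := by
  refine Integrable.of_bound (by fun_prop) (‖v‖ * C * (‖w‖ * D)) ?_
  filter_upwards [hC, hD] with x h1 h2
  rw [norm_mul]
  have a1 : ‖inner ℝ v (φ x)‖ ≤ ‖v‖ * C := (norm_inner_le_norm _ _).trans (by gcongr)
  have a2 : ‖inner ℝ w (χ x)‖ ≤ ‖w‖ * D := (norm_inner_le_norm _ _).trans (by gcongr)
  exact mul_le_mul a1 a2 (norm_nonneg _) ((norm_nonneg _).trans a1)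

variable (hψ : Measurable ψ) (hb : ∀ x, ‖ψ x‖ ≤ 1)
  (he : ∀ i j, ∫ x, inner ℝ (e i) (ψ x) * inner ℝ (e j) (ψ x) ∂μ = if i = j then s i else 0)
include hψ hb he

theorem integral_sum_mul_inner_sq (a : Fin d → ℝ) :
    ∫ x, (∑ j, a j * inner ℝ (e j) (ψ x)) ^ 2 ∂μ = ∑ j, a j ^ 2 * s j := by
  have hi : ∀ i j, Integrable (fun x => inner ℝ (e i) (ψ x) * inner ℝ (e j) (ψ x)) μ := fun i j =>
    integrable_inner_mul_inner hψ hψ (.of_forall hb) (.of_forall hb) _ _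
  have e1 : ∀ x, (∑ j, a j * inner ℝ (e j) (ψ x)) ^ 2
      = ∑ i, ∑ j, a i * a j * (inner ℝ (e i) (ψ x) * inner ℝ (e j) (ψ x)) := by
    intro x
    rw [sq, Finset.sum_mul_sum]
    refine Finset.sum_congr rfl fun i _ => Finset.sum_congr rfl fun j _ => by ring
  simp only [e1]
  rw [integral_finsetSum _ fun i _ => integrable_finsetSum _ fun j _ => (hi i j).const_mul _]
  refine Finset.sum_congr rfl fun i _ => ?_
  rw [integral_finsetSum _ fun j _ => (hi i j).const_mul _]
  simp only [integral_const_mul, he, mul_ite, mul_zero, Finset.sum_ite_eq, Finset.mem_univ, if_true]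
  ring

theorem norm_coWhiten_sq (hs : ∀ i, 0 ≤ s i) (hl : 0 < l) (β : EuclideanSpace ℝ (Fin d)) :
    ‖coWhiten e s l β‖ ^ 2 = ∫ x, inner ℝ β (ψ x) ^ 2 ∂μ + l * ‖β‖ ^ 2 := by
  have e1 : ∀ x, inner ℝ β (ψ x) = ∑ j, inner ℝ (e j) β * inner ℝ (e j) (ψ x) := by
    intro x
    rw [← e.sum_inner_mul_inner β (ψ x)]
    refine Finset.sum_congr rfl fun j _ => by rw [real_inner_comm]
  simp only [e1]
  rw [integral_sum_mul_inner_sq e hψ hb he, ← e.sum_sq_norm_inner_right β, EuclideanSpace.norm_sq_eq,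
    Finset.mul_sum, ← Finset.sum_add_distrib]
  refine Finset.sum_congr rfl fun j _ => ?_
  have h0 : 0 ≤ s j + l := by linarith [hs j]
  simp only [coWhiten, norm_mul, mul_pow]
  rw [Real.norm_of_nonneg (Real.sqrt_nonneg _), Real.sq_sqrt h0, Real.norm_eq_abs, sq_abs]
  ring

/-- In the basis `e` the whitened second moment is diagonal with entries s/(s + l), all at most one.
-/
theorem integral_inner_whiten_sq_le (hs : ∀ i, 0 ≤ s i) (hl : 0 < l)
    (b : EuclideanSpace ℝ (Fin d)) : ∫ x, inner ℝ b (whiten e s l (ψ x)) ^ 2 ∂μ ≤ ‖b‖ ^ 2 := by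
  have e1 : ∀ x, inner ℝ b (whiten e s l (ψ x))
      = ∑ j, b j / √(s j + l) * inner ℝ (e j) (ψ x) := by
    intro x
    rw [PiLp.inner_apply]
    refine Finset.sum_congr rfl fun j _ => ?_
    simp only [whiten, RCLike.inner_apply, conj_trivial]
    ring
  simp only [e1]
  rw [integral_sum_mul_inner_sq e hψ hb he, EuclideanSpace.norm_sq_eq]
  refine Finset.sum_le_sum fun j _ => ?_
  have h0 : 0 < s j + l := by linarith [hs j]
  rw [div_pow, Real.sq_sqrt h0.le, Real.norm_eq_abs, sq_abs, div_mul_eq_mul_div, div_le_iff₀ h0]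
  nlinarith [sq_nonneg (b j)]

/-- The trace of the whitened second moment, which is the strong variance entering the Bernstein
bound. -/
theorem integral_norm_whiten_sq (hs : ∀ i, 0 ≤ s i) (hl : 0 < l) :
    ∫ x, ‖whiten e s l (ψ x)‖ ^ 2 ∂μ = effDim s l := by
  have hi : ∀ i j, Integrable (fun x => inner ℝ (e i) (ψ x) * inner ℝ (e j) (ψ x)) μ := fun i j =>
    integrable_inner_mul_inner hψ hψ (.of_forall hb) (.of_forall hb) _ _
  have e1 : ∀ x, ‖whiten e s l (ψ x)‖ ^ 2
      = ∑ j, (s j + l)⁻¹ * (inner ℝ (e j) (ψ x) * inner ℝ (e j) (ψ x)) := by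
    intro x
    rw [EuclideanSpace.norm_sq_eq]
    refine Finset.sum_congr rfl fun j _ => ?_
    have h0 : 0 < s j + l := by linarith [hs j]
    simp only [whiten]
    rw [Real.norm_eq_abs, sq_abs, div_pow, Real.sq_sqrt h0.le]
    ring
  simp only [e1]
  rw [integral_finsetSum _ fun j _ => (hi j j).const_mul _]
  refine Finset.sum_congr rfl fun j _ => ?_
  rw [integral_const_mul, he, if_pos rfl]
  ring

end Moments

theorem effDim_le (hs : ∀ i, 0 ≤ s i) (hl : 0 < l) : effDim s l ≤ d := by
  calc effDim s l ≤ ∑ _j : Fin d, (1 : ℝ) := Finset.sum_le_sum fun j _ => by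
        rw [div_le_one (by linarith [hs j])]; linarith
    _ = d := by simp

/-- Doubling the level at most halves each summand. This makes the dyadic search in `exists_level`
lose only a constant. -/
theorem effDim_le_two_mul (hs : ∀ i, 0 ≤ s i) (hl : 0 < l) :
    effDim s l ≤ 2 * effDim s (2 * l) := by
  unfold effDim
  rw [Finset.mul_sum]
  refine Finset.sum_le_sum fun j _ => ?_
  have := hs j
  rw [mul_div_assoc', div_le_div_iff₀ (by linarith) (by linarith)]
  nlinarith [mul_nonneg this this]

/-- The level at which the effective dimension balances the sample size. -/
theorem exists_level (hs : ∀ i, 0 ≤ s i) {κ l₀ : ℝ} (hκ : 0 < κ) (hl₀ : 0 < l₀) :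
    ∃ l, l₀ ≤ l ∧ effDim s l ≤ κ * l ∧ (l = l₀ ∨ κ / 4 * l ≤ effDim s l) := by
  classical
  have hex : ∃ j : ℕ, effDim s (2 ^ j * l₀) ≤ κ * (2 ^ j * l₀) := by
    obtain ⟨j, hj⟩ := pow_unbounded_of_one_lt ((d : ℝ) / (κ * l₀)) one_lt_two
    refine ⟨j, (effDim_le hs (by positivity)).trans ?_⟩
    rw [div_lt_iff₀ (by positivity)] at hj
    linarith
  have h1 := Nat.find_spec hex
  refine ⟨2 ^ Nat.find hex * l₀, le_mul_of_one_le_left hl₀.le (one_le_pow₀ one_le_two), h1, ?_⟩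
  rcases hj : Nat.find hex with _ | j
  · left; simp
  · right
    -- By minimality the level l/2 fails, so its effective dimension exceeds κl/2; the dimension at
    -- l is at least half of that, whence the factor 1/4.
    have h2 : ¬ effDim s (2 ^ j * l₀) ≤ κ * (2 ^ j * l₀) := Nat.find_min hex (by omega)
    have h3 := effDim_le_two_mul (s := s) hs (show 0 < 2 ^ j * l₀ by positivity)
    rw [pow_succ, show 2 ^ j * 2 * l₀ = 2 * (2 ^ j * l₀) by ring]
    nlinarith

end Whitening

/-! ### Uniform deviations of products of linear functions -/

/-- The tensor product of two vectors. -/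
def outerVec {κ κ' : Type*} (u : EuclideanSpace ℝ κ) (v : EuclideanSpace ℝ κ') :
    EuclideanSpace ℝ (κ × κ') := WithLp.toLp 2 fun p => u p.1 * v p.2

theorem inner_outerVec {κ κ' : Type*} [Fintype κ] [Fintype κ'] (u u' : EuclideanSpace ℝ κ)
    (v v' : EuclideanSpace ℝ κ') :
    inner ℝ (outerVec u v) (outerVec u' v') = inner ℝ u u' * inner ℝ v v' := by
  simp only [PiLp.inner_apply, outerVec, RCLike.inner_apply, conj_trivial]
  rw [Finset.sum_mul_sum, Fintype.sum_prod_type]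
  refine Finset.sum_congr rfl fun i _ => Finset.sum_congr rfl fun j _ => by ring

theorem norm_outerVec {κ κ' : Type*} [Fintype κ] [Fintype κ'] (u : EuclideanSpace ℝ κ)
    (v : EuclideanSpace ℝ κ') : ‖outerVec u v‖ = ‖u‖ * ‖v‖ := by
  have h := inner_outerVec u u v v
  rw [real_inner_self_eq_norm_sq, real_inner_self_eq_norm_sq, real_inner_self_eq_norm_sq,
    ← mul_pow] at h
  exact (sq_eq_sq₀ (norm_nonneg _) (by positivity)).1 h

theorem measurable_outerVec {Ω κ κ' : Type*} [MeasurableSpace Ω] [Fintype κ] [Fintype κ']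
    {φ : Ω → EuclideanSpace ℝ κ} {χ : Ω → EuclideanSpace ℝ κ'} (hφ : Measurable φ)
    (hχ : Measurable χ) : Measurable fun x => outerVec (φ x) (χ x) := by
  unfold outerVec
  refine (WithLp.measurable_toLp 2 _).comp (measurable_pi_lambda _ fun j => ?_)
  fun_prop

/-- Reading `B` as a matrix, the left side is (uᵀBv)², at most ‖Bv‖² when ‖u‖ ≤ 1. The first factor
of the tensor is thus discarded without paying for its dimension. -/
theorem inner_outerVec_sq_le {κ κ' : Type*} [Fintype κ] [Fintype κ'] (B : EuclideanSpace ℝ (κ × κ'))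
    (u : EuclideanSpace ℝ κ) (v : EuclideanSpace ℝ κ') (hu : ‖u‖ ≤ 1) :
    inner ℝ B (outerVec u v) ^ 2 ≤ ∑ i, inner ℝ (WithLp.toLp 2 fun j => B (i, j)) v ^ 2 := by
  have e1 : inner ℝ B (outerVec u v)
      = ∑ i, u i * inner ℝ (WithLp.toLp 2 fun j => B (i, j) : EuclideanSpace ℝ κ') v := by
    simp only [PiLp.inner_apply, outerVec, RCLike.inner_apply, conj_trivial]
    rw [Fintype.sum_prod_type]
    refine Finset.sum_congr rfl fun i _ => ?_
    rw [Finset.mul_sum]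
    refine Finset.sum_congr rfl fun j _ => by ring
  rw [e1]
  refine (Finset.sum_mul_sq_le_sq_mul_sq _ _ _).trans ?_
  refine mul_le_of_le_one_left (Finset.sum_nonneg fun i _ => sq_nonneg _) ?_
  have : ∑ i, u i ^ 2 = ‖u‖ ^ 2 := by
    rw [EuclideanSpace.norm_sq_eq]
    exact Finset.sum_congr rfl fun i _ => by rw [Real.norm_eq_abs, sq_abs]
  rw [this]
  nlinarith [norm_nonneg u]

section Deviation

variable {ι Ω : Type*} [Fintype ι] [MeasurableSpace Ω] {μ : Measure Ω} [IsProbabilityMeasure μ]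
  {d : ℕ} {e : OrthonormalBasis (Fin d) ℝ (EuclideanSpace ℝ (Fin d))} {s : Fin d → ℝ}
  {ψ : Ω → EuclideanSpace ℝ (Fin d)} {l c : ℝ}

/-- The tensor √l φ ⊗ (whitened ψ) has norm at most one, weak variance at most `l` and strong
variance at most `l * effDim s l`. A bilinear deviation is, up to 1/√l, the inner product of its
centred sum with `outerVec w (coWhiten e s l β)`, so one norm bound serves all `w` and `β` at once.
-/
theorem measure_pi_deviation_le {κ : Type*} [Fintype κ] {φ : Ω → EuclideanSpace ℝ κ}
    (hφ : Measurable φ) (hφb : ∀ᵐ x ∂μ, ‖φ x‖ ≤ 1) (hψ : Measurable ψ) (hb : ∀ x, ‖ψ x‖ ≤ 1)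
    (hs : ∀ i, 0 ≤ s i)
    (he : ∀ i j, ∫ x, inner ℝ (e i) (ψ x) * inner ℝ (e j) (ψ x) ∂μ = if i = j then s i else 0)
    (hl : 0 < l) (hc : 0 < c) (hc1 : c ≤ 1) (hR : 1 ≤ c * (Fintype.card ι * l))
    (hd : effDim s l ≤ c ^ 2 / 2 * (Fintype.card ι * l)) :
    (Measure.pi fun _ : ι => μ) {ω | ¬ ∀ w β,
        |∑ t, inner ℝ w (φ (ω t)) * inner ℝ β (ψ (ω t))
            - Fintype.card ι * ∫ x, inner ℝ w (φ x) * inner ℝ β (ψ x) ∂μ|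
          ≤ 3 * c * Fintype.card ι * √l * ‖w‖ * ‖coWhiten e s l β‖}
      ≤ ENNReal.ofReal (Real.exp (-(c ^ 2 * (Fintype.card ι * l) / 4))) := by
  set n : ℝ := (Fintype.card ι : ℝ) with hn
  have hn0 : 0 ≤ n := Nat.cast_nonneg _
  have hsl : 0 < √l := Real.sqrt_pos.2 hl
  have hsl2 : √l ^ 2 = l := Real.sq_sqrt hl.le
  set χ : Ω → EuclideanSpace ℝ (Fin d) := fun x => whiten e s l (ψ x) with hχ
  have hχm : Measurable χ := (measurable_whiten e s l).comp hψ
  have hχb : ∀ x, √l * ‖χ x‖ ≤ 1 := by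
    intro x
    have h1 := norm_whiten_sq_le e hs hl (ψ x)
    have h2 : ‖ψ x‖ ^ 2 ≤ 1 := by nlinarith [hb x, norm_nonneg (ψ x)]
    have h3 : (√l * ‖χ x‖) ^ 2 ≤ 1 := by rw [mul_pow, hsl2]; linarith
    nlinarith [mul_nonneg hsl.le (norm_nonneg (χ x))]
  have hχb' : ∀ x, ‖χ x‖ ≤ (√l)⁻¹ := by
    intro x
    rw [← one_div, le_div_iff₀ hsl, mul_comm]
    exact hχb x
  set W : Ω → EuclideanSpace ℝ (κ × Fin d) := fun x => √l • outerVec (φ x) (χ x) with hW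
  have hWm : Measurable W := (measurable_outerVec hφ hχm).const_smul (√l)
  have hnW : ∀ x, ‖W x‖ = √l * (‖φ x‖ * ‖χ x‖) := by
    intro x; rw [hW]; simp only [norm_smul, norm_outerVec, Real.norm_of_nonneg hsl.le]
  have hWb : ∀ᵐ x ∂μ, ‖W x‖ ≤ 1 := by
    filter_upwards [hφb] with x hx
    rw [hnW]
    have := hχb x
    nlinarith [norm_nonneg (φ x), mul_nonneg hsl.le (norm_nonneg (χ x))]
  have hWl : ∀ B, ∫ x, inner ℝ B (W x) ^ 2 ∂μ ≤ l * ‖B‖ ^ 2 := by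
    intro B
    have hi : ∀ i, Integrable (fun x => inner ℝ (WithLp.toLp 2 fun j => B (i, j)) (χ x) ^ 2) μ := by
      intro i
      simp only [sq]
      exact integrable_inner_mul_inner hχm hχm (.of_forall hχb') (.of_forall hχb') _ _
    calc ∫ x, inner ℝ B (W x) ^ 2 ∂μ
        ≤ ∫ x, l * ∑ i, inner ℝ (WithLp.toLp 2 fun j => B (i, j)) (χ x) ^ 2 ∂μ := by
          refine integral_mono_of_nonneg (.of_forall fun x => by positivity)
            ((integrable_finsetSum _ fun i _ => hi i).const_mul _) ?_
          filter_upwards [hφb] with x hx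
          simp only [hW, inner_smul_right, mul_pow, hsl2]
          gcongr
          exact inner_outerVec_sq_le B _ _ hx
      _ = l * ∑ i, ∫ x, inner ℝ (WithLp.toLp 2 fun j => B (i, j)) (χ x) ^ 2 ∂μ := by
          rw [integral_const_mul, integral_finsetSum _ fun i _ => hi i]
      _ ≤ l * ∑ i, ‖(WithLp.toLp 2 fun j => B (i, j) : EuclideanSpace ℝ (Fin d))‖ ^ 2 := by
          gcongr with i
          exact integral_inner_whiten_sq_le e hψ hb he hs hl _
      _ = l * ‖B‖ ^ 2 := by
          congr 1
          simp only [EuclideanSpace.norm_sq_eq]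
          rw [Fintype.sum_prod_type]
  have hWV : ∫ x, ‖W x‖ ^ 2 ∂μ ≤ l * effDim s l := by
    rw [← integral_norm_whiten_sq e hψ hb he hs hl, ← integral_const_mul]
    have hχi : Integrable (fun x => ‖χ x‖ ^ 2) μ := by
      refine Integrable.of_bound (by fun_prop) ((√l)⁻¹ ^ 2) (.of_forall fun x => ?_)
      rw [norm_pow, norm_norm]
      exact pow_le_pow_left₀ (norm_nonneg _) (hχb' x) 2
    refine integral_mono_of_nonneg (.of_forall fun x => by positivity) (hχi.const_mul l) ?_
    filter_upwards [hφb] with x hx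
    simp only [hnW, mul_pow, hsl2]
    gcongr
    refine mul_le_of_le_one_left (by positivity) ?_
    nlinarith [norm_nonneg (φ x)]
  have hWi : Integrable W μ := Integrable.of_bound hWm.aestronglyMeasurable 1 hWb
  refine le_trans (measure_mono ?_)
    (measure_pi_norm_sum_ge_le (ι := ι) μ hWm hWb hWl hWV hl.le hc hc1 hR (by rw [← hn]; nlinarith))
  intro ω hω
  simp only [Set.mem_ofPred_eq] at hω ⊢
  by_contra hcon
  push Not at hcon
  apply hω
  intro w β
  have e1 : ∀ x, inner ℝ w (φ x) * inner ℝ β (ψ x)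
      = (√l)⁻¹ * inner ℝ (outerVec w (coWhiten e s l β)) (W x) := by
    intro x
    simp only [hW, inner_smul_right, inner_outerVec, hχ, inner_coWhiten_whiten e hs hl]
    field_simp
  simp only [e1]
  rw [integral_const_mul, ← Finset.mul_sum, integral_inner hWi, ← inner_sum,
    show ∀ a b : ℝ, (√l)⁻¹ * a - n * ((√l)⁻¹ * b) = (√l)⁻¹ * (a - n * b) by intros; ring]
  have e2 : ∑ t, (W (ω t) - ∫ x, W x ∂μ) = ∑ t, W (ω t) - n • ∫ x, W x ∂μ := by
    rw [Finset.sum_sub_distrib, Finset.sum_const, Finset.card_univ, hn, Nat.cast_smul_eq_nsmul]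
  have e3 : inner ℝ (outerVec w (coWhiten e s l β)) (∑ t, W (ω t))
      - n * inner ℝ (outerVec w (coWhiten e s l β)) (∫ x, W x ∂μ)
      = inner ℝ (outerVec w (coWhiten e s l β)) (∑ t, (W (ω t) - ∫ x, W x ∂μ)) := by
    rw [e2, inner_sub_right, inner_smul_right]
  rw [e3, abs_mul, abs_of_pos (inv_pos.2 hsl), inv_mul_le_iff₀ hsl]
  refine (abs_real_inner_le_norm _ _).trans ?_
  rw [norm_outerVec]
  refine (mul_le_mul_of_nonneg_left hcon.le (by positivity)).trans (le_of_eq ?_)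
  rw [← hn]
  linear_combination (-(3 * c * n * ‖w‖ * ‖coWhiten e s l β‖)) * hsl2

/-- Lower tail of the empirical effective dimension. -/
theorem measure_pi_sum_norm_whiten_lt_le (hψ : Measurable ψ) (hb : ∀ x, ‖ψ x‖ ≤ 1)
    (hs : ∀ i, 0 ≤ s i)
    (he : ∀ i j, ∫ x, inner ℝ (e i) (ψ x) * inner ℝ (e j) (ψ x) ∂μ = if i = j then s i else 0)
    (hl : 0 < l) :
    (Measure.pi fun _ : ι => μ) {ω | ∑ t, ‖whiten e s l (ψ (ω t))‖ ^ 2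
        < Fintype.card ι * effDim s l / 4}
      ≤ ENNReal.ofReal (Real.exp (-(Fintype.card ι * (l * effDim s l) / 4))) := by
  set n : ℝ := (Fintype.card ι : ℝ) with hn
  set V : Ω → ℝ := fun x => l * ‖whiten e s l (ψ x)‖ ^ 2 with hVdef
  have hV : Measurable V := (((measurable_whiten e s l).comp hψ).norm.pow_const 2).const_mul l
  have hV0 : ∀ x, 0 ≤ V x := fun x => by positivity
  have hV1 : ∀ x, V x ≤ 1 := fun x =>
    (norm_whiten_sq_le e hs hl (ψ x)).trans (by nlinarith [hb x, norm_nonneg (ψ x)])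
  have hVi : Integrable V μ := Integrable.of_bound hV.aestronglyMeasurable 1
    (.of_forall fun x => by rw [Real.norm_of_nonneg (hV0 x)]; exact hV1 x)
  set v := l * effDim s l with hv
  have hEV : ∫ x, V x ∂μ = v := by
    rw [hVdef, integral_const_mul, integral_norm_whiten_sq e hψ hb he hs hl]
  have hstep : ∀ u : ℝ, ∫⁻ x, ENNReal.ofReal (Real.exp (-(u + V x))) ∂μ
      ≤ ENNReal.ofReal (Real.exp (-(v / 2))) * ENNReal.ofReal (Real.exp (-u)) := by
    intro u
    -- On [0, 1] one has exp(-V) ≤ 1 - V/2, since (1 - V/2)(1 + V + V²/2) = 1 + V/2 - V³/4 ≥ 1. Thus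
    -- each step contributes exp(-v/2), and Markov's inequality at nv/4 leaves exp(-nv/4).
    have hpt : ∀ x, Real.exp (-(u + V x)) ≤ Real.exp (-u) * (1 - 1 / 2 * V x) := by
      intro x
      rw [neg_add, Real.exp_add]
      gcongr
      have := Real.quadratic_le_exp_of_nonneg (hV0 x)
      rw [Real.exp_neg, inv_le_comm₀ (Real.exp_pos _) (by linarith [hV1 x])]
      refine le_trans ?_ this
      rw [inv_le_iff_one_le_mul₀ (by linarith [hV1 x])]
      nlinarith [hV0 x, hV1 x, mul_nonneg (hV0 x) (sub_nonneg.2 (hV1 x)),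
        mul_nonneg (mul_nonneg (hV0 x) (hV0 x)) (sub_nonneg.2 (hV1 x))]
    have hint : Integrable (fun x => Real.exp (-u) * (1 - 1 / 2 * V x)) μ :=
      ((integrable_const _).sub' (hVi.const_mul _)).const_mul _
    calc _ ≤ ∫⁻ x, ENNReal.ofReal (Real.exp (-u) * (1 - 1 / 2 * V x)) ∂μ :=
          lintegral_mono fun x => ENNReal.ofReal_le_ofReal (hpt x)
      _ = ENNReal.ofReal (∫ x, Real.exp (-u) * (1 - 1 / 2 * V x) ∂μ) :=
          (ofReal_integral_eq_lintegral_ofReal hint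
            (.of_forall fun x => (Real.exp_pos _).le.trans (hpt x))).symm
      _ ≤ _ := by
          rw [← ENNReal.ofReal_mul (Real.exp_pos _).le]
          apply ENNReal.ofReal_le_ofReal
          rw [integral_const_mul, integral_sub (integrable_const _) (hVi.const_mul _),
            integral_const_mul, hEV, mul_comm]
          gcongr
          simp only [integral_const, probReal_univ, one_smul]
          linarith [Real.add_one_le_exp (-(v / 2))]
  have key := lintegral_pi_sum_le (ι := ι) μ hV (Φ := fun u => ENNReal.ofReal (Real.exp (-u)))
    (by fun_prop) _ hstep
  rw [← ENNReal.ofReal_pow (Real.exp_pos _).le, ← Real.exp_nat_mul,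
    ← ENNReal.ofReal_mul (Real.exp_pos _).le, ← Real.exp_add, ← hn] at key
  have hmeas : Measurable fun ω : ι → Ω => ∑ t, V (ω t) :=
    Finset.measurable_fun_sum _ fun t _ => hV.comp (measurable_pi_apply t)
  have hsub : {ω : ι → Ω | ∑ t, ‖whiten e s l (ψ (ω t))‖ ^ 2 < n * effDim s l / 4} ⊆
      {ω | ENNReal.ofReal (Real.exp (-(n * v / 4))) ≤ ENNReal.ofReal (Real.exp (-∑ t, V (ω t)))} := by
    intro ω hω
    simp only [Set.mem_ofPred_eq] at hω ⊢
    refine ENNReal.ofReal_le_ofReal (Real.exp_le_exp.2 (neg_le_neg ?_))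
    rw [hVdef, ← Finset.mul_sum, hv]
    nlinarith
  have hmark := mul_meas_ge_le_lintegral₀ (μ := Measure.pi fun _ : ι => μ)
    (f := fun ω => ENNReal.ofReal (Real.exp (-∑ t, V (ω t))))
    (hmeas.neg.exp.ennreal_ofReal.aemeasurable) (ENNReal.ofReal (Real.exp (-(n * v / 4))))
  have h1 := (mul_le_mul_right (measure_mono (μ := Measure.pi fun _ : ι => μ) hsub)
    (ENNReal.ofReal (Real.exp (-(n * v / 4))))).trans (hmark.trans key)
  have h2 := mul_le_mul_right h1 (ENNReal.ofReal (Real.exp (n * v / 4)))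
  rw [← mul_assoc, ← ENNReal.ofReal_mul (Real.exp_pos _).le, ← Real.exp_add, add_neg_cancel,
    Real.exp_zero, ENNReal.ofReal_one, one_mul, ← ENNReal.ofReal_mul (Real.exp_pos _).le,
    ← Real.exp_add] at h2
  refine h2.trans (ENNReal.ofReal_le_ofReal (Real.exp_le_exp.2 (le_of_eq ?_)))
  ring

/-- The event on which all empirical averages are close to their means. -/
structure GoodSample {κ₁ κ₂ : Type*} [Fintype κ₁] [Fintype κ₂] (μ : Measure Ω)
    (e : OrthonormalBasis (Fin d) ℝ (EuclideanSpace ℝ (Fin d))) (s : Fin d → ℝ)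
    (ψ : Ω → EuclideanSpace ℝ (Fin d)) (φ₁ : Ω → EuclideanSpace ℝ κ₁)
    (φ₂ : Ω → EuclideanSpace ℝ κ₂) (l c l₀ : ℝ) (ω : ι → Ω) : Prop where
  quad : ∀ β, |∑ t, inner ℝ β (ψ (ω t)) ^ 2 - Fintype.card ι * ∫ x, inner ℝ β (ψ x) ^ 2 ∂μ|
    ≤ 3 * c * Fintype.card ι * ‖coWhiten e s l β‖ ^ 2
  prod₁ : ∀ w β, |∑ t, inner ℝ w (φ₁ (ω t)) * inner ℝ β (ψ (ω t))
      - Fintype.card ι * ∫ x, inner ℝ w (φ₁ x) * inner ℝ β (ψ x) ∂μ|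
    ≤ 3 * c * Fintype.card ι * √l * ‖w‖ * ‖coWhiten e s l β‖
  prod₂ : ∀ w β, |∑ t, inner ℝ w (φ₂ (ω t)) * inner ℝ β (ψ (ω t))
      - Fintype.card ι * ∫ x, inner ℝ w (φ₂ x) * inner ℝ β (ψ x) ∂μ|
    ≤ 3 * c * Fintype.card ι * √l * ‖w‖ * ‖coWhiten e s l β‖
  trace : l ≠ l₀ → Fintype.card ι * effDim s l / 4 ≤ ∑ t, ‖whiten e s l (ψ (ω t))‖ ^ 2

/-- A union bound over four events, each of probability at most exp(-τ): three bilinear deviations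
and the lower tail of the empirical trace. The lower bound on `l` makes the deviation exponent
c²nl/4 at least 4τ. -/
theorem measure_pi_not_goodSample_le [Nonempty ι] {κ₁ κ₂ : Type*} [Fintype κ₁] [Fintype κ₂]
    {φ₁ : Ω → EuclideanSpace ℝ κ₁} {φ₂ : Ω → EuclideanSpace ℝ κ₂}
    (hφ₁ : Measurable φ₁) (hφ₁b : ∀ᵐ x ∂μ, ‖φ₁ x‖ ≤ 1)
    (hφ₂ : Measurable φ₂) (hφ₂b : ∀ᵐ x ∂μ, ‖φ₂ x‖ ≤ 1)
    (hψ : Measurable ψ) (hb : ∀ x, ‖ψ x‖ ≤ 1) (hs : ∀ i, 0 ≤ s i)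
    (he : ∀ i j, ∫ x, inner ℝ (e i) (ψ x) * inner ℝ (e j) (ψ x) ∂μ = if i = j then s i else 0)
    (hc : 0 < c) (hc1 : c ≤ 1) {τ : ℝ} (hτ : 1 ≤ τ)
    (hl : 16 * τ / (c ^ 2 * Fintype.card ι) ≤ l)
    (hd : effDim s l ≤ c ^ 2 / 2 * Fintype.card ι * l)
    (hd' : l = 16 * τ / (c ^ 2 * Fintype.card ι) ∨ c ^ 2 / 2 * Fintype.card ι / 4 * l ≤ effDim s l) :
    (Measure.pi fun _ : ι => μ)
        {ω | ¬ GoodSample μ e s ψ φ₁ φ₂ l c (16 * τ / (c ^ 2 * Fintype.card ι)) ω}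
      ≤ ENNReal.ofReal (4 * Real.exp (-τ)) := by
  set n : ℝ := (Fintype.card ι : ℝ) with hn
  have hn0 : 0 < n := Nat.cast_pos.2 Fintype.card_pos
  have hl₀ : 0 < 16 * τ / (c ^ 2 * n) := by positivity
  have hl0 : 0 < l := hl₀.trans_le hl
  have hnl : 16 * τ ≤ c ^ 2 * (n * l) := by
    rw [div_le_iff₀ (by positivity)] at hl
    linarith
  have hR : 1 ≤ c * (n * l) := by
    have : c ^ 2 * (n * l) ≤ c * (n * l) := by
      have := mul_pos hn0 hl0
      have h2 : c ^ 2 ≤ c := by nlinarith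
      gcongr
    linarith
  have hd2 : effDim s l ≤ c ^ 2 / 2 * (n * l) := by linarith
  have hexp : ENNReal.ofReal (Real.exp (-(c ^ 2 * (n * l) / 4))) ≤ ENNReal.ofReal (Real.exp (-τ)) :=
    ENNReal.ofReal_le_ofReal (Real.exp_le_exp.2 (by linarith))
  have hsl : 0 < √l := Real.sqrt_pos.2 hl0
  have hsl2 : √l ^ 2 = l := Real.sq_sqrt hl0.le
  -- The quadratic deviation is the bilinear one with √l times the whitened ψ as first feature and
  -- `coWhiten e s l β` as its weight; the factor √l then cancels.
  have hχm : Measurable fun x => √l • whiten e s l (ψ x) :=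
    Measurable.const_smul ((measurable_whiten e s l).comp hψ) (√l)
  have hχb : ∀ᵐ x ∂μ, ‖√l • whiten e s l (ψ x)‖ ≤ 1 := .of_forall fun x => by
    rw [norm_smul, Real.norm_of_nonneg hsl.le]
    have h1 := norm_whiten_sq_le e hs hl0 (ψ x)
    have h2 : ‖ψ x‖ ^ 2 ≤ 1 := by nlinarith [hb x, norm_nonneg (ψ x)]
    have h3 : (√l * ‖whiten e s l (ψ x)‖) ^ 2 ≤ 1 := by rw [mul_pow, hsl2]; linarith
    nlinarith [mul_nonneg hsl.le (norm_nonneg (whiten e s l (ψ x)))]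
  have b0 := (measure_pi_deviation_le (ι := ι) hχm hχb hψ hb hs he hl0 hc hc1 hR hd2).trans hexp
  have b1 := (measure_pi_deviation_le (ι := ι) hφ₁ hφ₁b hψ hb hs he hl0 hc hc1 hR hd2).trans hexp
  have b2 := (measure_pi_deviation_le (ι := ι) hφ₂ hφ₂b hψ hb hs he hl0 hc hc1 hR hd2).trans hexp
  -- The trace is needed only at a level above the deviation level. There the effective dimension is
  -- at least c²nl/8, so the exponent nl·effDim/4 is at least (c²nl)(nl)/32 ≥ 8τ.
  have b3 : (Measure.pi fun _ : ι => μ) {ω | l ≠ 16 * τ / (c ^ 2 * n) ∧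
      ∑ t, ‖whiten e s l (ψ (ω t))‖ ^ 2 < n * effDim s l / 4} ≤ ENNReal.ofReal (Real.exp (-τ)) := by
    rcases hd' with h | h
    · simp [h]
    · refine (measure_mono (fun ω hω => hω.2)).trans
        ((measure_pi_sum_norm_whiten_lt_le hψ hb hs he hl0).trans ?_)
      refine ENNReal.ofReal_le_ofReal (Real.exp_le_exp.2 (neg_le_neg ?_))
      rw [← hn]
      have h1 : n * (l * (c ^ 2 / 2 * n / 4 * l)) ≤ n * (l * effDim s l) := by gcongr
      have h2 : n * (l * (c ^ 2 / 2 * n / 4 * l)) = c ^ 2 * (n * l) * (n * l) / 8 := by ring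
      have h3 : 16 ≤ n * l := by
        have : c ^ 2 * (n * l) ≤ 1 * (n * l) := by
          have := mul_pos hn0 hl0
          have h2 : c ^ 2 ≤ 1 := by nlinarith
          gcongr
        linarith
      have h4 : 16 * τ * 16 ≤ c ^ 2 * (n * l) * (n * l) := by gcongr
      linarith
  have hfour : ENNReal.ofReal (4 * Real.exp (-τ)) = ENNReal.ofReal (Real.exp (-τ)) +
      ENNReal.ofReal (Real.exp (-τ)) + (ENNReal.ofReal (Real.exp (-τ)) +
      ENNReal.ofReal (Real.exp (-τ))) := by
    have := (Real.exp_pos (-τ)).le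
    rw [← ENNReal.ofReal_add this this, ← ENNReal.ofReal_add (by linarith) (by linarith)]
    congr 1; ring
  rw [hfour]
  refine le_trans (measure_mono ?_) ((measure_union_le _ _).trans (add_le_add
    ((measure_union_le _ _).trans (add_le_add b0 b1)) ((measure_union_le _ _).trans (add_le_add b2 b3))))
  intro ω hω
  by_contra hcon
  simp only [Set.mem_union, Set.mem_ofPred_eq, not_or, not_not, not_and, not_lt] at hcon
  obtain ⟨⟨h0, h1⟩, h2, h3⟩ := hcon
  refine hω ⟨fun β => ?_, h1, h2, h3⟩
  have := h0 (coWhiten e s l β) β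
  simp only [inner_smul_right, inner_coWhiten_whiten e hs hl0, mul_assoc, integral_const_mul,
    ← Finset.mul_sum] at this
  rw [show ∀ a b : ℝ, √l * a - n * (√l * b) = √l * (a - n * b) by intros; ring, abs_mul,
    abs_of_pos hsl] at this
  simp only [sq]
  refine le_of_mul_le_mul_left (this.trans (le_of_eq ?_)) hsl
  ring

end Deviation

/-! ### Rademacher sums -/

section Signs

/-- The real number `±1` at index `t`. -/
def sgn {ι : Type*} (s : ι → ℤˣ) (t : ι) : ℝ := ((s t : ℤ) : ℝ)

theorem sgn_flip_same {ι : Type*} [DecidableEq ι] (s : ι → ℤˣ) (t : ι) : sgn (s * Pi.mulSingle t (-1)) t = -sgn s t := by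
  simp [sgn]

theorem sgn_flip_ne {ι : Type*} [DecidableEq ι] (s : ι → ℤˣ) {t u : ι} (h : u ≠ t) :
    sgn (s * Pi.mulSingle t (-1)) u = sgn s u := by
  simp [sgn, Pi.mulSingle_eq_of_ne h]

theorem sgn_eq {ι : Type*} (s : ι → ℤˣ) (t : ι) : sgn s t = 1 ∨ sgn s t = -1 := by
  rcases Int.units_eq_one_or (s t) with h | h <;> simp [sgn, h]

variable {ι : Type*} [Fintype ι] [DecidableEq ι]

theorem sum_signs_flip (t : ι) (f : (ι → ℤˣ) → ℝ) :
    ∑ s : ι → ℤˣ, f (s * Pi.mulSingle t (-1)) = ∑ s : ι → ℤˣ, f s :=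
  Fintype.sum_equiv (Equiv.mulRight (Pi.mulSingle t (-1))) _ _ fun _ => rfl

/-- Pairing each sign vector with its flip at `t` averages over the new sign; moments of Rademacher
sums then follow by induction on the index set. -/
theorem sum_signs_insert {H : Type*} [AddCommGroup H] [Module ℝ H] {S : Finset ι} {t : ι}
    (ht : t ∉ S) (v : ι → H) (F : H → ℝ) :
    ∑ s : ι → ℤˣ, F (∑ u ∈ insert t S, sgn s u • v u)
      = ∑ s : ι → ℤˣ, (F (∑ u ∈ S, sgn s u • v u + v t) + F (∑ u ∈ S, sgn s u • v u - v t)) / 2 := by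
  have h1 := sum_signs_flip t fun s => F (∑ u ∈ insert t S, sgn s u • v u)
  have h2 : ∀ s : ι → ℤˣ, F (∑ u ∈ insert t S, sgn s u • v u)
      + F (∑ u ∈ insert t S, sgn (s * Pi.mulSingle t (-1)) u • v u)
      = F (∑ u ∈ S, sgn s u • v u + v t) + F (∑ u ∈ S, sgn s u • v u - v t) := by
    intro s
    have e1 : ∑ u ∈ S, sgn (s * Pi.mulSingle t (-1)) u • v u = ∑ u ∈ S, sgn s u • v u :=
      Finset.sum_congr rfl fun u hu => by rw [sgn_flip_ne s (fun h : u = t => ht (h ▸ hu))]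
    rw [Finset.sum_insert ht, Finset.sum_insert ht, sgn_flip_same, e1]
    rcases sgn_eq s t with h | h <;> rw [h]
    · simp only [one_smul, neg_smul]
      rw [add_comm (v t), neg_add_eq_sub]
    · simp only [one_smul, neg_smul, neg_neg]
      rw [add_comm (v t), neg_add_eq_sub, add_comm]
  rw [← Finset.sum_div, ← Finset.sum_congr rfl fun s _ => h2 s, Finset.sum_add_distrib, h1]
  ring

variable {H : Type*} [NormedAddCommGroup H] [InnerProductSpace ℝ H]

theorem sum_signs_norm_sq (S : Finset ι) (v : ι → H) :
    ∑ s : ι → ℤˣ, ‖∑ u ∈ S, sgn s u • v u‖ ^ 2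
      = Fintype.card (ι → ℤˣ) * ∑ u ∈ S, ‖v u‖ ^ 2 := by
  induction S using Finset.induction_on with
  | empty => simp
  | insert t S ht ih =>
    rw [sum_signs_insert ht v fun x => ‖x‖ ^ 2]
    have e : ∀ x : H, (‖x + v t‖ ^ 2 + ‖x - v t‖ ^ 2) / 2 = ‖x‖ ^ 2 + ‖v t‖ ^ 2 := by
      intro x
      rw [norm_add_sq_real, norm_sub_sq_real]; ring
    simp only [e]
    rw [Finset.sum_add_distrib, ih, Finset.sum_insert ht]
    simp only [Finset.sum_const, Finset.card_univ, nsmul_eq_mul]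
    ring

/-- Averaging over the new sign gives at most ‖x‖⁴ + 6‖v‖²‖x‖² + ‖v‖⁴; the cross term 6 is what 3(a
+ b)² provides. -/
theorem sum_signs_norm_pow_four_le (S : Finset ι) (v : ι → H) :
    ∑ s : ι → ℤˣ, ‖∑ u ∈ S, sgn s u • v u‖ ^ 4
      ≤ Fintype.card (ι → ℤˣ) * (3 * (∑ u ∈ S, ‖v u‖ ^ 2) ^ 2) := by
  induction S using Finset.induction_on with
  | empty => simp
  | insert t S ht ih =>
    rw [sum_signs_insert ht v fun x => ‖x‖ ^ 4]
    have e : ∀ x : H, (‖x + v t‖ ^ 4 + ‖x - v t‖ ^ 4) / 2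
        ≤ ‖x‖ ^ 4 + 6 * ‖v t‖ ^ 2 * ‖x‖ ^ 2 + ‖v t‖ ^ 4 := by
      intro x
      rw [show ‖x + v t‖ ^ 4 = (‖x + v t‖ ^ 2) ^ 2 by ring,
        show ‖x - v t‖ ^ 4 = (‖x - v t‖ ^ 2) ^ 2 by ring, norm_add_sq_real, norm_sub_sq_real]
      have := real_inner_mul_inner_self_le x (v t)
      rw [real_inner_self_eq_norm_sq, real_inner_self_eq_norm_sq] at this
      nlinarith
    refine (Finset.sum_le_sum fun s _ => e _).trans ?_
    rw [Finset.sum_add_distrib, Finset.sum_add_distrib, ← Finset.mul_sum, sum_signs_norm_sq,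
      Finset.sum_insert ht]
    simp only [Finset.sum_const, Finset.card_univ, nsmul_eq_mul]
    nlinarith [sq_nonneg (‖v t‖ ^ 2), mul_nonneg (Nat.cast_nonneg (α := ℝ) (Fintype.card (ι → ℤˣ)))
      (sq_nonneg (‖v t‖ ^ 2))]

/-- A Khintchine inequality in a Hilbert space. -/
theorem sum_signs_norm_ge (S : Finset ι) (v : ι → H) :
    Fintype.card (ι → ℤˣ) * (5 / 9 * √(∑ u ∈ S, ‖v u‖ ^ 2))
      ≤ ∑ s : ι → ℤˣ, ‖∑ u ∈ S, sgn s u • v u‖ := by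
  set V := ∑ u ∈ S, ‖v u‖ ^ 2 with hV
  have hV0 : 0 ≤ V := Finset.sum_nonneg fun _ _ => by positivity
  set q := √V with hq
  have hqV : q ^ 2 = V := Real.sq_sqrt hV0
  rcases (Real.sqrt_nonneg V).eq_or_lt with h0 | h0
  · rw [← hq] at h0
    rw [← h0]
    simpa using Finset.sum_nonneg fun s _ => norm_nonneg _
  rw [← hq] at h0
  -- A lower bound for `x` by second and fourth powers, tangent at x = 3q/2. In the mean the fourth
  -- power costs 3 · 4/27 = 4/9, which leaves 5/9.
  have hpt : ∀ x : ℝ, 0 ≤ x → x ^ 2 / q - 4 / 27 * x ^ 4 / q ^ 3 ≤ x := by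
    intro x hx
    have : x - (x ^ 2 / q - 4 / 27 * x ^ 4 / q ^ 3)
        = x * (4 / 27 * (x / q - 3 / 2) ^ 2 * (x / q + 3)) := by
      field_simp
      ring
    have h2 : 0 ≤ x * (4 / 27 * (x / q - 3 / 2) ^ 2 * (x / q + 3)) := by positivity
    linarith
  refine le_trans ?_ (Finset.sum_le_sum fun s _ => hpt _ (norm_nonneg _))
  rw [Finset.sum_sub_distrib, ← Finset.sum_div, ← Finset.sum_div, ← Finset.mul_sum,
    sum_signs_norm_sq, ← hV, ← hqV]
  have h4 := sum_signs_norm_pow_four_le S v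
  rw [← hV, ← hqV] at h4
  set N : ℝ := (Fintype.card (ι → ℤˣ) : ℝ)
  have e1 : N * q ^ 2 / q = N * q := by field_simp
  have e2 : 4 / 27 * (∑ s : ι → ℤˣ, ‖∑ u ∈ S, sgn s u • v u‖ ^ 4) / q ^ 3 ≤ 4 / 9 * (N * q) := by
    rw [div_le_iff₀ (by positivity)]
    nlinarith
  rw [e1]
  linarith

/-- Rademacher sums are sub-Gaussian: each sign contributes a hyperbolic cosine, and cosh x ≤
exp(x²/2). -/
theorem sum_signs_exp_le (S : Finset ι) (q : ι → ℝ) (a : ℝ) :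
    ∑ s : ι → ℤˣ, Real.exp (a * ∑ u ∈ S, sgn s u * q u)
      ≤ Fintype.card (ι → ℤˣ) * Real.exp (a ^ 2 / 2 * ∑ u ∈ S, q u ^ 2) := by
  induction S using Finset.induction_on with
  | empty => simp
  | insert t S ht ih =>
    have h1 := sum_signs_insert ht q fun x => Real.exp (a * x)
    simp only [smul_eq_mul] at h1
    rw [h1]
    have e : ∀ x : ℝ, (Real.exp (a * (x + q t)) + Real.exp (a * (x - q t))) / 2
        = Real.exp (a * x) * Real.cosh (a * q t) := by
      intro x
      rw [Real.cosh_eq, mul_add, mul_sub, Real.exp_add, sub_eq_add_neg, Real.exp_add]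
      ring
    simp only [e]
    rw [← Finset.sum_mul, Finset.sum_insert ht, mul_add, Real.exp_add]
    calc _ ≤ Fintype.card (ι → ℤˣ) * Real.exp (a ^ 2 / 2 * ∑ u ∈ S, q u ^ 2)
          * Real.exp ((a * q t) ^ 2 / 2) :=
          mul_le_mul ih (Real.cosh_le_exp_half_sq _) (Real.cosh_pos _).le (by positivity)
      _ = _ := by rw [mul_pow]; ring_nf

end Signs

/-! ### Empirical critical radius and effective dimension -/

theorem card_signs (T : ℕ) : (Fintype.card (Fin T → ℤˣ) : ℝ) = 2 ^ T := by
  simp [Fintype.card_units_int]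

/-- Any choice of one admissible function per sign pattern bounds the supremum from below. The
uniform bound `B` is required because a real `sSup` is zero on sets unbounded above. -/
theorem le_localRademacher {ρ : Type*} {T : ℕ} (D : Fin T → ρ) (S : Finset (Fin T))
    (F : Set (ρ → ℝ)) (η B : ℝ) (hB : ∀ q ∈ F, ∀ t ∈ S, |q (D t)| ≤ B)
    (p : (Fin T → ℤˣ) → ρ → ℝ) (hp : ∀ s, p s ∈ F)
    (hη : ∀ s, √(empMean D S fun r => p s r ^ 2) ≤ η) :
    (∑ s, (∑ t ∈ S, sgn s t * p s (D t)) / (S.card : ℝ)) / 2 ^ T ≤ localRademacher D S F η := by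
  unfold localRademacher
  gcongr with s
  refine le_csSup ⟨(∑ t ∈ S, B) / S.card, ?_⟩ ⟨p s, ⟨hp s, hη s⟩, rfl⟩
  rintro _ ⟨q, ⟨hq, -⟩, rfl⟩
  dsimp only
  gcongr with t ht
  refine (le_abs_self _).trans ?_
  rw [abs_mul]
  have : |((s t : ℤ) : ℝ)| = 1 := by
    rcases sgn_eq s t with h | h <;> rw [sgn] at h <;> rw [h] <;> simp
  rw [this, one_mul]
  exact hB q hq t ht

/-- If l r₀² ≤ δ² there is nothing to show. Otherwise the ellipsoid ‖coWhiten β‖ ≤ 2δ/3 lies inside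
the ball of radius `r₀` and inside the localization at `δ`. Over this ellipsoid the Rademacher
supremum equals 2δ/3 times the norm of the whitened Rademacher sum. By Khintchine and the trace
hypothesis its mean is of order δ c√l, while criticality caps it by δ²/r₀. -/
theorem level_le_of_isCriticalRadius {ρ : Type*} {T d : ℕ} (D : Fin T → ρ) {S : Finset (Fin T)}
    (hS : S.Nonempty) {F : Set (ρ → ℝ)} {r₀ δ c l : ℝ}
    (θ : EuclideanSpace ℝ (Fin d) → ρ → ℝ) (hF : F = θ '' {β | ‖β‖ ≤ r₀})
    (x : Fin T → EuclideanSpace ℝ (Fin d)) (hx : ∀ t ∈ S, ∀ β, θ β (D t) = inner ℝ β (x t))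
    (hx1 : ∀ t, ‖x t‖ ≤ 1)
    {e : OrthonormalBasis (Fin d) ℝ (EuclideanSpace ℝ (Fin d))} {s : Fin d → ℝ}
    (hs : ∀ i, 0 ≤ s i) (hl : 0 < l) (hc : 0 < c) (hc1 : c ≤ 1) (hr₀ : 0 < r₀)
    (hnorm : ∀ β, l * ‖β‖ ^ 2 ≤ ‖coWhiten e s l β‖ ^ 2)
    (hquad : ∀ β, ∑ t ∈ S, inner ℝ β (x t) ^ 2 ≤ 9 / 8 * S.card * ‖coWhiten e s l β‖ ^ 2)
    (htr : S.card * effDim s l / 4 ≤ ∑ t ∈ S, ‖whiten e s l (x t)‖ ^ 2)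
    (hd : c ^ 2 / 2 * S.card / 4 * l ≤ effDim s l)
    (hδ : IsCriticalRadius D S F r₀ δ) : c ^ 2 * (l * r₀ ^ 2) ≤ 256 * δ ^ 2 := by
  obtain ⟨hδ0, hcrit⟩ := hδ
  have hn : (0 : ℝ) < S.card := Nat.cast_pos.2 hS.card_pos
  rcases le_or_gt (l * r₀ ^ 2) (δ ^ 2) with hle | hlt
  · have : c ^ 2 ≤ 1 := by nlinarith
    have h0 : 0 ≤ l * r₀ ^ 2 := by positivity
    nlinarith
  set n : ℝ := (S.card : ℝ) with hndef
  -- Chosen so that 9/8 · r² = δ²/2 stays within the localization, 9/8 being the distortion allowed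
  -- by `hquad`.
  set r := 2 * δ / 3 with hr
  have hr0 : 0 < r := by positivity
  set Y : (Fin T → ℤˣ) → EuclideanSpace ℝ (Fin d) := fun σ => ∑ t ∈ S, sgn σ t • whiten e s l (x t)
    with hY
  -- The maximizer over the ellipsoid for the sign pattern σ. When the sum vanishes, division by
  -- zero yields the zero vector, which is equally good.
  choose β hβ using fun σ => coWhiten_surjective e hs hl ((r / ‖Y σ‖) • Y σ)
  have hβn : ∀ σ, ‖coWhiten e s l (β σ)‖ ≤ r := by
    intro σ
    rw [hβ, norm_smul, norm_div, norm_norm, Real.norm_of_nonneg hr0.le]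
    rw [div_mul_eq_mul_div]
    exact div_le_of_le_mul₀ (norm_nonneg _) hr0.le le_rfl
  have hβr : ∀ σ, ‖β σ‖ ≤ r₀ := by
    intro σ
    have h1 := hnorm (β σ)
    have h2 : ‖coWhiten e s l (β σ)‖ ^ 2 ≤ r ^ 2 := pow_le_pow_left₀ (norm_nonneg _) (hβn σ) 2
    have h3 : l * ‖β σ‖ ^ 2 ≤ l * r₀ ^ 2 := by
      have : r ^ 2 ≤ δ ^ 2 := by rw [hr]; nlinarith
      linarith
    have h4 := le_of_mul_le_mul_left h3 hl
    exact (sq_le_sq₀ (norm_nonneg _) hr₀.le).1 h4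
  have hmean : ∀ σ, √(empMean D S fun ρ' => θ (β σ) ρ' ^ 2) ≤ δ := by
    intro σ
    refine (Real.sqrt_le_left hδ0.le).2 ?_
    unfold empMean
    rw [Finset.sum_congr rfl fun t ht => congrArg (· ^ 2) (hx t ht (β σ)), div_le_iff₀ hn]
    refine (hquad _).trans ?_
    have h2 : ‖coWhiten e s l (β σ)‖ ^ 2 ≤ r ^ 2 := pow_le_pow_left₀ (norm_nonneg _) (hβn σ) 2
    have h3 : r ^ 2 = 4 / 9 * δ ^ 2 := by rw [hr]; ring
    nlinarith [sq_nonneg δ]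
  have hlow := le_localRademacher D S F δ r₀ (by
    rw [hF]
    rintro _ ⟨b, hb, rfl⟩ t ht
    rw [hx t ht]
    refine (abs_real_inner_le_norm _ _).trans ?_
    have hb' : ‖b‖ ≤ r₀ := hb
    nlinarith [hx1 t, norm_nonneg b, norm_nonneg (x t)]) (fun σ => θ (β σ))
    (fun σ => by rw [hF]; exact ⟨β σ, hβr σ, rfl⟩) hmean
  have hsum : ∀ σ, ∑ t ∈ S, sgn σ t * θ (β σ) (D t) = r * ‖Y σ‖ := by
    intro σ
    have e1 : ∀ t ∈ S, sgn σ t * θ (β σ) (D t)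
        = inner ℝ (coWhiten e s l (β σ)) (sgn σ t • whiten e s l (x t)) := by
      intro t ht
      rw [hx t ht, inner_smul_right, inner_coWhiten_whiten e hs hl]
    rw [Finset.sum_congr rfl e1, ← inner_sum, hβ, real_inner_smul_left]
    change r / ‖Y σ‖ * inner ℝ (Y σ) (Y σ) = _
    rw [real_inner_self_eq_norm_sq]
    by_cases h : ‖Y σ‖ = 0
    · simp [h]
    · field_simp
  simp only [hsum] at hlow
  rw [← Finset.sum_div, ← Finset.mul_sum] at hlow
  have hkh := sum_signs_norm_ge S fun t => whiten e s l (x t)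
  rw [card_signs] at hkh
  -- The trace is at least c²n²l/32, and 0.17² < 1/32. On the other side 0.17 · 5/9 · 2/3 exceeds
  -- 1/16, which yields the final constant 16² = 256.
  have hq : 0.17 * (c * n * √l) ≤ √(∑ u ∈ S, ‖whiten e s l (x u)‖ ^ 2) := by
    refine Real.le_sqrt_of_sq_le ?_
    refine le_trans ?_ htr
    rw [mul_pow, mul_pow, Real.sq_sqrt hl.le]
    have h1 : n * (c ^ 2 / 2 * n / 4 * l) ≤ n * effDim s l := by gcongr
    have h2 : 0 ≤ c ^ 2 * n ^ 2 * l := by positivity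
    nlinarith
  have h2T : (0 : ℝ) < 2 ^ T := by positivity
  have hfin : r * (5 / 9 * (0.17 * (c * √l))) ≤ δ ^ 2 / r₀ := by
    refine le_trans ?_ (hlow.trans hcrit)
    rw [le_div_iff₀ h2T, le_div_iff₀ hn]
    calc r * (5 / 9 * (0.17 * (c * √l))) * 2 ^ T * n
        = r * (2 ^ T * (5 / 9 * (0.17 * (c * n * √l)))) := by ring
      _ ≤ r * (2 ^ T * (5 / 9 * √(∑ u ∈ S, ‖whiten e s l (x u)‖ ^ 2))) := by gcongr
      _ ≤ _ := by gcongr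
  rw [le_div_iff₀ hr₀, hr] at hfin
  have hfin2 : c * √l * r₀ ≤ 16 * δ := by
    have h1 : δ * (c * √l * r₀ * (2 / 3 * (5 / 9 * 0.17))) ≤ δ * δ := by nlinarith
    have h2 := le_of_mul_le_mul_left h1 hδ0
    have : 0 ≤ c * √l * r₀ := by positivity
    nlinarith
  calc c ^ 2 * (l * r₀ ^ 2) = (c * √l * r₀) ^ 2 := by
        rw [mul_pow, mul_pow, Real.sq_sqrt hl.le]; ring
    _ ≤ (16 * δ) ^ 2 := pow_le_pow_left₀ (by positivity) hfin2 2
    _ = 256 * δ ^ 2 := by ring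

/-! ### Critical radii of finite-dimensional classes -/

/-- Nonnegativity of `G` takes care of an empty localized class, whose `sSup` is zero. -/
theorem localRademacher_le {ρ : Type*} {T : ℕ} (D : Fin T → ρ) (S : Finset (Fin T))
    (F : Set (ρ → ℝ)) (η b : ℝ) (G : (Fin T → ℤˣ) → ℝ)
    (h0 : ∀ s, 0 ≤ G s)
    (h : ∀ s, ∀ q ∈ F, √(empMean D S fun r => q r ^ 2) ≤ η →
      (∑ t ∈ S, sgn s t * q (D t)) / (S.card : ℝ) ≤ G s)
    (hG : ∑ s, G s ≤ 2 ^ T * b) : localRademacher D S F η ≤ b := by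
  unfold localRademacher
  rw [div_le_iff₀ (by positivity), mul_comm]
  refine (Finset.sum_le_sum fun s _ => ?_).trans hG
  refine Real.sSup_le ?_ (h0 s)
  rintro _ ⟨q, ⟨hq, hη⟩, rfl⟩
  exact h s q hq hη

/-- Massart's finite class bound for a class that is approximated by a finite set of functions. -/
theorem localRademacher_le_of_net {ρ Z : Type*} {T : ℕ} (D : Fin T → ρ) {S : Finset (Fin T)}
    (hS : S.Nonempty) (F : Set (ρ → ℝ)) {δ Λ g a : ℝ} (G : Finset Z) (Q : Z → ρ → ℝ)
    (hδ : 0 < δ) (hΛ : 0 ≤ Λ) (ha : 0 < a) (hg : 0 ≤ g) (hG : (G.card : ℝ) ≤ Real.exp g)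
    (hnet : ∀ q ∈ F, ∃ z ∈ G, ∀ t ∈ S, |q (D t) - Q z (D t)| ≤ Λ / S.card)
    (hΛδ : Λ / S.card ≤ δ) :
    localRademacher D S F δ ≤ (Λ + (g + 1) / a + 2 * a * (S.card * δ ^ 2)) / S.card := by
  classical
  set n : ℝ := (S.card : ℝ) with hn
  have hn0 : 0 < n := Nat.cast_pos.2 hS.card_pos
  set G' := G.filter fun z => ∑ t ∈ S, Q z (D t) ^ 2 ≤ n * (4 * δ ^ 2) with hG'
  set b := (g + 2 * a ^ 2 * (n * δ ^ 2)) / a with hb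
  have hb0 : 0 ≤ b := by positivity
  refine localRademacher_le D S F δ _
    (fun s => (Λ + (b + 1 / a * ∑ z ∈ G', Real.exp (a * (∑ t ∈ S, sgn s t * Q z (D t)) - a * b))) / n)
    (fun s => ?_) (fun s q hq hqδ => ?_) ?_
  · have : 0 ≤ ∑ z ∈ G', Real.exp (a * (∑ t ∈ S, sgn s t * Q z (D t)) - a * b) :=
      Finset.sum_nonneg fun _ _ => (Real.exp_pos _).le
    positivity
  · obtain ⟨z, hz, hzq⟩ := hnet q hq
    rw [← hn]
    gcongr
    have hsum : ∑ t ∈ S, sgn s t * q (D t) ≤ Λ + ∑ t ∈ S, sgn s t * Q z (D t) := by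
      have h1 : ∀ t ∈ S, sgn s t * q (D t) ≤ Λ / n + sgn s t * Q z (D t) := by
        intro t ht
        have := abs_le.1 (hzq t ht)
        rcases sgn_eq s t with h | h <;> rw [h] <;> linarith
      refine (Finset.sum_le_sum h1).trans (le_of_eq ?_)
      rw [Finset.sum_add_distrib, Finset.sum_const, nsmul_eq_mul, ← hn]
      field_simp
    have hzG : z ∈ G' := by
      rw [hG', Finset.mem_filter]
      refine ⟨hz, ?_⟩
      have hq2 : ∑ t ∈ S, q (D t) ^ 2 ≤ n * δ ^ 2 := by
        have := (Real.sqrt_le_left hδ.le).1 hqδ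
        unfold empMean at this
        rw [div_le_iff₀ hn0] at this
        linarith
      have h1 : ∀ t ∈ S, Q z (D t) ^ 2 ≤ 2 * q (D t) ^ 2 + 2 * δ ^ 2 := by
        intro t ht
        have h2 : (q (D t) - Q z (D t)) ^ 2 ≤ δ ^ 2 :=
          sq_le_sq' (by linarith [(abs_le.1 (hzq t ht)).1]) (by linarith [(abs_le.1 (hzq t ht)).2])
        nlinarith [sq_nonneg (2 * q (D t) - Q z (D t))]
      refine (Finset.sum_le_sum h1).trans ?_
      rw [Finset.sum_add_distrib, ← Finset.mul_sum, Finset.sum_const, nsmul_eq_mul, ← hn]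
      linarith
    have hexp : ∑ t ∈ S, sgn s t * Q z (D t) - b
        ≤ 1 / a * Real.exp (a * (∑ t ∈ S, sgn s t * Q z (D t)) - a * b) := by
      rw [one_div, inv_mul_eq_div, le_div_iff₀ ha]
      have := Real.add_one_le_exp (a * (∑ t ∈ S, sgn s t * Q z (D t)) - a * b)
      linarith
    have hle : Real.exp (a * (∑ t ∈ S, sgn s t * Q z (D t)) - a * b)
        ≤ ∑ z ∈ G', Real.exp (a * (∑ t ∈ S, sgn s t * Q z (D t)) - a * b) :=
      Finset.single_le_sum (f := fun z => Real.exp (a * (∑ t ∈ S, sgn s t * Q z (D t)) - a * b))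
        (fun _ _ => (Real.exp_pos _).le) hzG
    have := mul_le_mul_of_nonneg_left hle (one_div_pos.2 ha).le
    linarith
  · have hswap : ∑ s : Fin T → ℤˣ, ∑ z ∈ G', Real.exp (a * (∑ t ∈ S, sgn s t * Q z (D t)) - a * b)
        ≤ 2 ^ T := by
      rw [Finset.sum_comm]
      have h1 : ∀ z ∈ G', ∑ s : Fin T → ℤˣ, Real.exp (a * (∑ t ∈ S, sgn s t * Q z (D t)) - a * b)
          ≤ 2 ^ T * Real.exp (-g) := by
        intro z hz
        simp only [Real.exp_sub]
        rw [← Finset.sum_div, div_le_iff₀ (Real.exp_pos _)]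
        refine (sum_signs_exp_le S (fun t => Q z (D t)) a).trans ?_
        rw [card_signs, mul_assoc, ← Real.exp_add]
        gcongr
        have h2 := (Finset.mem_filter.1 hz).2
        have h3 : a * b = g + 2 * a ^ 2 * (n * δ ^ 2) := by rw [hb]; field_simp
        rw [h3]
        nlinarith [sq_nonneg a]
      refine (Finset.sum_le_sum h1).trans ?_
      rw [Finset.sum_const, nsmul_eq_mul, ← mul_assoc, mul_comm (_ : ℝ) (2 ^ T), mul_assoc]
      refine mul_le_of_le_one_right (by positivity) ?_
      have h4 : (G'.card : ℝ) ≤ Real.exp g :=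
        (Nat.cast_le.2 (Finset.card_filter_le _ _)).trans hG
      calc (G'.card : ℝ) * Real.exp (-g) ≤ Real.exp g * Real.exp (-g) := by gcongr
        _ = 1 := by rw [← Real.exp_add]; simp
    rw [← Finset.sum_div, Finset.sum_add_distrib, Finset.sum_add_distrib, ← Finset.mul_sum]
    simp only [Finset.sum_const, Finset.card_univ, nsmul_eq_mul]
    rw [card_signs, ← mul_div_assoc (2 ^ T : ℝ) _ n]
    refine div_le_div_of_nonneg_right ?_ hn0.le
    have h5 := mul_le_mul_of_nonneg_left hswap (one_div_pos.2 ha).le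
    have h6 : b = g / a + 2 * a * (n * δ ^ 2) := by rw [hb]; field_simp
    have h7 : (g + 1) / a = g / a + 1 / a := by ring
    have h8 : (2 : ℝ) ^ T * b = 2 ^ T * (g / a + 2 * a * (n * δ ^ 2)) := by rw [h6]
    rw [h7]
    linarith

/-- A constant for which `isCriticalRadius_of_lipschitz` holds. -/
def critConst (R Λ c : ℝ) : ℝ := 1 + Λ + 2 * c * Λ + c * (3 * √(4 * R + 6) + 2 * Λ)

/-- The grid has mesh n⁻² in each parameter, so its log-cardinality is of order (number of
parameters) · log n. The lower bound log n ≥ 1/2 lets log n also absorb the dependence on `R`. -/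
theorem card_grid_le {ι : Type*} [Fintype ι] [DecidableEq ι] {R : ℝ} (hR : 0 ≤ R) {n : ℕ}
    (hn : 2 ≤ n) :
    ((Fintype.piFinset fun _ : ι => Finset.Icc ⌊-(R * n ^ 2)⌋ ⌊R * n ^ 2⌋).card : ℝ)
      ≤ Real.exp ((4 * R + 4) * Fintype.card ι * Real.log n) := by
  have hn' : (2 : ℝ) ≤ n := by exact_mod_cast hn
  have hlog : 1 / 2 ≤ Real.log n := by
    have := Real.log_le_log (by norm_num) hn'
    linarith [Real.log_two_gt_d9]
  have hcard : ((Finset.Icc ⌊-(R * n ^ 2)⌋ ⌊R * (n : ℝ) ^ 2⌋).card : ℝ) ≤ (2 * R + 2) * n ^ 2 := by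
    rw [Int.card_Icc]
    have h1 : ((⌊R * (n : ℝ) ^ 2⌋ + 1 - ⌊-(R * (n : ℝ) ^ 2)⌋ : ℤ) : ℝ) ≤ (2 * R + 2) * n ^ 2 := by
      push_cast
      have a1 := Int.floor_le (R * (n : ℝ) ^ 2)
      have a2 := Int.lt_floor_add_one (-(R * (n : ℝ) ^ 2))
      nlinarith
    have h2 : (0 : ℤ) ≤ ⌊R * (n : ℝ) ^ 2⌋ + 1 - ⌊-(R * (n : ℝ) ^ 2)⌋ := by
      have : ⌊-(R * (n : ℝ) ^ 2)⌋ ≤ ⌊R * (n : ℝ) ^ 2⌋ := Int.floor_le_floor (by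
        have : 0 ≤ R * (n : ℝ) ^ 2 := by positivity
        linarith)
      omega
    rw [← Int.cast_natCast, Int.toNat_of_nonneg h2]
    exact h1
  have hexp : (2 * R + 2) * n ^ 2 ≤ Real.exp ((4 * R + 4) * Real.log n) := by
    have h1 : 2 * R + 2 ≤ Real.exp (2 * (2 * R + 1) * Real.log n) := by
      have := Real.add_one_le_exp (2 * R + 1)
      calc 2 * R + 2 ≤ Real.exp (2 * R + 1) := by linarith
        _ ≤ _ := Real.exp_le_exp.2 (by nlinarith)
    have h2 : (n : ℝ) ^ 2 = Real.exp (2 * Real.log n) := by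
      rw [two_mul, Real.exp_add, Real.exp_log (by linarith), sq]
    calc (2 * R + 2) * (n : ℝ) ^ 2
        ≤ Real.exp (2 * (2 * R + 1) * Real.log n) * Real.exp (2 * Real.log n) := by
          rw [← h2]; gcongr
      _ = _ := by rw [← Real.exp_add]; congr 1; ring
  rw [Fintype.card_piFinset, Finset.prod_const, Finset.card_univ, Nat.cast_pow]
  calc _ ≤ Real.exp ((4 * R + 4) * Real.log n) ^ Fintype.card ι := by
        gcongr; exact hcard.trans hexp
    _ = _ := by rw [← Real.exp_nat_mul]; congr 1; ring

/-- A class with finitely many bounded parameters on which it depends in a Lipschitz way has a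
critical radius of parametric order. -/
theorem isCriticalRadius_of_lipschitz {R Λ c K : ℝ} (hR : 0 ≤ R) (hΛ : 0 ≤ Λ) (hc : 0 < c)
    (hK : critConst R Λ c ≤ K) {ρ ι : Type*} {T : ℕ} (D : Fin T → ρ) (S : Finset (Fin T))
    (hS : 2 ≤ S.card) [Fintype ι] {A : ℝ} (hA : Fintype.card ι + 1 ≤ A) (P : Set (ι → ℝ))
    (q : (ι → ℝ) → ρ → ℝ) {F : Set (ρ → ℝ)} (hF : F ⊆ q '' P)
    (hbox : ∀ p ∈ P, ∀ i, |p i| ≤ R) (hbd : ∀ p ∈ P, ∀ t ∈ S, |q p (D t)| ≤ Λ)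
    (hlip : ∀ p ∈ P, ∀ (p' : ι → ℝ) (h : ℝ), 0 ≤ h → h * Fintype.card ι ≤ 1 → (∀ i, |p i - p' i| ≤ h) →
      ∀ t ∈ S, |q p (D t) - q p' (D t)| ≤ Λ * (h * Fintype.card ι)) :
    IsCriticalRadius D S F c (K * √(A * Real.log S.card / S.card)) := by
  classical
  have hSne : S.Nonempty := Finset.card_pos.1 (by omega)
  set n : ℝ := (S.card : ℝ) with hn
  have hn2 : (2 : ℝ) ≤ n := by rw [hn]; exact_mod_cast hS
  set N : ℝ := (Fintype.card ι : ℝ) with hN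
  have hN0 : 0 ≤ N := Nat.cast_nonneg _
  have hlog : 1 / 2 ≤ Real.log n := by
    have := Real.log_le_log (by norm_num) hn2
    linarith [Real.log_two_gt_d9]
  have hsq0 : 0 ≤ √(4 * R + 6) := Real.sqrt_nonneg _
  unfold critConst at hK
  have hcΛ : 0 ≤ c * Λ := by positivity
  have hcs : 0 ≤ c * √(4 * R + 6) := by positivity
  have hK1 : 1 ≤ K := by nlinarith
  have hKΛ : Λ ≤ K := by nlinarith
  set u := √(A * Real.log n / n) with hu
  have hAlog : 1 / 2 ≤ A * Real.log n := by nlinarith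
  have hu2 : u ^ 2 = A * Real.log n / n := Real.sq_sqrt (by positivity)
  have hu0 : 0 < u := Real.sqrt_pos.2 (by positivity)
  set δ := K * u with hδ
  have hδ0 : 0 < δ := by positivity
  refine ⟨hδ0, ?_⟩
  have hδ2 : δ ^ 2 = K ^ 2 * u ^ 2 := by rw [hδ]; ring
  rcases le_or_gt n A with hAn | hAn
  -- With more parameters than observations, δ² ≥ K²/2 and the trivial bound `Λ` on the complexity
  -- suffices.
  · have hu12 : 1 / 2 ≤ u ^ 2 := by
      rw [hu2, le_div_iff₀ (by linarith)]
      nlinarith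
    refine localRademacher_le D S F δ _ (fun _ => Λ) (fun _ => hΛ) (fun s f hf _ => ?_) ?_ |>.trans
      (show Λ ≤ δ ^ 2 / c from ?_)
    · obtain ⟨p, hp, rfl⟩ := hF hf
      rw [div_le_iff₀ (by linarith)]
      calc ∑ t ∈ S, sgn s t * q p (D t) ≤ ∑ t ∈ S, Λ := by
            refine Finset.sum_le_sum fun t ht => ?_
            have := abs_le.1 (hbd p hp t ht)
            rcases sgn_eq s t with h | h <;> rw [h] <;> linarith
        _ = Λ * S.card := by simp [mul_comm]
    · simp [Finset.card_univ, Fintype.card_units_int]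
    · rw [le_div_iff₀ hc, hδ2]
      have : K ≤ K ^ 2 := by nlinarith
      nlinarith
  · have hNn : N ≤ n := by linarith
    -- Rounding every parameter down to mesh n⁻² costs at most Λ · N/n² ≤ Λ/n, because here the
    -- number `N` of parameters is at most `n`.
    have hnet : ∀ f ∈ F, ∃ z ∈ Fintype.piFinset fun _ : ι =>
        Finset.Icc ⌊-(R * (S.card : ℝ) ^ 2)⌋ ⌊R * (S.card : ℝ) ^ 2⌋,
        ∀ t ∈ S, |f (D t) - q (fun i => (z i : ℝ) / n ^ 2) (D t)| ≤ Λ / S.card := by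
      intro f hf
      obtain ⟨p, hp, rfl⟩ := hF hf
      refine ⟨fun i => ⌊p i * n ^ 2⌋, ?_, fun t ht => ?_⟩
      · rw [Fintype.mem_piFinset]
        intro i
        have := abs_le.1 (hbox p hp i)
        rw [Finset.mem_Icc]
        constructor
        · refine Int.floor_le_floor ?_
          rw [← hn]
          nlinarith [sq_nonneg n]
        · refine Int.floor_le_floor ?_
          rw [← hn]
          nlinarith [sq_nonneg n]
      · have hh : 1 / n ^ 2 * N ≤ 1 / n := by
          rw [div_mul_eq_mul_div, div_le_div_iff₀ (by positivity) (by positivity)]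
          nlinarith
        refine (hlip p hp _ (1 / n ^ 2) (by positivity) (hh.trans ?_) (fun i => ?_) t ht).trans ?_
        · rw [div_le_one (by linarith)]; linarith
        · have hn20 : 0 < n ^ 2 := by positivity
          have e1 : p i - (⌊p i * n ^ 2⌋ : ℝ) / n ^ 2 = (p i * n ^ 2 - ⌊p i * n ^ 2⌋) / n ^ 2 := by
            field_simp
          rw [e1, abs_div, abs_of_pos hn20]
          gcongr
          rw [abs_le]
          constructor <;> linarith [Int.floor_le (p i * n ^ 2), Int.lt_floor_add_one (p i * n ^ 2)]
        · rw [← hn, div_eq_mul_one_div Λ n]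
          gcongr
    have hu1 : 1 / n ≤ u := by
      refine Real.le_sqrt_of_sq_le ?_
      rw [div_pow, one_pow, div_le_div_iff₀ (by positivity) (by linarith)]
      nlinarith
    have hΛδ : Λ / S.card ≤ δ := by
      rw [← hn, div_eq_mul_one_div]
      exact mul_le_mul hKΛ hu1 (by positivity) (by linarith)
    set w := √(4 * R + 6) with hw
    have hw2 : w ^ 2 = 4 * R + 6 := Real.sq_sqrt (by linarith)
    have hw1 : 0 < w := Real.sqrt_pos.2 (by linarith)
    -- This `a` balances the bound: the entropy term is at most wK·nu² and the variance term equals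
    -- 2wK·nu². Since `K` dominates c(3w + 2Λ), the total is at most n δ²/c.
    have key := localRademacher_le_of_net D hSne F (a := w / K) _ _ hδ0 hΛ (by positivity)
      (show 0 ≤ (4 * R + 4) * N * Real.log n by positivity)
      (by rw [hN, hn]; exact card_grid_le hR hS) hnet hΛδ
    refine key.trans ?_
    rw [← hn]
    have hnu : A * Real.log n = n * u ^ 2 := by rw [hu2]; field_simp
    have h1 : (4 * R + 4) * N * Real.log n + 1 ≤ w ^ 2 * (n * u ^ 2) := by
      rw [← hnu, hw2]
      have h0 : N * Real.log n ≤ A * Real.log n :=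
        mul_le_mul_of_nonneg_right (by linarith) (by linarith)
      linarith [mul_nonneg (show 0 ≤ 4 * R + 4 by linarith) (sub_nonneg.2 h0)]
    have h2 : ((4 * R + 4) * N * Real.log n + 1) / (w / K) ≤ w * K * (n * u ^ 2) := by
      rw [div_le_iff₀ (by positivity)]
      refine h1.trans (le_of_eq ?_)
      field_simp
    have h3 : 2 * (w / K) * (n * δ ^ 2) = 2 * w * K * (n * u ^ 2) := by
      rw [hδ2]; field_simp
    have h4 : Λ ≤ 2 * Λ * (n * u ^ 2) := by
      rw [← hnu]
      linarith [mul_nonneg hΛ (sub_nonneg.2 hAlog)]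
    rw [h3, div_le_div_iff₀ (by linarith) hc]
    clear_value n N w u δ
    have h5 : Λ + ((4 * R + 4) * N * Real.log n + 1) / (w / K) + 2 * w * K * (n * u ^ 2)
        ≤ (2 * Λ + 3 * w * K) * (n * u ^ 2) := by linarith
    refine (mul_le_mul_of_nonneg_right h5 hc.le).trans ?_
    rw [hδ2]
    have h6 : (2 * Λ + 3 * w * K) * c ≤ K ^ 2 := by
      have h7 : c * (3 * w + 2 * Λ) ≤ K := by linarith
      have h8 : (2 * Λ + 3 * w * K) * c ≤ K * (c * (3 * w + 2 * Λ)) := by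
        linarith [mul_nonneg (sub_nonneg.2 hK1) hcΛ]
      have h10 : K * (c * (3 * w + 2 * Λ)) ≤ K * K := by gcongr
      linarith
    have h9 : 0 ≤ n * u ^ 2 := by positivity
    calc (2 * Λ + 3 * w * K) * (n * u ^ 2) * c = (2 * Λ + 3 * w * K) * c * (n * u ^ 2) := by ring
      _ ≤ K ^ 2 * (n * u ^ 2) := by gcongr
      _ = _ := by ring

/-! ### Laws of trajectories -/

namespace TwoStageDTR

variable {𝒳₁ 𝒜₁ 𝒳₂ 𝒜₂ 𝒰 : Type*} [MeasurableSpace 𝒳₁] [MeasurableSpace 𝒜₁]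
  [MeasurableSpace 𝒳₂] [MeasurableSpace 𝒜₂] [MeasurableSpace 𝒰]
  (M : TwoStageDTR 𝒳₁ 𝒜₁ 𝒳₂ 𝒜₂ 𝒰)

/-- The law of `(((X₁, U), A₁), X₂)`. -/
def stateLaw (q : Measure 𝒳₁) (k₁ : Kernel 𝒳₁ 𝒜₁) : Measure (((𝒳₁ × 𝒰) × 𝒜₁) × 𝒳₂) :=
  (((q.prod M.conf)
    ⊗ₘ k₁.comap (fun p : 𝒳₁ × 𝒰 => p.1) (by fun_prop))
    ⊗ₘ M.trans.comap
      (fun p : (𝒳₁ × 𝒰) × 𝒜₁ => (p.1.1, p.2, p.1.2)) (by fun_prop))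

instance (q : Measure 𝒳₁) [IsProbabilityMeasure q] (k₁ : Kernel 𝒳₁ 𝒜₁) [IsMarkovKernel k₁]
    (k₂ : Kernel (𝒳₁ × 𝒜₁ × 𝒳₂ × ℝ × 𝒰) 𝒜₂) [IsMarkovKernel k₂] :
    IsProbabilityMeasure (M.pathLaw q k₁ k₂) := by unfold pathLaw; infer_instance

instance : IsProbabilityMeasure M.obsLaw := by unfold obsLaw; infer_instance

instance : IsMarkovKernel M.stateTrans := by unfold stateTrans; infer_instance

instance (π : DTRPolicy 𝒳₁ 𝒜₁ 𝒳₂ 𝒜₂) : IsProbabilityMeasure (M.visitLaw π) := by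
  unfold visitLaw; infer_instance

section Disintegration

variable [StandardBorelSpace 𝒳₂] [StandardBorelSpace 𝒰] [Nonempty 𝒰]

/-- Bayes' rule for (X₂, U): drawing X₂ from its marginal and then U from its posterior is the same
as drawing U from its prior and then X₂. -/
theorem lintegral_stateTrans_condKernel (h : 𝒳₁ × 𝒜₁) {F : 𝒳₂ × 𝒰 → ENNReal} (hF : Measurable F) :
    ∫⁻ x₂, ∫⁻ u, F (x₂, u) ∂(M.stateConf.condKernel (h, x₂)) ∂(M.stateTrans h)
      = ∫⁻ u, ∫⁻ x₂, F (x₂, u) ∂(M.trans (h.1, h.2, u)) ∂M.conf := by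
  rw [stateTrans, ← Kernel.lintegral_compProd _ _ _ hF, Kernel.disintegrate, stateConf,
    Kernel.lintegral_swapRight _ _ hF, Kernel.lintegral_compProd _ _ _ (by fun_prop)]
  simp [Kernel.const_apply]

/-- U is independent of (X₁, A₁), so its law given (X₁, A₁, X₂) is the same kernel for every initial
law and every first-stage policy. This is why the observational and interventional processes share
the posterior of U. -/
theorem map_stateLaw (q : Measure 𝒳₁) [IsProbabilityMeasure q] (k₁ : Kernel 𝒳₁ 𝒜₁)
    [IsMarkovKernel k₁] :
    (M.stateLaw q k₁).map (fun p => (((p.1.1.1, p.1.2), p.2), p.1.1.2))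
      = ((q ⊗ₘ k₁) ⊗ₘ M.stateTrans) ⊗ₘ M.stateConf.condKernel := by
  refine Measure.ext_of_lintegral _ fun F hF => ?_
  rw [lintegral_map hF (by fun_prop), stateLaw, Measure.lintegral_compProd (by fun_prop),
    Measure.lintegral_compProd (by fun_prop), lintegral_prod _ (Measurable.aemeasurable (by fun_prop)),
    Measure.lintegral_compProd hF, Measure.lintegral_compProd (by fun_prop),
    Measure.lintegral_compProd (by fun_prop)]
  refine lintegral_congr fun x => ?_
  simp only [Kernel.comap_apply]
  rw [lintegral_lintegral_swap]
  · refine lintegral_congr fun a => ?_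
    rw [M.lintegral_stateTrans_condKernel (x, a) (F := fun p => F (((x, a), p.1), p.2)) (by fun_prop)]
  · have : Measurable fun p : 𝒰 × 𝒜₁ => ∫⁻ x₂, F (((x, p.2), x₂), p.1)
        ∂(M.trans.comap (fun p : 𝒰 × 𝒜₁ => (x, p.2, p.1)) (by fun_prop)) p := by fun_prop
    exact this.aemeasurable

/-- An interventional policy draws A₂ from (X₁, A₁, X₂) alone, so A₂ and U are conditionally
independent given these and the order of their draws can be exchanged by Tonelli. Under the
confounded behaviour policy this exchange is not available. -/
theorem map_intLaw (π : DTRPolicy 𝒳₁ 𝒜₁ 𝒳₂ 𝒜₂) :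
    (M.intLaw π).map (fun p => ((p.hist, p.1.1.1.1.1.2), p.eps))
      = (M.visitLaw π ⊗ₘ M.stateConf.condKernel.comap
          (fun s : DTRHist 𝒳₁ 𝒜₁ 𝒳₂ 𝒜₂ => s.1) (by fun_prop))
        ⊗ₘ M.noise.comap (fun p : DTRHist 𝒳₁ 𝒜₁ 𝒳₂ 𝒜₂ × 𝒰 => (p.2, p.1.1.1.1, p.1.1.2))
          (by fun_prop) := by
  refine Measure.ext_of_lintegral _ fun F hF => ?_
  have hmh : Measurable fun p : DTRPath 𝒳₁ 𝒜₁ 𝒳₂ 𝒜₂ 𝒰 => ((p.hist, p.1.1.1.1.1.2), p.eps) := by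
    unfold DTRPath.hist DTRPath.eps; fun_prop
  have hFm : Measurable fun p : DTRPath 𝒳₁ 𝒜₁ 𝒳₂ 𝒜₂ 𝒰 => F ((p.hist, p.1.1.1.1.1.2), p.eps) :=
    hF.comp hmh
  -- the function of `(X₁, A₁, X₂, U)` and `A₂` obtained by integrating the noise out
  let G : ((((𝒳₁ × 𝒜₁) × 𝒳₂) × 𝒰) × 𝒜₂) → ENNReal := fun p =>
    ∫⁻ e, F (((p.1.1, p.2), p.1.2), e)
      ∂(M.noise.comap (fun p : ((((𝒳₁ × 𝒜₁) × 𝒳₂) × 𝒰) × 𝒜₂) => (p.1.2, p.1.1.1.1, p.1.1.2))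
        (by fun_prop)) p
  have hG : Measurable G := by fun_prop
  let κ : Kernel (((𝒳₁ × 𝒜₁) × 𝒳₂) × 𝒰) 𝒜₂ :=
    π.snd.comap (fun p => (p.1.1.1, p.1.1.2, p.1.2)) (by fun_prop)
  have hGκ : Measurable fun p => ∫⁻ a, G (p, a) ∂(κ p) := by fun_prop
  have hL : ∫⁻ p, F ((p.hist, p.1.1.1.1.1.2), p.eps) ∂(M.intLaw π)
      = ∫⁻ p, ∫⁻ a, G ((((((p.1.1.1, p.1.2), p.2), p.1.1.2)) : (((𝒳₁ × 𝒜₁) × 𝒳₂) × 𝒰)), a)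
        ∂(κ (((p.1.1.1, p.1.2), p.2), p.1.1.2)) ∂(M.stateLaw M.ctxNew π.fst) := by
    unfold intLaw pathLaw
    rw [Measure.lintegral_compProd hFm, Measure.lintegral_compProd (by
        unfold DTRPath.hist DTRPath.eps; fun_prop), Measure.lintegral_compProd (by
        unfold DTRPath.hist DTRPath.eps; fun_prop)]
    refine lintegral_congr fun p => ?_
    simp only [Kernel.comap_apply, DTRPath.hist, DTRPath.eps, G, κ]
    rw [lintegral_const]
    simp
  have hR : ∫⁻ p, F p ∂((M.visitLaw π ⊗ₘ M.stateConf.condKernel.comap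
          (fun s : DTRHist 𝒳₁ 𝒜₁ 𝒳₂ 𝒜₂ => s.1) (by fun_prop))
        ⊗ₘ M.noise.comap (fun p : DTRHist 𝒳₁ 𝒜₁ 𝒳₂ 𝒜₂ × 𝒰 => (p.2, p.1.1.1.1, p.1.1.2))
          (by fun_prop))
      = ∫⁻ h, ∫⁻ a, ∫⁻ u, G ((h, u), a) ∂(M.stateConf.condKernel h)
          ∂(π.snd (h.1.1, h.1.2, h.2)) ∂((M.ctxNew ⊗ₘ π.fst) ⊗ₘ M.stateTrans) := by
    rw [Measure.lintegral_compProd hF, Measure.lintegral_compProd (by fun_prop), visitLaw,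
      Measure.lintegral_compProd (by fun_prop)]
    rfl
  rw [lintegral_map hF hmh, hL, hR, ← lintegral_map (μ := M.stateLaw M.ctxNew π.fst)
    (g := fun p => (((p.1.1.1, p.1.2), p.2), p.1.1.2)) hGκ (by fun_prop), map_stateLaw,
    Measure.lintegral_compProd hGκ]
  refine lintegral_congr fun h => ?_
  simp only [Kernel.comap_apply, κ]
  rw [lintegral_lintegral_swap]
  have : Measurable fun p : 𝒰 × 𝒜₂ => G ((h, p.1), p.2) := by fun_prop
  exact this.aemeasurable

end Disintegration

end TwoStageDTR

/-! ### Conditional expectations given a random variable; measurability of the coordinates. -/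

theorem integrable_integral_compProd {α β : Type*} [MeasurableSpace α] [MeasurableSpace β]
    {μ : Measure α} [SFinite μ] {κ : Kernel α β} [IsSFiniteKernel κ] {f : α × β → ℝ}
    (hf : Integrable f (μ ⊗ₘ κ)) : Integrable (fun x => ∫ y, f (x, y) ∂(κ x)) μ := by
  have h := Integrable.integral_compProd (a := ()) (κ := Kernel.const Unit μ)
    (η := Kernel.prodMkLeft Unit κ) hf
  simpa using h

theorem condExp_comap_eq_zero {Ω β : Type*} [MeasurableSpace Ω] [MeasurableSpace β] {μ : Measure Ω}
    [IsFiniteMeasure μ] {V : Ω → β} (hV : Measurable V) {Z : Ω → ℝ} (hZ : Integrable Z μ)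
    (h : ∀ B, MeasurableSet B → ∫ x in V ⁻¹' B, Z x ∂μ = 0) :
    μ[Z | MeasurableSpace.comap V inferInstance] =ᵐ[μ] 0 := by
  refine (ae_eq_condExp_of_forall_setIntegral_eq hV.comap_le hZ (fun s _ _ => integrableOn_zero)
    (fun s hs _ => ?_) aestronglyMeasurable_zero).symm
  obtain ⟨B, hB, rfl⟩ := hs
  simp [h B hB]

theorem setIntegral_eq_zero_of_condExp_comap {Ω β : Type*} [MeasurableSpace Ω] [MeasurableSpace β]
    {μ : Measure Ω} [IsFiniteMeasure μ] {V : Ω → β} (hV : Measurable V) {Z : Ω → ℝ}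
    (hZ : Integrable Z μ) (h : μ[Z | MeasurableSpace.comap V inferInstance] =ᵐ[μ] 0) {B : Set β}
    (hB : MeasurableSet B) : ∫ x in V ⁻¹' B, Z x ∂μ = 0 := by
  rw [← setIntegral_condExp hV.comap_le hZ ⟨B, hB, rfl⟩, integral_congr_ae (ae_restrict_of_ae h)]
  simp

namespace DTRPath

variable {𝒳₁ 𝒜₁ 𝒳₂ 𝒜₂ 𝒰 : Type*} [MeasurableSpace 𝒳₁] [MeasurableSpace 𝒜₁]
  [MeasurableSpace 𝒳₂] [MeasurableSpace 𝒜₂] [MeasurableSpace 𝒰]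

@[fun_prop]
theorem measurable_hist : Measurable (hist : DTRPath 𝒳₁ 𝒜₁ 𝒳₂ 𝒜₂ 𝒰 → _) := by
  unfold hist; fun_prop

@[fun_prop]
theorem measurable_y₁ : Measurable (y₁ : DTRPath 𝒳₁ 𝒜₁ 𝒳₂ 𝒜₂ 𝒰 → ℝ) := by unfold y₁; fun_prop

@[fun_prop]
theorem measurable_eps : Measurable (eps : DTRPath 𝒳₁ 𝒜₁ 𝒳₂ 𝒜₂ 𝒰 → ℝ) := by unfold eps; fun_prop

end DTRPath

namespace TwoStageDTR

variable {𝒳₁ 𝒜₁ 𝒳₂ 𝒜₂ 𝒰 : Type*} [MeasurableSpace 𝒳₁] [MeasurableSpace 𝒜₁]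
  [MeasurableSpace 𝒳₂] [MeasurableSpace 𝒜₂] [MeasurableSpace 𝒰]
  (M : TwoStageDTR 𝒳₁ 𝒜₁ 𝒳₂ 𝒜₂ 𝒰)

@[fun_prop]
theorem measurable_y₂ : Measurable (M.y₂ : DTRPath 𝒳₁ 𝒜₁ 𝒳₂ 𝒜₂ 𝒰 → ℝ) := by
  unfold y₂
  exact (M.measurable_f.comp DTRPath.measurable_hist).add DTRPath.measurable_eps

@[fun_prop]
theorem measurable_ay : Measurable (M.ay : DTRTrial 𝒳₁ 𝒜₁ 𝒳₂ 𝒜₂ 𝒰 → _) := by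
  unfold ay; fun_prop

theorem measurableSet_complete :
    MeasurableSet (complete : Set (DTRTrial 𝒳₁ 𝒜₁ 𝒳₂ 𝒜₂ 𝒰)) :=
  measurableSet_eq_fun measurable_snd measurable_const

theorem measurable_histIV : Measurable fun ω : DTRTrial 𝒳₁ 𝒜₁ 𝒳₂ 𝒜₂ 𝒰 => (ω.1.hist, ω.1.y₁) := by
  fun_prop

/-! ### Data missing at random -/

/-- The law of the missingness indicators given `(X, A)`. -/
def missKernel : Kernel (DTRHist 𝒳₁ 𝒜₁ 𝒳₂ 𝒜₂) (Bool × Bool) :=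
  (M.miss₁.comap (fun s : DTRHist 𝒳₁ 𝒜₁ 𝒳₂ 𝒜₂ => (s.1.1.1, s.1.1.2)) (by fun_prop)) ×ₖ
    (M.miss₂.comap (fun s : DTRHist 𝒳₁ 𝒜₁ 𝒳₂ 𝒜₂ => (s.1.1.1, s.1.1.2, s.1.2, s.2)) (by fun_prop))

instance : IsMarkovKernel M.missKernel := by unfold missKernel; infer_instance

/-- The probability that no context is missing given `(X, A)`. -/
def propensity (s : DTRHist 𝒳₁ 𝒜₁ 𝒳₂ 𝒜₂) : ℝ := (M.missKernel s).real {(true, true)}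

theorem measurable_propensity : Measurable M.propensity :=
  (Kernel.measurable_coe _ (measurableSet_singleton _)).ennreal_toReal

theorem propensity_nonneg (s : DTRHist 𝒳₁ 𝒜₁ 𝒳₂ 𝒜₂) : 0 ≤ M.propensity s := measureReal_nonneg

theorem propensity_le_one (s : DTRHist 𝒳₁ 𝒜₁ 𝒳₂ 𝒜₂) : M.propensity s ≤ 1 := measureReal_le_one

theorem obsLaw_eq : M.obsLaw = M.pathLaw M.ctx M.behav₁ M.behav₂ ⊗ₘ
    M.missKernel.comap DTRPath.hist DTRPath.measurable_hist := by
  unfold obsLaw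
  congr 1
  ext p : 1
  rw [Kernel.comap_apply, missKernel, Kernel.prod_apply, Kernel.prod_apply]
  rfl

theorem map_fst_obsLaw : M.obsLaw.map Prod.fst = M.pathLaw M.ctx M.behav₁ M.behav₂ := by
  rw [obsLaw_eq]
  exact Measure.fst_compProd _ _

/-- Missingness at random: for a function of the trajectory alone, integrating the indicators out
first replaces the event of completeness by its probability given (X, A). -/
theorem setIntegral_complete {G : DTRPath 𝒳₁ 𝒜₁ 𝒳₂ 𝒜₂ 𝒰 → ℝ}
    (hGi : Integrable (fun ω => G ω.1) M.obsLaw) :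
    ∫ ω in complete, G ω.1 ∂M.obsLaw = ∫ ω, M.propensity ω.1.hist * G ω.1 ∂M.obsLaw := by
  have h1 : Integrable (complete.indicator fun ω : DTRTrial 𝒳₁ 𝒜₁ 𝒳₂ 𝒜₂ 𝒰 => G ω.1) M.obsLaw :=
    hGi.indicator measurableSet_complete
  have h2 : Integrable (fun ω => M.propensity ω.1.hist * G ω.1) M.obsLaw := by
    refine hGi.bdd_mul (c := 1) (M.measurable_propensity.comp (by fun_prop)).aestronglyMeasurable
      (.of_forall fun ω => ?_)
    rw [Real.norm_of_nonneg (M.propensity_nonneg _)]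
    exact M.propensity_le_one _
  rw [← integral_indicator measurableSet_complete]
  rw [obsLaw_eq] at h1 h2 ⊢
  rw [Measure.integral_compProd h1, Measure.integral_compProd h2]
  refine integral_congr_ae (.of_forall fun p => ?_)
  have e1 : (fun r => complete.indicator (fun ω : DTRTrial 𝒳₁ 𝒜₁ 𝒳₂ 𝒜₂ 𝒰 => G ω.1) (p, r))
      = Set.indicator {(true, true)} fun _ => G p := by
    ext r
    by_cases h : r = (true, true) <;> simp [Set.indicator, complete, h]
  simp only [e1]
  rw [integral_indicator (measurableSet_singleton _), setIntegral_const, integral_const,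
    probReal_univ, one_smul]
  rfl

section MissingAtRandom

variable (hac : M.obsLaw.map (fun ω => (ω.1.hist, ω.1.y₁)) ≪
  M.completeLaw.map (fun ω => (ω.1.hist, ω.1.y₁)))
include hac

/-- Conditioning on a null event gives the zero measure, which cannot dominate a probability law. -/
theorem obsLaw_complete_ne_zero : M.obsLaw complete ≠ 0 := by
  intro h0
  have h1 : M.completeLaw = 0 := by
    unfold completeLaw
    exact cond_eq_zero_of_meas_eq_zero h0
  have h2 : M.obsLaw.map (fun ω => (ω.1.hist, ω.1.y₁)) Set.univ = 0 := hac (by simp [h1])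
  rw [Measure.map_apply (by fun_prop) MeasurableSet.univ] at h2
  simp at h2

theorem isProbabilityMeasure_completeLaw : IsProbabilityMeasure M.completeLaw := by
  have := M.obsLaw_complete_ne_zero hac
  exact cond_isProbabilityMeasure this

/-- The complete law gives no mass to histories at which completeness has probability zero, and
domination carries this over to the observational law. -/
theorem propensity_pos : ∀ᵐ ω ∂M.obsLaw, 0 < M.propensity ω.1.hist := by
  set N : Set (DTRHist 𝒳₁ 𝒜₁ 𝒳₂ 𝒜₂ × ℝ) := {s | M.propensity s.1 = 0} with hN
  have hNm : MeasurableSet N := measurableSet_eq_fun (M.measurable_propensity.comp measurable_fst)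
    measurable_const
  have h1 : M.obsLaw (complete ∩ (fun ω => (ω.1.hist, ω.1.y₁)) ⁻¹' N) = 0 := by
    have h2 := M.setIntegral_complete (G := fun p => N.indicator (fun _ => (1 : ℝ)) (p.hist, p.y₁))
      (Integrable.of_bound ((measurable_const.indicator hNm).comp (by fun_prop)).aestronglyMeasurable
        1 (.of_forall fun ω => by
          simp only [Set.indicator]; split_ifs <;> simp))
    have h3 : ∀ ω : DTRTrial 𝒳₁ 𝒜₁ 𝒳₂ 𝒜₂ 𝒰,
        M.propensity ω.1.hist * N.indicator (fun _ => (1 : ℝ)) (ω.1.hist, ω.1.y₁) = 0 := by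
      intro ω
      simp only [Set.indicator, hN, Set.mem_ofPred_eq]
      split_ifs with h
      · simp [h]
      · simp
    simp only [h3, integral_zero] at h2
    have h4 : (fun ω : DTRTrial 𝒳₁ 𝒜₁ 𝒳₂ 𝒜₂ 𝒰 => N.indicator (fun _ => (1 : ℝ)) (ω.1.hist, ω.1.y₁))
        = ((fun ω : DTRTrial 𝒳₁ 𝒜₁ 𝒳₂ 𝒜₂ 𝒰 => (ω.1.hist, ω.1.y₁)) ⁻¹' N).indicator fun _ => 1 := rfl
    have hNm' : MeasurableSet ((fun ω : DTRTrial 𝒳₁ 𝒜₁ 𝒳₂ 𝒜₂ 𝒰 => (ω.1.hist, ω.1.y₁)) ⁻¹' N) :=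
      measurable_histIV hNm
    rw [h4, integral_indicator hNm', setIntegral_const, smul_eq_mul, mul_one,
      measureReal_restrict_apply hNm', measureReal_eq_zero_iff] at h2
    rwa [Set.inter_comm]
  have h5 : M.completeLaw.map (fun ω => (ω.1.hist, ω.1.y₁)) N = 0 := by
    rw [Measure.map_apply measurable_histIV hNm, completeLaw, cond_apply measurableSet_complete,
      h1, mul_zero]
  have h6 := hac h5
  rw [Measure.map_apply measurable_histIV hNm] at h6
  filter_upwards [measure_eq_zero_iff_ae_notMem.1 h6] with ω hω
  exact lt_of_le_of_ne (M.propensity_nonneg _) fun h => hω h.symm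

/-- For an event B in σ(X, A, Y₁), the integral of F over B and completeness equals that of ρF over
B, where ρ is the propensity. Hence ρF has conditional mean zero; ρ is measurable for the
conditioning and positive, so it can be divided out. -/
theorem condExp_eq_zero_of_completeLaw {F : DTRPath 𝒳₁ 𝒜₁ 𝒳₂ 𝒜₂ 𝒰 → ℝ}
    (hFi : Integrable (fun ω => F ω.1) M.obsLaw)
    (h : M.completeLaw[fun ω => F ω.1 | sigmaHistIV] =ᵐ[M.completeLaw] 0) :
    M.obsLaw[fun ω => F ω.1 | sigmaHistIV] =ᵐ[M.obsLaw] 0 := by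
  have := M.isProbabilityMeasure_completeLaw hac
  have hp := M.obsLaw_complete_ne_zero hac
  have hFc : Integrable (fun ω => F ω.1) M.completeLaw := by
    unfold completeLaw ProbabilityTheory.cond
    exact (hFi.restrict).smul_measure (ENNReal.inv_ne_top.2 hp)
  have hprop : Measurable fun ω : DTRTrial 𝒳₁ 𝒜₁ 𝒳₂ 𝒜₂ 𝒰 => M.propensity ω.1.hist :=
    M.measurable_propensity.comp (by fun_prop)
  have hbd : ∀ ω : DTRTrial 𝒳₁ 𝒜₁ 𝒳₂ 𝒜₂ 𝒰, ‖M.propensity ω.1.hist‖ ≤ 1 := fun ω => by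
    rw [Real.norm_of_nonneg (M.propensity_nonneg _)]
    exact M.propensity_le_one _
  have hρF : Integrable (fun ω => M.propensity ω.1.hist * F ω.1) M.obsLaw :=
    hFi.bdd_mul hprop.aestronglyMeasurable (.of_forall hbd)
  have h1 : M.obsLaw[fun ω => M.propensity ω.1.hist * F ω.1 | sigmaHistIV] =ᵐ[M.obsLaw] 0 := by
    refine condExp_comap_eq_zero measurable_histIV hρF fun B hB => ?_
    have hB' : MeasurableSet ((fun ω : DTRTrial 𝒳₁ 𝒜₁ 𝒳₂ 𝒜₂ 𝒰 => (ω.1.hist, ω.1.y₁)) ⁻¹' B) :=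
      measurable_histIV hB
    have h2 := setIntegral_eq_zero_of_condExp_comap measurable_histIV hFc h hB
    rw [completeLaw, ProbabilityTheory.cond, Measure.restrict_smul, integral_smul_measure,
      Measure.restrict_restrict hB'] at h2
    have h3 : ∫ ω in (fun ω : DTRTrial 𝒳₁ 𝒜₁ 𝒳₂ 𝒜₂ 𝒰 => (ω.1.hist, ω.1.y₁)) ⁻¹' B ∩ complete, F ω.1
        ∂M.obsLaw = 0 := by
      rcases smul_eq_zero.1 h2 with h | h
      · rw [ENNReal.toReal_inv, inv_eq_zero, ENNReal.toReal_eq_zero_iff] at h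
        rcases h with h | h
        · exact absurd h hp
        · exact absurd h (measure_ne_top _ _)
      · exact h
    set G : DTRPath 𝒳₁ 𝒜₁ 𝒳₂ 𝒜₂ 𝒰 → ℝ :=
      ((fun p : DTRPath 𝒳₁ 𝒜₁ 𝒳₂ 𝒜₂ 𝒰 => (p.hist, p.y₁)) ⁻¹' B).indicator F with hG
    have hBp : MeasurableSet ((fun p : DTRPath 𝒳₁ 𝒜₁ 𝒳₂ 𝒜₂ 𝒰 => (p.hist, p.y₁)) ⁻¹' B) :=
      hB.preimage (by fun_prop)
    have e1 : (fun ω : DTRTrial 𝒳₁ 𝒜₁ 𝒳₂ 𝒜₂ 𝒰 => G ω.1)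
        = ((fun ω : DTRTrial 𝒳₁ 𝒜₁ 𝒳₂ 𝒜₂ 𝒰 => (ω.1.hist, ω.1.y₁)) ⁻¹' B).indicator
          fun ω => F ω.1 := rfl
    have hGi : Integrable (fun ω => G ω.1) M.obsLaw := by rw [e1]; exact hFi.indicator hB'
    have h4 := M.setIntegral_complete hGi
    rw [e1, integral_indicator hB', Measure.restrict_restrict hB', h3] at h4
    rw [← integral_indicator hB', h4]
    refine integral_congr_ae (.of_forall fun ω => ?_)
    by_cases h : (ω.1.hist, ω.1.y₁) ∈ B
    · simp only [Set.indicator, hG, Set.mem_preimage, h, if_true]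
    · simp only [Set.indicator, hG, Set.mem_preimage, h, if_false, mul_zero]
  have hsm : StronglyMeasurable[sigmaHistIV] fun ω : DTRTrial 𝒳₁ 𝒜₁ 𝒳₂ 𝒜₂ 𝒰 =>
      M.propensity ω.1.hist :=
    ((M.measurable_propensity.comp measurable_fst).comp
      (comap_measurable fun ω : DTRTrial 𝒳₁ 𝒜₁ 𝒳₂ 𝒜₂ 𝒰 => (ω.1.hist, ω.1.y₁))).stronglyMeasurable
  have h5 := condExp_mul_of_stronglyMeasurable_left (μ := M.obsLaw) hsm hρF hFi
  filter_upwards [h1, h5, M.propensity_pos hac] with ω w1 w2 w3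
  have : M.propensity ω.1.hist * (M.obsLaw[fun ω => F ω.1 | sigmaHistIV]) ω = 0 :=
    w2.symm.trans w1
  exact (mul_eq_zero.1 this).resolve_left w3.ne'

end MissingAtRandom

end TwoStageDTR

namespace TwoStageDTR

variable {𝒳₁ 𝒜₁ 𝒳₂ 𝒜₂ 𝒰 : Type*} [MeasurableSpace 𝒳₁] [MeasurableSpace 𝒜₁]
  [MeasurableSpace 𝒳₂] [MeasurableSpace 𝒜₂] [MeasurableSpace 𝒰]
  (M : TwoStageDTR 𝒳₁ 𝒜₁ 𝒳₂ 𝒜₂ 𝒰)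
  [StandardBorelSpace 𝒳₂] [StandardBorelSpace 𝒰] [Nonempty 𝒰]

/-! ### The noise given `(X₁, A₁, X₂)` and `Y₁` -/

/-- The observational law of `((X₁, A₁), X₂)`. -/
def firstLaw : Measure ((𝒳₁ × 𝒜₁) × 𝒳₂) := (M.ctx ⊗ₘ M.behav₁) ⊗ₘ M.stateTrans

instance : IsProbabilityMeasure M.firstLaw := by unfold firstLaw; infer_instance

/-- `Y₁` given `(X₁, A₁, X₂, U)`, which does not depend on `U`. -/
def rewardKernel : Kernel (((𝒳₁ × 𝒜₁) × 𝒳₂) × 𝒰) ℝ :=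
  M.reward₁.comap (fun p => (p.1.1.1, p.1.1.2, p.1.2)) (by fun_prop)

instance : IsMarkovKernel M.rewardKernel := by unfold rewardKernel; infer_instance

/-- The noise given `(X₁, A₁, X₂, U)` and `Y₁`, which does not depend on `Y₁`. -/
def noiseKernel : Kernel ((((𝒳₁ × 𝒜₁) × 𝒳₂) × 𝒰) × ℝ) ℝ :=
  M.noise.comap (fun p => (p.1.2, p.1.1.1.1, p.1.1.2)) (by fun_prop)

instance : IsMarkovKernel M.noiseKernel := by unfold noiseKernel; infer_instance

/-- A₂ is integrated out. In what remains, Y₁ is drawn without regard to U, and ε without regard to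
Y₁; this is the conditional independence behind the instrument. -/
theorem map_pathLaw :
    (M.pathLaw M.ctx M.behav₁ M.behav₂).map
        (fun p => (((p.hist.1, p.1.1.1.1.1.2), p.y₁), p.eps))
      = ((M.firstLaw ⊗ₘ M.stateConf.condKernel) ⊗ₘ M.rewardKernel) ⊗ₘ M.noiseKernel := by
  refine Measure.ext_of_lintegral _ fun F hF => ?_
  have hFm : Measurable fun p : DTRPath 𝒳₁ 𝒜₁ 𝒳₂ 𝒜₂ 𝒰 =>
      F (((p.hist.1, p.1.1.1.1.1.2), p.y₁), p.eps) := by fun_prop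
  have hG : Measurable fun p : ((𝒳₁ × 𝒜₁) × 𝒳₂) × 𝒰 =>
      ∫⁻ y, ∫⁻ e, F ((p, y), e) ∂(M.noiseKernel (p, y)) ∂(M.rewardKernel p) := by fun_prop
  rw [lintegral_map hF (by fun_prop), Measure.lintegral_compProd hF,
    Measure.lintegral_compProd (by fun_prop), firstLaw, ← map_stateLaw,
    lintegral_map hG (by fun_prop)]
  unfold pathLaw
  rw [Measure.lintegral_compProd hFm, Measure.lintegral_compProd (by fun_prop),
    Measure.lintegral_compProd (by fun_prop)]
  refine lintegral_congr fun p => ?_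
  simp only [Kernel.comap_apply, DTRPath.hist, DTRPath.eps, DTRPath.y₁, noiseKernel, rewardKernel,
    lintegral_const, measure_univ, mul_one]

/-- The mean of the noise given `(U, X₁, X₂)`. -/
def noiseMean (p : ((𝒳₁ × 𝒜₁) × 𝒳₂) × 𝒰) : ℝ := ∫ e, e ∂(M.noise (p.2, p.1.1.1, p.1.2))

/-- The mean of the noise given `(X₁, A₁, X₂)`. -/
def confMean (h : (𝒳₁ × 𝒜₁) × 𝒳₂) : ℝ := ∫ u, M.noiseMean (h, u) ∂(M.stateConf.condKernel h)

omit [StandardBorelSpace 𝒳₂] [StandardBorelSpace 𝒰] [Nonempty 𝒰] in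
theorem measurable_noiseMean : Measurable M.noiseMean := by
  have h : StronglyMeasurable fun p : ((𝒳₁ × 𝒜₁) × 𝒳₂) × 𝒰 =>
      ∫ e, e ∂((M.noise.comap (fun p : ((𝒳₁ × 𝒜₁) × 𝒳₂) × 𝒰 => (p.2, p.1.1.1, p.1.2))
        (by fun_prop)) p) :=
    StronglyMeasurable.integral_kernel_prod_right (f := fun _ e => e)
      (measurable_snd.stronglyMeasurable)
  exact h.measurable

theorem measurable_confMean : Measurable M.confMean := by
  have h : StronglyMeasurable fun h : (𝒳₁ × 𝒜₁) × 𝒳₂ =>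
      ∫ u, M.noiseMean (h, u) ∂(M.stateConf.condKernel h) :=
    StronglyMeasurable.integral_kernel_prod_right (f := fun h u => M.noiseMean (h, u))
      M.measurable_noiseMean.stronglyMeasurable
  exact h.measurable

theorem map_obsLaw_first :
    M.obsLaw.map (fun ω => ω.1.hist.1) = M.firstLaw := by
  have h : M.obsLaw.map (fun ω => ω.1.hist.1)
      = ((((M.obsLaw.map Prod.fst).map
        (fun p => (((p.hist.1, p.1.1.1.1.1.2), p.y₁), p.eps))).fst).fst).fst := by
    unfold Measure.fst
    rw [Measure.map_map (by fun_prop) (by fun_prop), Measure.map_map (by fun_prop) (by fun_prop),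
      Measure.map_map (by fun_prop) (by fun_prop), Measure.map_map (by fun_prop) (by fun_prop)]
    rfl
  rw [h, map_fst_obsLaw, map_pathLaw, Measure.fst_compProd, Measure.fst_compProd,
    Measure.fst_compProd]

section Integrable

variable (hε : Integrable (fun ω => ω.1.eps) M.obsLaw)
include hε

theorem integrable_eps_compProd : Integrable Prod.snd
    (((M.firstLaw ⊗ₘ M.stateConf.condKernel) ⊗ₘ M.rewardKernel) ⊗ₘ M.noiseKernel) := by
  rw [← map_pathLaw, integrable_map_measure measurable_snd.aestronglyMeasurable
    (Measurable.aemeasurable (by fun_prop)), ← map_fst_obsLaw,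
    integrable_map_measure (Measurable.aestronglyMeasurable (by fun_prop))
      measurable_fst.aemeasurable]
  exact hε

theorem integrable_noiseMean : Integrable M.noiseMean (M.firstLaw ⊗ₘ M.stateConf.condKernel) := by
  have h := integrable_integral_compProd
    (integrable_integral_compProd (M.integrable_eps_compProd hε))
  refine h.congr (.of_forall fun p => ?_)
  simp [noiseKernel, noiseMean]

theorem integrable_confMean : Integrable M.confMean M.firstLaw :=
  integrable_integral_compProd (M.integrable_noiseMean hε)

/-- Separating `f` from the noise requires integrable noise for almost every U, and an integrable
noise mean. Fubini provides these only for almost every history, hence the almost everywhere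
statement. -/
theorem cate_ae_eq : ∀ᵐ ω ∂M.obsLaw, M.cate ω.1.hist = M.f ω.1.hist + M.confMean ω.1.hist.1 := by
  have h1 := M.integrable_eps_compProd hε
  have h2 := M.integrable_noiseMean hε
  have h3 : ∀ᵐ h ∂M.firstLaw, (∀ᵐ u ∂(M.stateConf.condKernel h),
      Integrable (fun e => e) (M.noise (u, h.1.1, h.2))) ∧
      Integrable (fun u => M.noiseMean (h, u)) (M.stateConf.condKernel h) := by
    have a1 := ((Measure.integrable_compProd_iff h1.aestronglyMeasurable).1 h1).1
    have a2 := Measure.ae_ae_of_ae_compProd (Measure.ae_ae_of_ae_compProd a1)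
    have a3 := ((Measure.integrable_compProd_iff h2.aestronglyMeasurable).1 h2).1
    filter_upwards [a2, a3] with h b2 b3
    refine ⟨?_, b3⟩
    filter_upwards [b2] with u hu
    obtain ⟨y, hy⟩ := hu.exists
    simpa [noiseKernel] using hy
  rw [← M.map_obsLaw_first] at h3
  filter_upwards [ae_of_ae_map (Measurable.aemeasurable (by fun_prop)) h3] with ω hω
  unfold cate confMean
  have h4 : ∀ᵐ u ∂(M.stateConf.condKernel ω.1.hist.1),
      ∫ e, (M.f ω.1.hist + e) ∂(M.noise (u, ω.1.hist.1.1.1, ω.1.hist.1.2))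
        = M.f ω.1.hist + M.noiseMean (ω.1.hist.1, u) := by
    filter_upwards [hω.1] with u hu
    rw [integral_add (integrable_const _) hu]
    simp [noiseMean]
  rw [integral_congr_ae h4, integral_add (integrable_const _) hω.2]
  simp

/-- Given (X₁, A₁, X₂), the reward Y₁ is independent of (U, ε). On an event about Y₁ the noise may
therefore be replaced by its mean given (X₁, A₁, X₂). -/
theorem condExp_eps_sub_confMean :
    M.obsLaw[fun ω => ω.1.eps - M.confMean ω.1.hist.1 | sigmaIV] =ᵐ[M.obsLaw] 0 := by
  have hcm : Integrable (fun ω => M.confMean ω.1.hist.1) M.obsLaw := by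
    have h := M.integrable_confMean hε
    rwa [← M.map_obsLaw_first, integrable_map_measure M.measurable_confMean.aestronglyMeasurable
      (Measurable.aemeasurable (by fun_prop))] at h
  have hm := M.measurable_confMean
  refine condExp_comap_eq_zero (by fun_prop) (hε.sub' hcm) fun B hB => ?_
  have hBm : MeasurableSet ((fun ω : DTRTrial 𝒳₁ 𝒜₁ 𝒳₂ 𝒜₂ 𝒰 => ω.1.y₁) ⁻¹' B) :=
    hB.preimage (by fun_prop)
  rw [integral_sub hε.integrableOn hcm.integrableOn, sub_eq_zero]
  -- both sides in terms of the law of `(X₁, A₁, X₂, U, Y₁, ε)`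
  have key : ∀ G : (((((𝒳₁ × 𝒜₁) × 𝒳₂) × 𝒰) × ℝ) × ℝ) → ℝ, Measurable G →
      ∫ ω in (fun ω : DTRTrial 𝒳₁ 𝒜₁ 𝒳₂ 𝒜₂ 𝒰 => ω.1.y₁) ⁻¹' B,
        G (((ω.1.hist.1, ω.1.1.1.1.1.1.2), ω.1.y₁), ω.1.eps) ∂M.obsLaw
      = ∫ p, ((fun p => p.1.2) ⁻¹' B).indicator G p
        ∂(((M.firstLaw ⊗ₘ M.stateConf.condKernel) ⊗ₘ M.rewardKernel) ⊗ₘ M.noiseKernel) := by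
    intro G hG
    have hGB : Measurable (((fun p : (((((𝒳₁ × 𝒜₁) × 𝒳₂) × 𝒰) × ℝ) × ℝ) => p.1.2) ⁻¹' B).indicator
      G) := hG.indicator (hB.preimage (by fun_prop))
    have hGB2 : Measurable fun x : DTRPath 𝒳₁ 𝒜₁ 𝒳₂ 𝒜₂ 𝒰 =>
        ((fun p : (((((𝒳₁ × 𝒜₁) × 𝒳₂) × 𝒰) × ℝ) × ℝ) => p.1.2) ⁻¹' B).indicator G
          (((x.hist.1, x.1.1.1.1.1.2), x.y₁), x.eps) :=
      hGB.comp (g := ((fun p : (((((𝒳₁ × 𝒜₁) × 𝒳₂) × 𝒰) × ℝ) × ℝ) => p.1.2) ⁻¹' B).indicator G)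
        (by fun_prop)
    rw [← map_pathLaw, integral_map (Measurable.aemeasurable (by fun_prop))
      hGB.aestronglyMeasurable, ← map_fst_obsLaw, integral_map measurable_fst.aemeasurable
      hGB2.aestronglyMeasurable, ← integral_indicator hBm]
    rfl
  have hBm' : MeasurableSet ((fun p : (((((𝒳₁ × 𝒜₁) × 𝒳₂) × 𝒰) × ℝ) × ℝ) => p.1.2) ⁻¹' B) :=
    hB.preimage (by fun_prop)
  have hI1 := (M.integrable_eps_compProd hε).indicator hBm'
  have hI2 : Integrable (fun p => M.confMean p.1.1.1)
      (((M.firstLaw ⊗ₘ M.stateConf.condKernel) ⊗ₘ M.rewardKernel) ⊗ₘ M.noiseKernel) := by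
    have h := M.integrable_confMean hε
    have e : M.firstLaw = (((M.firstLaw ⊗ₘ M.stateConf.condKernel) ⊗ₘ M.rewardKernel)
        ⊗ₘ M.noiseKernel).map (fun p => p.1.1.1) := by
      conv_lhs => rw [← Measure.fst_compProd M.firstLaw M.stateConf.condKernel,
        ← Measure.fst_compProd (M.firstLaw ⊗ₘ M.stateConf.condKernel) M.rewardKernel,
        ← Measure.fst_compProd ((M.firstLaw ⊗ₘ M.stateConf.condKernel) ⊗ₘ M.rewardKernel)
          M.noiseKernel]
      unfold Measure.fst
      rw [Measure.map_map (by fun_prop) (by fun_prop), Measure.map_map (by fun_prop) (by fun_prop)]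
      rfl
    rw [e] at h
    rwa [integrable_map_measure M.measurable_confMean.aestronglyMeasurable
      (Measurable.aemeasurable (by fun_prop))] at h
  have hI2' := hI2.indicator hBm'
  rw [key Prod.snd measurable_snd, key (fun p => M.confMean p.1.1.1) (by fun_prop)]
  rw [Measure.integral_compProd hI1, Measure.integral_compProd hI2',
    Measure.integral_compProd (integrable_integral_compProd hI1),
    Measure.integral_compProd (integrable_integral_compProd hI2'),
    Measure.integral_compProd (integrable_integral_compProd (integrable_integral_compProd hI1)),
    Measure.integral_compProd (integrable_integral_compProd (integrable_integral_compProd hI2'))]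
  refine integral_congr_ae (.of_forall fun h => ?_)
  have e1 : ∀ u y, ∫ e, ((fun p : (((((𝒳₁ × 𝒜₁) × 𝒳₂) × 𝒰) × ℝ) × ℝ) => p.1.2) ⁻¹' B).indicator
      Prod.snd (((h, u), y), e) ∂(M.noiseKernel ((h, u), y))
      = B.indicator (fun _ => M.noiseMean (h, u)) y := by
    intro u y
    by_cases hy : y ∈ B <;> simp [Set.indicator, hy, noiseKernel, noiseMean]
  have e2 : ∀ u y, ∫ e, ((fun p : (((((𝒳₁ × 𝒜₁) × 𝒳₂) × 𝒰) × ℝ) × ℝ) => p.1.2) ⁻¹' B).indicator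
      (fun p => M.confMean p.1.1.1) (((h, u), y), e) ∂(M.noiseKernel ((h, u), y))
      = B.indicator (fun _ => M.confMean h) y := by
    intro u y
    by_cases hy : y ∈ B <;> simp [Set.indicator, hy]
  simp only [e1, e2, integral_indicator_const _ hB, smul_eq_mul]
  simp only [rewardKernel, Kernel.comap_apply, integral_const_mul]
  rw [← confMean]
  simp

end Integrable

theorem value_eq (π : DTRPolicy 𝒳₁ 𝒜₁ 𝒳₂ 𝒜₂) (hπ : Integrable M.y₂ (M.intLaw π)) :
    M.value π = ∫ s, M.cate s ∂(M.visitLaw π) := by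
  have hm : Measurable fun p : (DTRHist 𝒳₁ 𝒜₁ 𝒳₂ 𝒜₂ × 𝒰) × ℝ => M.f p.1.1 + p.2 :=
    (M.measurable_f.comp (by fun_prop)).add measurable_snd
  have hmap : Measurable fun p : DTRPath 𝒳₁ 𝒜₁ 𝒳₂ 𝒜₂ 𝒰 => ((p.hist, p.1.1.1.1.1.2), p.eps) := by
    fun_prop
  have h1 : M.value π = ∫ p, (M.f p.1.1 + p.2) ∂((M.intLaw π).map
      (fun p => ((p.hist, p.1.1.1.1.1.2), p.eps))) := by
    rw [integral_map hmap.aemeasurable hm.aestronglyMeasurable]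
    rfl
  have h2 : Integrable (fun p : (DTRHist 𝒳₁ 𝒜₁ 𝒳₂ 𝒜₂ × 𝒰) × ℝ => M.f p.1.1 + p.2)
      ((M.intLaw π).map (fun p => ((p.hist, p.1.1.1.1.1.2), p.eps))) := by
    rw [integrable_map_measure hm.aestronglyMeasurable hmap.aemeasurable]
    exact hπ
  rw [map_intLaw] at h1 h2
  rw [h1, Measure.integral_compProd h2,
    Measure.integral_compProd (integrable_integral_compProd h2)]
  rfl

/-! ### Identification of the CATE by the bridge functions -/

/-- The difference g - f - confMean telescopes into (g - h₁) + (h₁ - Y₂) + (ε - confMean). Each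
summand has conditional mean zero given Y₁: the first by missingness at random and the tower
property, the second by the bridge equation, the third by the instrument. The sum is a function of
(X, A), so completeness of Y₁ makes it vanish. -/
theorem bridge_ae_eq_cate (hac : M.obsLaw.map (fun ω => (ω.1.hist, ω.1.y₁)) ≪
      M.completeLaw.map (fun ω => (ω.1.hist, ω.1.y₁)))
    (hε : Integrable (fun ω => ω.1.eps) M.obsLaw) (hc : M.IVComplete)
    {h₁ : (𝒜₁ × 𝒜₂) × (ℝ × ℝ) → ℝ} {g : DTRHist 𝒳₁ 𝒜₁ 𝒳₂ 𝒜₂ → ℝ} (hg : Measurable g)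
    (hgi : Integrable (fun ω => g ω.1.hist) M.obsLaw)
    (hhi : Integrable (fun ω => h₁ (M.ay ω)) M.obsLaw)
    (hy : Integrable (fun ω => M.y₂ ω.1) M.obsLaw) (hs : M.SolvesIES h₁ g) :
    g =ᵐ[M.histLaw] M.cate := by
  have hIV : (sigmaIV : MeasurableSpace (DTRTrial 𝒳₁ 𝒜₁ 𝒳₂ 𝒜₂ 𝒰)) ≤ sigmaHistIV := by
    rintro _ ⟨B, hB, rfl⟩
    exact ⟨Prod.snd ⁻¹' B, measurable_snd hB, rfl⟩
  have h1 : M.obsLaw[fun ω => g ω.1.hist - h₁ (M.ay ω) | sigmaHistIV] =ᵐ[M.obsLaw] 0 :=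
    M.condExp_eq_zero_of_completeLaw hac (F := fun p =>
      g p.hist - h₁ ((p.hist.1.1.2, p.hist.2), (p.y₁, M.y₂ p))) (hgi.sub' hhi) hs.2
  have h2 : M.obsLaw[fun ω => g ω.1.hist - h₁ (M.ay ω) | sigmaIV] =ᵐ[M.obsLaw] 0 := by
    refine (condExp_condExp_of_le hIV (measurable_histIV.comap_le)).symm.trans ?_
    refine (condExp_congr_ae h1).trans ?_
    simp
  have h3 := M.condExp_eps_sub_confMean hε
  have hcm : Integrable (fun ω => M.confMean ω.1.hist.1) M.obsLaw := by
    have h := M.integrable_confMean hε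
    rwa [← M.map_obsLaw_first, integrable_map_measure M.measurable_confMean.aestronglyMeasurable
      (Measurable.aemeasurable (by fun_prop))] at h
  have hm := M.measurable_confMean
  have hf := M.measurable_f
  have hfi : Integrable (fun ω => M.f ω.1.hist) M.obsLaw := by
    refine (hy.sub' hε).congr (.of_forall fun ω => ?_)
    simp [y₂]
  have h4 : M.obsLaw[fun ω => g ω.1.hist - M.f ω.1.hist - M.confMean ω.1.hist.1 | sigmaIV]
      =ᵐ[M.obsLaw] 0 := by
    have e : (fun ω : DTRTrial 𝒳₁ 𝒜₁ 𝒳₂ 𝒜₂ 𝒰 =>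
        g ω.1.hist - M.f ω.1.hist - M.confMean ω.1.hist.1)
        = (fun ω => g ω.1.hist - h₁ (M.ay ω)) + (fun ω => h₁ (M.ay ω) - M.y₂ ω.1)
          + fun ω => ω.1.eps - M.confMean ω.1.hist.1 := by
      ext ω
      simp only [Pi.add_apply, y₂]
      ring
    rw [e]
    have i1 := hgi.sub' hhi
    have i2 := hhi.sub' hy
    have i3 := hε.sub' hcm
    filter_upwards [condExp_add (i1.add i2) i3 sigmaIV, condExp_add i1 i2 sigmaIV, h2, h3, hs.1]
      with ω w1 w2 w3 w4 w5
    rw [w1, Pi.add_apply, w2, Pi.add_apply, w3, w4, w5]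
    simp
  have h5 := (hc (fun s => g s - M.f s - M.confMean s.1) (by fun_prop) ((hgi.sub' hfi).sub' hcm)).1 h4
  have h6 : ∀ᵐ ω ∂M.obsLaw, g ω.1.hist = M.cate ω.1.hist := by
    filter_upwards [h5, M.cate_ae_eq hε] with ω w1 w2
    rw [w2]
    have : g ω.1.hist - M.f ω.1.hist - M.confMean ω.1.hist.1 = 0 := w1
    linarith
  have hcate : Measurable M.cate := by
    have a1 : StronglyMeasurable fun p : DTRHist 𝒳₁ 𝒜₁ 𝒳₂ 𝒜₂ × 𝒰 =>
        ∫ e, (M.f p.1 + e) ∂((M.noise.comap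
          (fun p : DTRHist 𝒳₁ 𝒜₁ 𝒳₂ 𝒜₂ × 𝒰 => (p.2, p.1.1.1.1, p.1.1.2)) (by fun_prop)) p) :=
      StronglyMeasurable.integral_kernel_prod_right (f := fun (p : DTRHist 𝒳₁ 𝒜₁ 𝒳₂ 𝒜₂ × 𝒰) (e : ℝ) => M.f p.1 + e)
        (Measurable.stronglyMeasurable (by fun_prop))
    have a2 : StronglyMeasurable fun s : DTRHist 𝒳₁ 𝒜₁ 𝒳₂ 𝒜₂ =>
        ∫ u, (∫ e, (M.f s + e) ∂(M.noise (u, s.1.1.1, s.1.2)))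
          ∂((M.stateConf.condKernel.comap (fun s : DTRHist 𝒳₁ 𝒜₁ 𝒳₂ 𝒜₂ => s.1) (by fun_prop)) s) :=
      StronglyMeasurable.integral_kernel_prod_right
        (f := fun s u => ∫ e, (M.f s + e) ∂(M.noise (u, s.1.1.1, s.1.2))) a1
    exact a2.measurable
  rw [histLaw]
  exact (ae_map_iff (Measurable.aemeasurable (by fun_prop)) (measurableSet_eq_fun hg hcate)).2 h6

/-- Splitting the visitation law by Lebesgue decomposition, the bridge equations settle the
absolutely continuous part and the hypothesis on `g` the singular part. -/
theorem value_eq_modelValue {g : DTRHist 𝒳₁ 𝒜₁ 𝒳₂ 𝒜₂ → ℝ} (hg : g =ᵐ[M.histLaw] M.cate)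
    {π : DTRPolicy 𝒳₁ 𝒜₁ 𝒳₂ 𝒜₂} (hs : g =ᵐ[(M.visitLaw π).singularPart M.histLaw] M.cate)
    (hπ : Integrable M.y₂ (M.intLaw π)) : M.value π = M.modelValue g π := by
  have : IsFiniteMeasure M.histLaw := by unfold histLaw; infer_instance
  have h : g =ᵐ[M.visitLaw π] M.cate := by
    rw [Measure.haveLebesgueDecomposition_add (M.visitLaw π) M.histLaw]
    exact ae_add_measure_iff.2 ⟨hs, (withDensity_absolutelyContinuous _ _).ae_le hg⟩
  rw [M.value_eq π hπ, modelValue, integral_congr_ae h]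

end TwoStageDTR

/-! ### Conditional moments of linear functions -/

theorem norm_toEuclideanLin_le {m d : ℕ} (W : Matrix (Fin m) (Fin d) ℝ)
    (x : EuclideanSpace ℝ (Fin d)) : ‖W.toEuclideanLin x‖ ≤ frobNorm W * ‖x‖ := by
  rw [EuclideanSpace.norm_eq, EuclideanSpace.norm_eq, frobNorm, ← Real.sqrt_mul (by positivity)]
  refine Real.sqrt_le_sqrt ?_
  rw [Finset.sum_mul]
  refine Finset.sum_le_sum fun i _ => ?_
  simp only [Real.norm_eq_abs, sq_abs]
  have h := Finset.sum_mul_sq_le_sq_mul_sq Finset.univ (W i) (fun j => x j)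
  exact h

theorem norm_adjoint_toEuclideanLin_le {m d : ℕ} (W : Matrix (Fin m) (Fin d) ℝ)
    (w : EuclideanSpace ℝ (Fin m)) :
    ‖LinearMap.adjoint W.toEuclideanLin w‖ ≤ frobNorm W * ‖w‖ := by
  set v := LinearMap.adjoint W.toEuclideanLin w with hv
  have h1 : ‖v‖ ^ 2 ≤ ‖w‖ * (frobNorm W * ‖v‖) := by
    rw [← real_inner_self_eq_norm_sq]
    nth_rewrite 1 [hv]
    rw [LinearMap.adjoint_inner_left]
    exact (real_inner_le_norm _ _).trans
      (mul_le_mul_of_nonneg_left (norm_toEuclideanLin_le W v) (norm_nonneg _))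
  have hF : 0 ≤ frobNorm W := Real.sqrt_nonneg _
  rcases (norm_nonneg v).eq_or_lt with h0 | h0
  · rw [← h0]; positivity
  · refine le_of_mul_le_mul_right ?_ h0
    linarith [h1, sq ‖v‖]

section CondExp

variable {Ω β : Type*} [MeasurableSpace Ω] [MeasurableSpace β] {μ : Measure Ω} [IsFiniteMeasure μ]

omit [IsFiniteMeasure μ] in
theorem condExp_inner_left {m : MeasurableSpace Ω} {E : Type*} [NormedAddCommGroup E]
    [InnerProductSpace ℝ E] [CompleteSpace E] {φ : Ω → E} (hφ : Integrable φ μ) (w : E) :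
    μ[fun ω => inner ℝ w (φ ω) | m] =ᵐ[μ] fun ω => inner ℝ w (μ[φ | m] ω) :=
  (ContinuousLinearMap.comp_condExp_comm hφ (innerSL ℝ w)).symm

theorem integral_mul_of_condExp_comap {V : Ω → β} (hV : Measurable V) {Z T : Ω → ℝ}
    (hZ : Integrable Z μ) (hT : μ[Z | MeasurableSpace.comap V inferInstance] =ᵐ[μ] T) {q : β → ℝ}
    (hq : Measurable q) (hZq : Integrable (fun ω => Z ω * q (V ω)) μ) :
    ∫ ω, Z ω * q (V ω) ∂μ = ∫ ω, T ω * q (V ω) ∂μ := by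
  have hsm : StronglyMeasurable[MeasurableSpace.comap V inferInstance] fun ω => q (V ω) :=
    (hq.comp (comap_measurable V)).stronglyMeasurable
  rw [← integral_condExp hV.comap_le]
  refine integral_congr_ae ((condExp_mul_of_stronglyMeasurable_right hsm hZq hZ).trans ?_)
  filter_upwards [hT] with ω h
  simp [h]

omit [IsFiniteMeasure μ] in
theorem ofReal_abs_integral_mul_le {f g : Ω → ℝ} (hf : AEStronglyMeasurable f μ)
    (hg : AEStronglyMeasurable g μ) :
    ENNReal.ofReal |∫ ω, f ω * g ω ∂μ| ≤ eLpNorm f 2 μ * eLpNorm g 2 μ := by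
  rw [← Real.enorm_eq_ofReal_abs]
  refine (enorm_integral_le_lintegral_enorm _).trans ?_
  rw [← eLpNorm_one_eq_lintegral_enorm]
  have h := eLpNorm_smul_le_mul_eLpNorm (p := 2) (q := 2) (r := 1) hg hf
  exact h

end CondExp

namespace DTRFeatures

variable {𝒳₁ 𝒜₁ 𝒳₂ 𝒜₂ 𝒰 : Type*} [MeasurableSpace 𝒳₁] [MeasurableSpace 𝒜₁]
  [MeasurableSpace 𝒳₂] [MeasurableSpace 𝒜₂] [MeasurableSpace 𝒰]
  {m₁ m₂ d₁ d₂ : ℕ} (L : DTRFeatures 𝒳₁ 𝒜₁ 𝒳₂ 𝒜₂ m₁ m₂ d₁ d₂)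
  (M : TwoStageDTR 𝒳₁ 𝒜₁ 𝒳₂ 𝒜₂ 𝒰)

/-- The linear function `w ⬝ φ₂` of `(X, A)`. -/
def linG (w : EuclideanSpace ℝ (Fin m₂)) (s : DTRHist 𝒳₁ 𝒜₁ 𝒳₂ 𝒜₂) : ℝ := inner ℝ w (L.φ₂ s)

/-- What the causal model implies for the linear classes: the weights `(w₁s, w₂s)` of the bridge
functions, and the coefficients `β₁`, `β₂` of the conditional moments of `α₁(h)` and `α₂(h)`. -/
structure IsBridge (Pol : Set (DTRPolicy 𝒳₁ 𝒜₁ 𝒳₂ 𝒜₂)) (πs : DTRPolicy 𝒳₁ 𝒜₁ 𝒳₂ 𝒜₂) (b₁ : ℝ → ℝ)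
    (w₁s : EuclideanSpace ℝ (Fin m₁)) (w₂s : EuclideanSpace ℝ (Fin m₂))
    (β₁ : EuclideanSpace ℝ (Fin m₁) → EuclideanSpace ℝ (Fin d₁))
    (β₂ : EuclideanSpace ℝ (Fin m₁) → EuclideanSpace ℝ (Fin m₂) → EuclideanSpace ℝ (Fin d₂)) :
    Prop where
  norm_fst : ‖w₁s‖ ≤ L.C₁
  norm_snd : ‖w₂s‖ ≤ L.C₂
  norm_coeff₁ : ∀ w₁, ‖w₁‖ ≤ L.C₁ → ‖β₁ w₁‖ ≤ L.D₁
  norm_coeff₂ : ∀ w₁ w₂, ‖w₁‖ ≤ L.C₁ → ‖w₂‖ ≤ L.C₂ → ‖β₂ w₁ w₂‖ ≤ L.D₂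
  coeff₁_self : β₁ w₁s = 0
  coeff₂_self : β₂ w₁s w₂s = 0
  moment₁ : ∀ w₁ β, ∫ ω, (inner ℝ w₁ (L.φ₁ (M.ay ω)) - M.y₂ ω.1) * inner ℝ β (L.ψ₁ ω.1.y₁) ∂M.obsLaw
    = ∫ ω, inner ℝ (β₁ w₁) (L.ψ₁ ω.1.y₁) * inner ℝ β (L.ψ₁ ω.1.y₁) ∂M.obsLaw
  moment₂ : ∀ w₁ w₂ β, ∫ ω, (inner ℝ w₂ (L.φ₂ ω.1.hist) - inner ℝ w₁ (L.φ₁ (M.ay ω))) *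
      inner ℝ β (L.ψ₂ (ω.1.hist, ω.1.y₁)) ∂M.completeLaw
    = ∫ ω, inner ℝ (β₂ w₁ w₂) (L.ψ₂ (ω.1.hist, ω.1.y₁)) * inner ℝ β (L.ψ₂ (ω.1.hist, ω.1.y₁))
      ∂M.completeLaw
  value : ∀ π ∈ Pol, M.value π = M.modelValue (L.linG w₂s) π
  shift : M.shiftNorm b₁ ≠ ⊤ → ∀ w₁ w₂,
    ENNReal.ofReal (M.modelValue (L.linG w₂s) πs - M.modelValue (L.linG w₂) πs) ≤
      eLpNorm (fun ω => (inner ℝ (β₁ w₁) (L.ψ₁ ω.1.y₁) : ℝ)) 2 M.obsLaw *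
        eLpNorm (fun ω => b₁ ω.1.y₁) 2 M.obsLaw +
      eLpNorm (fun ω => (inner ℝ (β₂ w₁ w₂) (L.ψ₂ (ω.1.hist, ω.1.y₁)) : ℝ)) 2 M.completeLaw *
        eLpNorm (fun ω => M.shift₂ b₁ (ω.1.hist, ω.1.y₁)) 2 M.completeLaw

variable {L M}

/-- As E[b₁(Y₁) | X, A] is the density of the visitation law, the left integral is E[b₁ · ⟨v₂, φ₂⟩]
under the observational law. Write ⟨v₂, φ₂⟩ as ⟨v₁, φ₁⟩ plus ⟨t₂, ψ₂⟩ plus a residual. The residual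
has conditional mean zero given (X, A, Y₁), hence is orthogonal to b₁; ⟨v₁, φ₁⟩ may be replaced by
⟨t₁, ψ₁⟩ given Y₁; and the ψ₂ term passes to the complete law, turning b₁ into b₂. Cauchy-Schwarz
finishes. -/
theorem shift_bound (hL : L.Regular) {πs : DTRPolicy 𝒳₁ 𝒜₁ 𝒳₂ 𝒜₂} {b₁ : ℝ → ℝ}
    (hb : Measurable b₁) (hs : M.IsShift πs b₁)
    (hac : M.obsLaw.map (fun ω => (ω.1.hist, ω.1.y₁)) ≪
      M.completeLaw.map (fun ω => (ω.1.hist, ω.1.y₁)))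
    (hB : M.shiftNorm b₁ ≠ ⊤) {v₁ : EuclideanSpace ℝ (Fin m₁)} {v₂ : EuclideanSpace ℝ (Fin m₂)}
    {t₁ : EuclideanSpace ℝ (Fin d₁)} {t₂ : EuclideanSpace ℝ (Fin d₂)}
    (h₁ : M.obsLaw[fun ω => inner ℝ v₁ (L.φ₁ (M.ay ω)) | TwoStageDTR.sigmaIV] =ᵐ[M.obsLaw]
      fun ω => inner ℝ t₁ (L.ψ₁ ω.1.y₁))
    (h₂ : M.completeLaw[fun ω => inner ℝ v₂ (L.φ₂ ω.1.hist) - inner ℝ v₁ (L.φ₁ (M.ay ω)) |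
        TwoStageDTR.sigmaHistIV] =ᵐ[M.completeLaw]
      fun ω => inner ℝ t₂ (L.ψ₂ (ω.1.hist, ω.1.y₁))) :
    ENNReal.ofReal |∫ s, inner ℝ v₂ (L.φ₂ s) ∂(M.visitLaw πs)| ≤
      eLpNorm (fun ω => (inner ℝ t₁ (L.ψ₁ ω.1.y₁) : ℝ)) 2 M.obsLaw *
        eLpNorm (fun ω => b₁ ω.1.y₁) 2 M.obsLaw +
      eLpNorm (fun ω => (inner ℝ t₂ (L.ψ₂ (ω.1.hist, ω.1.y₁)) : ℝ)) 2 M.completeLaw *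
        eLpNorm (fun ω => M.shift₂ b₁ (ω.1.hist, ω.1.y₁)) 2 M.completeLaw := by
  have := M.isProbabilityMeasure_completeLaw hac
  have mφ₁ := hL.measurable_φ₁
  have mφ₂ := hL.measurable_φ₂
  have mψ₁ := hL.measurable_ψ₁
  have mψ₂ := hL.measurable_ψ₂
  have mV := TwoStageDTR.measurable_histIV (𝒳₁ := 𝒳₁) (𝒜₁ := 𝒜₁) (𝒳₂ := 𝒳₂) (𝒜₂ := 𝒜₂) (𝒰 := 𝒰)
  have hb1 : MemLp (fun ω => b₁ ω.1.y₁) 2 M.obsLaw :=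
    ⟨Measurable.aestronglyMeasurable (by fun_prop), by
      unfold TwoStageDTR.shiftNorm at hB
      exact lt_top_iff_ne_top.2 (ENNReal.add_ne_top.1 hB).1⟩
  have hbi : Integrable (fun ω => b₁ ω.1.y₁) M.obsLaw := hb1.integrable (by norm_num)
  -- a bounded function times `b₁` is integrable
  have hbd : ∀ {q : DTRTrial 𝒳₁ 𝒜₁ 𝒳₂ 𝒜₂ 𝒰 → ℝ} {c : ℝ}, Measurable q → (∀ ω, |q ω| ≤ c) →
      Integrable (fun ω => q ω * b₁ ω.1.y₁) M.obsLaw := fun hq hc =>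
    hbi.bdd_mul hq.aestronglyMeasurable (.of_forall fun ω => hc ω)
  have c1 : ∀ ω, |(inner ℝ v₁ (L.φ₁ (M.ay ω)) : ℝ)| ≤ ‖v₁‖ := fun ω =>
    (abs_real_inner_le_norm _ _).trans (by nlinarith [norm_nonneg v₁, hL.norm_φ₁ (M.ay ω)])
  have c2 : ∀ s, |(inner ℝ v₂ (L.φ₂ s) : ℝ)| ≤ ‖v₂‖ := fun s =>
    (abs_real_inner_le_norm _ _).trans (by nlinarith [norm_nonneg v₂, hL.norm_φ₂ s])
  have c3 : ∀ s, |(inner ℝ t₂ (L.ψ₂ s) : ℝ)| ≤ ‖t₂‖ := fun s =>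
    (abs_real_inner_le_norm _ _).trans (by nlinarith [norm_nonneg t₂, hL.norm_ψ₂ s])
  have m1 : Measurable fun ω : DTRTrial 𝒳₁ 𝒜₁ 𝒳₂ 𝒜₂ 𝒰 => (inner ℝ v₁ (L.φ₁ (M.ay ω)) : ℝ) := by
    fun_prop
  have m2 : Measurable fun s => (inner ℝ v₂ (L.φ₂ s) : ℝ) := by fun_prop
  have m3 : Measurable fun s => (inner ℝ t₂ (L.ψ₂ s) : ℝ) := by fun_prop
  have m2' : Measurable fun ω : DTRTrial 𝒳₁ 𝒜₁ 𝒳₂ 𝒜₂ 𝒰 => (inner ℝ v₂ (L.φ₂ ω.1.hist) : ℝ) :=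
    m2.comp (by fun_prop)
  have m3' : Measurable fun ω : DTRTrial 𝒳₁ 𝒜₁ 𝒳₂ 𝒜₂ 𝒰 =>
    (inner ℝ t₂ (L.ψ₂ (ω.1.hist, ω.1.y₁)) : ℝ) := m3.comp mV
  have hi : ∀ {q : DTRTrial 𝒳₁ 𝒜₁ 𝒳₂ 𝒜₂ 𝒰 → ℝ} {c : ℝ}, Measurable q → (∀ ω, |q ω| ≤ c) →
      Integrable q M.obsLaw := fun hq hc =>
    Integrable.of_bound hq.aestronglyMeasurable _ (.of_forall hc)
  have i1 := hbd m1 c1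
  have i2 := hbd m2' (fun ω => c2 ω.1.hist)
  have i3 := hbd m3' (fun ω => c3 _)
  -- change of measure
  have e1 : ∫ s, inner ℝ v₂ (L.φ₂ s) ∂(M.visitLaw πs)
      = ∫ ω, inner ℝ v₂ (L.φ₂ ω.1.hist) * b₁ ω.1.y₁ ∂M.obsLaw := by
    have : IsFiniteMeasure M.histLaw := by unfold TwoStageDTR.histLaw; infer_instance
    have hr : Measurable fun s => ((M.visitLaw πs).rnDeriv M.histLaw s).toReal *
        inner ℝ v₂ (L.φ₂ s) := ((Measure.measurable_rnDeriv _ _).ennreal_toReal).mul m2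
    rw [← integral_rnDeriv_smul hs.1]
    simp only [smul_eq_mul]
    have hmap : ∫ s, ((M.visitLaw πs).rnDeriv M.histLaw s).toReal * inner ℝ v₂ (L.φ₂ s) ∂M.histLaw
        = ∫ ω, ((M.visitLaw πs).rnDeriv M.histLaw ω.1.hist).toReal * inner ℝ v₂ (L.φ₂ ω.1.hist)
          ∂M.obsLaw :=
      integral_map (Measurable.aemeasurable (by fun_prop)) hr.aestronglyMeasurable
    rw [hmap]
    have hi2 : Integrable (fun ω => b₁ ω.1.y₁ * inner ℝ v₂ (L.φ₂ ω.1.hist)) M.obsLaw :=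
      i2.congr (.of_forall fun ω => mul_comm _ _)
    have := integral_mul_of_condExp_comap (μ := M.obsLaw) (V := fun ω => ω.1.hist) (by fun_prop)
      hbi hs.2 (q := fun s => inner ℝ v₂ (L.φ₂ s)) m2 hi2
    simp only [mul_comm (b₁ _)] at this
    exact this.symm
  -- the conditional moments
  have e2 : ∫ ω, inner ℝ v₁ (L.φ₁ (M.ay ω)) * b₁ ω.1.y₁ ∂M.obsLaw
      = ∫ ω, inner ℝ t₁ (L.ψ₁ ω.1.y₁) * b₁ ω.1.y₁ ∂M.obsLaw :=
    integral_mul_of_condExp_comap (V := fun ω => ω.1.y₁) (by fun_prop) (hi m1 c1) h₁ hb i1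
  have h₂' : M.obsLaw[fun ω => inner ℝ v₂ (L.φ₂ ω.1.hist) - inner ℝ v₁ (L.φ₁ (M.ay ω)) -
      inner ℝ t₂ (L.ψ₂ (ω.1.hist, ω.1.y₁)) | TwoStageDTR.sigmaHistIV] =ᵐ[M.obsLaw] 0 := by
    have hc : ∀ {q : DTRTrial 𝒳₁ 𝒜₁ 𝒳₂ 𝒜₂ 𝒰 → ℝ} {c : ℝ}, Measurable q → (∀ ω, |q ω| ≤ c) →
      Integrable q M.completeLaw := fun hq hc =>
        Integrable.of_bound hq.aestronglyMeasurable _ (.of_forall hc)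
    refine M.condExp_eq_zero_of_completeLaw hac (F := fun p => inner ℝ v₂ (L.φ₂ p.hist) -
      inner ℝ v₁ (L.φ₁ ((p.hist.1.1.2, p.hist.2), (p.y₁, M.y₂ p))) -
        inner ℝ t₂ (L.ψ₂ (p.hist, p.y₁)))
      (((hi m2' fun ω => c2 _).sub' (hi m1 c1)).sub' (hi m3' fun ω => c3 _)) ?_
    have hst : StronglyMeasurable[TwoStageDTR.sigmaHistIV]
        fun ω : DTRTrial 𝒳₁ 𝒜₁ 𝒳₂ 𝒜₂ 𝒰 => (inner ℝ t₂ (L.ψ₂ (ω.1.hist, ω.1.y₁)) : ℝ) :=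
      (m3.comp (comap_measurable
        fun ω : DTRTrial 𝒳₁ 𝒜₁ 𝒳₂ 𝒜₂ 𝒰 => (ω.1.hist, ω.1.y₁))).stronglyMeasurable
    refine (condExp_sub ((hc m2' fun ω => c2 _).sub' (hc m1 c1)) (hc m3' fun ω => c3 _) _).trans ?_
    rw [condExp_of_stronglyMeasurable mV.comap_le hst (hc m3' fun ω => c3 _)]
    filter_upwards [h₂] with ω hω
    rw [Pi.sub_apply, hω]
    simp
  have i4 : Integrable (fun ω => (inner ℝ v₂ (L.φ₂ ω.1.hist) - inner ℝ v₁ (L.φ₁ (M.ay ω)) -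
      inner ℝ t₂ (L.ψ₂ (ω.1.hist, ω.1.y₁))) * b₁ ω.1.y₁) M.obsLaw := by
    refine ((i2.sub' i1).sub' i3).congr (.of_forall fun ω => ?_)
    simp only [sub_mul]
  have e3 : ∫ ω, (inner ℝ v₂ (L.φ₂ ω.1.hist) - inner ℝ v₁ (L.φ₁ (M.ay ω)) -
      inner ℝ t₂ (L.ψ₂ (ω.1.hist, ω.1.y₁))) * b₁ ω.1.y₁ ∂M.obsLaw = 0 := by
    rw [integral_mul_of_condExp_comap (V := fun ω => (ω.1.hist, ω.1.y₁)) mV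
      (((hi m2' fun ω => c2 _).sub' (hi m1 c1)).sub' (hi m3' fun ω => c3 _)) h₂'
      (q := fun s => b₁ s.2) (by fun_prop) i4]
    simp
  have e4 : ∫ ω, inner ℝ t₂ (L.ψ₂ (ω.1.hist, ω.1.y₁)) * b₁ ω.1.y₁ ∂M.obsLaw
      = ∫ ω, inner ℝ t₂ (L.ψ₂ (ω.1.hist, ω.1.y₁)) * M.shift₂ b₁ (ω.1.hist, ω.1.y₁)
        ∂M.completeLaw := by
    have mq : Measurable fun s : DTRHist 𝒳₁ 𝒜₁ 𝒳₂ 𝒜₂ × ℝ => inner ℝ t₂ (L.ψ₂ s) * b₁ s.2 :=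
      m3.mul (by fun_prop)
    have mr : Measurable fun s => ((M.obsLaw.map (fun ω => (ω.1.hist, ω.1.y₁))).rnDeriv
        (M.completeLaw.map (fun ω => (ω.1.hist, ω.1.y₁))) s).toReal *
          (inner ℝ t₂ (L.ψ₂ s) * b₁ s.2) :=
      ((Measure.measurable_rnDeriv _ _).ennreal_toReal).mul mq
    rw [← integral_map (μ := M.obsLaw) (φ := fun ω => (ω.1.hist, ω.1.y₁)) mV.aemeasurable
      (f := fun s => inner ℝ t₂ (L.ψ₂ s) * b₁ s.2) mq.aestronglyMeasurable,
      ← integral_rnDeriv_smul hac]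
    simp only [smul_eq_mul]
    rw [integral_map mV.aemeasurable mr.aestronglyMeasurable]
    refine integral_congr_ae (.of_forall fun ω => ?_)
    simp only [TwoStageDTR.shift₂]
    ring
  have e5 : ∫ s, inner ℝ v₂ (L.φ₂ s) ∂(M.visitLaw πs)
      = ∫ ω, inner ℝ t₁ (L.ψ₁ ω.1.y₁) * b₁ ω.1.y₁ ∂M.obsLaw +
        ∫ ω, inner ℝ t₂ (L.ψ₂ (ω.1.hist, ω.1.y₁)) * M.shift₂ b₁ (ω.1.hist, ω.1.y₁)
          ∂M.completeLaw := by
    simp only [sub_mul] at e3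
    rw [integral_sub (i2.sub' i1) i3, integral_sub i2 i1] at e3
    rw [e1, ← e4, ← e2]
    linarith
  rw [e5]
  have mb2 : Measurable fun ω : DTRTrial 𝒳₁ 𝒜₁ 𝒳₂ 𝒜₂ 𝒰 => M.shift₂ b₁ (ω.1.hist, ω.1.y₁) := by
    have : Measurable (M.shift₂ b₁) := by
      unfold TwoStageDTR.shift₂
      exact (hb.comp measurable_snd).mul (Measure.measurable_rnDeriv _ _).ennreal_toReal
    exact this.comp mV
  refine (ENNReal.ofReal_le_ofReal (abs_add_le _ _)).trans ?_
  rw [ENNReal.ofReal_add (abs_nonneg _) (abs_nonneg _)]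
  exact add_le_add
    (ofReal_abs_integral_mul_le (Measurable.aestronglyMeasurable (by fun_prop))
      (Measurable.aestronglyMeasurable (by fun_prop)))
    (ofReal_abs_integral_mul_le m3'.aestronglyMeasurable mb2.aestronglyMeasurable)

end DTRFeatures

namespace DTRFeatures

variable {𝒳₁ 𝒜₁ 𝒳₂ 𝒜₂ 𝒰 : Type*} [MeasurableSpace 𝒳₁] [MeasurableSpace 𝒜₁]
  [MeasurableSpace 𝒳₂] [MeasurableSpace 𝒜₂] [MeasurableSpace 𝒰]
  {m₁ m₂ d₁ d₂ : ℕ} {L : DTRFeatures 𝒳₁ 𝒜₁ 𝒳₂ 𝒜₂ m₁ m₂ d₁ d₂}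
  {M : TwoStageDTR 𝒳₁ 𝒜₁ 𝒳₂ 𝒜₂ 𝒰}

omit [MeasurableSpace 𝒳₁] [MeasurableSpace 𝒜₁] [MeasurableSpace 𝒳₂] [MeasurableSpace 𝒜₂] in
theorem mem_hyp_of_norm_le {w₁ : EuclideanSpace ℝ (Fin m₁)} {w₂ : EuclideanSpace ℝ (Fin m₂)}
    (h₁ : ‖w₁‖ ≤ L.C₁) (h₂ : ‖w₂‖ ≤ L.C₂) :
    ((fun a => inner ℝ w₁ (L.φ₁ a)), L.linG w₂) ∈ L.hyp :=
  ⟨⟨w₁, h₁, rfl⟩, ⟨w₂, h₂, rfl⟩⟩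

theorem ae_abs_y₂_le {Lα : ℝ} (hbm : L.BoundsMoments M Lα) (hC₁ : 0 ≤ L.C₁) (hC₂ : 0 ≤ L.C₂) :
    ∀ᵐ ω ∂M.obsLaw, |M.y₂ ω.1| ≤ Lα := by
  have h := (hbm _ (L.mem_hyp_of_norm_le (w₁ := 0) (w₂ := 0) (by simpa) (by simpa))).1
  filter_upwards [h] with ω hω
  simpa using hω

theorem exists_isBridge [StandardBorelSpace 𝒳₂] [StandardBorelSpace 𝒰] [Nonempty 𝒰]
    {Pol : Set (DTRPolicy 𝒳₁ 𝒜₁ 𝒳₂ 𝒜₂)} {πs : DTRPolicy 𝒳₁ 𝒜₁ 𝒳₂ 𝒜₂} {b₁ : ℝ → ℝ} {Lα : ℝ}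
    (hL : L.Regular) (hbm : L.BoundsMoments M Lα)
    (hε : Integrable (fun ω => ω.1.eps) M.obsLaw)
    (hint : ∀ π ∈ Pol, Integrable M.y₂ (M.intLaw π))
    (hIV : M.IVComplete) (hbr : L.LinearBridge M Pol) (hlm : L.LinearMoments M)
    (hb : Measurable b₁) (hs : M.IsShift πs b₁)
    (hac : M.obsLaw.map (fun ω => (ω.1.hist, ω.1.y₁)) ≪
      M.completeLaw.map (fun ω => (ω.1.hist, ω.1.y₁))) :
    ∃ w₁s w₂s β₁ β₂, L.IsBridge M Pol πs b₁ w₁s w₂s β₁ β₂ := by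
  obtain ⟨⟨h₁s, gs⟩, ⟨⟨w₁s, hw₁s, rfl⟩, ⟨w₂s, hw₂s, rfl⟩⟩, hies, hsing⟩ := hbr
  obtain ⟨W₁, W₂, W₃, hW₁, hW₂, hW₃, hD₁, hD₂⟩ := hlm
  simp only at hies hsing hw₁s hw₂s
  have hC₁ : 0 ≤ L.C₁ := (norm_nonneg _).trans hw₁s
  have hC₂ : 0 ≤ L.C₂ := (norm_nonneg _).trans hw₂s
  have := M.isProbabilityMeasure_completeLaw hac
  have mφ₁ := hL.measurable_φ₁
  have mφ₂ := hL.measurable_φ₂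
  have mψ₁ := hL.measurable_ψ₁
  have mψ₂ := hL.measurable_ψ₂
  have mV := TwoStageDTR.measurable_histIV (𝒳₁ := 𝒳₁) (𝒜₁ := 𝒜₁) (𝒳₂ := 𝒳₂) (𝒜₂ := 𝒜₂) (𝒰 := 𝒰)
  have mf₁ : Measurable fun ω : DTRTrial 𝒳₁ 𝒜₁ 𝒳₂ 𝒜₂ 𝒰 => L.φ₁ (M.ay ω) := by fun_prop
  have mf₂ : Measurable fun ω : DTRTrial 𝒳₁ 𝒜₁ 𝒳₂ 𝒜₂ 𝒰 => L.φ₂ ω.1.hist :=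
    mφ₂.comp (by fun_prop)
  have iφ₁ : Integrable (fun ω => L.φ₁ (M.ay ω)) M.obsLaw :=
    Integrable.of_bound mf₁.aestronglyMeasurable 1 (.of_forall fun ω => hL.norm_φ₁ _)
  have iφ₁' : Integrable (fun ω => L.φ₁ (M.ay ω)) M.completeLaw :=
    Integrable.of_bound mf₁.aestronglyMeasurable 1 (.of_forall fun ω => hL.norm_φ₁ _)
  have iφ₂ : Integrable (fun ω => L.φ₂ ω.1.hist) M.obsLaw :=
    Integrable.of_bound mf₂.aestronglyMeasurable 1 (.of_forall fun ω => hL.norm_φ₂ _)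
  have iφ₂' : Integrable (fun ω => L.φ₂ ω.1.hist) M.completeLaw :=
    Integrable.of_bound mf₂.aestronglyMeasurable 1 (.of_forall fun ω => hL.norm_φ₂ _)
  have iy : Integrable (fun ω => M.y₂ ω.1) M.obsLaw :=
    Integrable.of_bound (Measurable.aestronglyMeasurable (by fun_prop)) Lα (L.ae_abs_y₂_le hbm hC₁ hC₂)
  have c₁ : ∀ v : EuclideanSpace ℝ (Fin m₁),
      M.obsLaw[fun ω => inner ℝ v (L.φ₁ (M.ay ω)) | TwoStageDTR.sigmaIV] =ᵐ[M.obsLaw]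
      fun ω => inner ℝ (LinearMap.adjoint W₁.toEuclideanLin v) (L.ψ₁ ω.1.y₁) := fun v => by
    filter_upwards [condExp_inner_left (m := TwoStageDTR.sigmaIV) iφ₁ v, hW₁] with ω e1 e2
    rw [e1, e2, LinearMap.adjoint_inner_left]
  have c₂ : ∀ (v₁ : EuclideanSpace ℝ (Fin m₁)) (v₂ : EuclideanSpace ℝ (Fin m₂)),
      M.completeLaw[fun ω => inner ℝ v₂ (L.φ₂ ω.1.hist) - inner ℝ v₁ (L.φ₁ (M.ay ω)) |
        TwoStageDTR.sigmaHistIV] =ᵐ[M.completeLaw]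
      fun ω => inner ℝ (LinearMap.adjoint W₃.toEuclideanLin v₂
        - LinearMap.adjoint W₂.toEuclideanLin v₁) (L.ψ₂ (ω.1.hist, ω.1.y₁)) := fun v₁ v₂ => by
    refine (condExp_sub (iφ₂'.const_inner v₂) (iφ₁'.const_inner v₁) _).trans ?_
    filter_upwards [condExp_inner_left (m := TwoStageDTR.sigmaHistIV) iφ₁' v₁,
      condExp_inner_left (m := TwoStageDTR.sigmaHistIV) iφ₂' v₂, hW₂, hW₃] with ω e1 e2 e3 e4
    rw [Pi.sub_apply, e1, e2, e3, e4, inner_sub_left, LinearMap.adjoint_inner_left,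
      LinearMap.adjoint_inner_left]
  have hcate : L.linG w₂s =ᵐ[M.histLaw] M.cate :=
    M.bridge_ae_eq_cate hac hε hIV (Measurable.inner measurable_const mφ₂)
      (iφ₂.const_inner w₂s) (iφ₁.const_inner w₁s) iy hies
  -- Subtracting the bridge equations removes Y₂ from the moments, so they depend only on the
  -- differences of weights, and W₁, W₂, W₃ act through their adjoints. Differences have norm at
  -- most twice the radius, which is why the dual radii carry a factor 2.
  refine ⟨w₁s, w₂s, fun w₁ => LinearMap.adjoint W₁.toEuclideanLin (w₁ - w₁s),
    fun w₁ w₂ => LinearMap.adjoint W₃.toEuclideanLin (w₂ - w₂s)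
      - LinearMap.adjoint W₂.toEuclideanLin (w₁ - w₁s), ?_⟩
  have hF : ∀ {m d : ℕ} (W : Matrix (Fin m) (Fin d) ℝ), 0 ≤ frobNorm W := fun W => Real.sqrt_nonneg _
  have nd : ∀ {m d : ℕ} (W : Matrix (Fin m) (Fin d) ℝ) {w ws : EuclideanSpace ℝ (Fin m)} {c : ℝ},
      ‖w‖ ≤ c → ‖ws‖ ≤ c → ‖LinearMap.adjoint W.toEuclideanLin (w - ws)‖ ≤ 2 * (c * frobNorm W) :=
    fun W w ws c h h' => by
      have h1 := norm_adjoint_toEuclideanLin_le W (w - ws)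
      have h2 : ‖w - ws‖ ≤ 2 * c := (norm_sub_le _ _).trans (by linarith)
      nlinarith [hF W, mul_le_mul_of_nonneg_left h2 (hF W)]
  constructor
  · exact hw₁s
  · exact hw₂s
  · intro w₁ h
    exact (nd W₁ h hw₁s).trans hD₁.le
  · intro w₁ w₂ h h'
    refine (norm_sub_le _ _).trans ?_
    linarith [nd W₃ h' hw₂s, nd W₂ h hw₁s]
  · simp
  · simp
  · intro w₁ β
    have mq : Measurable fun y => (inner ℝ β (L.ψ₁ y) : ℝ) := by fun_prop
    have hce : M.obsLaw[fun ω => inner ℝ w₁ (L.φ₁ (M.ay ω)) - M.y₂ ω.1 | TwoStageDTR.sigmaIV]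
        =ᵐ[M.obsLaw] fun ω => inner ℝ (LinearMap.adjoint W₁.toEuclideanLin (w₁ - w₁s))
          (L.ψ₁ ω.1.y₁) := by
      have e : (fun ω => inner ℝ w₁ (L.φ₁ (M.ay ω)) - M.y₂ ω.1)
          = (fun ω => inner ℝ (w₁ - w₁s) (L.φ₁ (M.ay ω)))
            + fun ω => inner ℝ w₁s (L.φ₁ (M.ay ω)) - M.y₂ ω.1 := by
        ext ω
        simp only [Pi.add_apply, inner_sub_left]
        ring
      rw [e]
      refine (condExp_add (iφ₁.const_inner _) ((iφ₁.const_inner _).sub' iy) _).trans ?_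
      filter_upwards [c₁ (w₁ - w₁s), hies.1] with ω e1 e2
      rw [Pi.add_apply, e1, e2]
      simp
    have hZ : Integrable (fun ω => inner ℝ w₁ (L.φ₁ (M.ay ω)) - M.y₂ ω.1) M.obsLaw :=
      (iφ₁.const_inner _).sub' iy
    refine integral_mul_of_condExp_comap (V := fun ω => ω.1.y₁) (by fun_prop) hZ hce mq ?_
    refine hZ.mul_bdd (c := ‖β‖) (Measurable.aestronglyMeasurable (by fun_prop))
      (.of_forall fun ω => (norm_inner_le_norm _ _).trans ?_)
    nlinarith [norm_nonneg β, hL.norm_ψ₁ ω.1.y₁]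
  · intro w₁ w₂ β
    have mq : Measurable fun s => (inner ℝ β (L.ψ₂ s) : ℝ) := by fun_prop
    have hce : M.completeLaw[fun ω => inner ℝ w₂ (L.φ₂ ω.1.hist) - inner ℝ w₁ (L.φ₁ (M.ay ω)) |
        TwoStageDTR.sigmaHistIV]
        =ᵐ[M.completeLaw] fun ω => inner ℝ (LinearMap.adjoint W₃.toEuclideanLin (w₂ - w₂s)
      - LinearMap.adjoint W₂.toEuclideanLin (w₁ - w₁s)) (L.ψ₂ (ω.1.hist, ω.1.y₁)) := by
      have e : (fun ω => inner ℝ w₂ (L.φ₂ ω.1.hist) - inner ℝ w₁ (L.φ₁ (M.ay ω)))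
          = (fun ω => inner ℝ (w₂ - w₂s) (L.φ₂ ω.1.hist) - inner ℝ (w₁ - w₁s) (L.φ₁ (M.ay ω)))
            + fun ω => inner ℝ w₂s (L.φ₂ ω.1.hist) - inner ℝ w₁s (L.φ₁ (M.ay ω)) := by
        ext ω
        simp only [Pi.add_apply, inner_sub_left]
        ring
      rw [e]
      refine (condExp_add ((iφ₂'.const_inner _).sub' (iφ₁'.const_inner _))
        ((iφ₂'.const_inner _).sub' (iφ₁'.const_inner _)) _).trans ?_
      filter_upwards [c₂ (w₁ - w₁s) (w₂ - w₂s), hies.2] with ω e1 e2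
      rw [Pi.add_apply, e1, e2]
      simp
    have hZ : Integrable (fun ω => inner ℝ w₂ (L.φ₂ ω.1.hist) - inner ℝ w₁ (L.φ₁ (M.ay ω)))
        M.completeLaw := (iφ₂'.const_inner _).sub' (iφ₁'.const_inner _)
    refine integral_mul_of_condExp_comap (V := fun ω => (ω.1.hist, ω.1.y₁)) mV hZ hce mq ?_
    refine hZ.mul_bdd (c := ‖β‖) (mq.comp mV).aestronglyMeasurable
      (.of_forall fun ω => (norm_inner_le_norm _ _).trans ?_)
    nlinarith [norm_nonneg β, hL.norm_ψ₂ (ω.1.hist, ω.1.y₁)]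
  · intro π hπ
    exact M.value_eq_modelValue hcate (hsing π hπ) (hint π hπ)
  · intro hB w₁ w₂
    refine le_trans ?_ (shift_bound hL hb hs hac hB (c₁ (w₁ - w₁s)) (c₂ (w₁ - w₁s) (w₂ - w₂s)))
    have hi : ∀ w, Integrable (L.linG w) (M.visitLaw πs) := fun w =>
      Integrable.of_bound (Measurable.inner measurable_const mφ₂).aestronglyMeasurable ‖w‖
        (.of_forall fun s => (norm_inner_le_norm _ _).trans
          (by nlinarith [norm_nonneg w, hL.norm_φ₂ s]))
    have e : M.modelValue (L.linG w₂s) πs - M.modelValue (L.linG w₂) πs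
        = -∫ s, inner ℝ (w₂ - w₂s) (L.φ₂ s) ∂(M.visitLaw πs) := by
      unfold TwoStageDTR.modelValue
      rw [← integral_sub (hi _) (hi _), ← integral_neg]
      refine integral_congr_ae (.of_forall fun s => ?_)
      simp only [linG, inner_sub_left]
      ring
    rw [e]
    exact ENNReal.ofReal_le_ofReal (neg_le_abs _)

end DTRFeatures

/-! ### The minimax loss on a sample with accurate moments -/

section DualLoss

variable {ρ H E : Type*} [NormedAddCommGroup E] {T : ℕ}

/-- The supremum over the dual class `F` in the empirical loss. -/
def dualLoss (D : Fin T → ρ) (S : Finset (Fin T)) (α : ρ → ℝ) (F : Set (ρ → ℝ)) : ℝ :=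
  sSup ((fun θ : ρ → ℝ => empMean D S (fun r => α r * θ r) - empMean D S (fun r => θ r ^ 2) / 2) '' F)

/-- The empirical moments of `α h * θ β` and `θ β ^ 2` are close to `B (t h) β` and `B β β`, up to a
fraction of `B β β + s`, for `h ∈ 𝓗` and `β` in the ball of radius `r`. -/
structure CloseMoments (D : Fin T → ρ) (S : Finset (Fin T)) (𝓗 : Set H) (α : H → ρ → ℝ)
    (θ : E → ρ → ℝ) (r s : ℝ) (B : E → E → ℝ) (t : H → E) : Prop where
  sq : ∀ β, ‖β‖ ≤ r → |empMean D S (fun x => θ β x ^ 2) - B β β| ≤ (B β β + s) / 8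
  mul : ∀ h ∈ 𝓗, ∀ β, ‖β‖ ≤ r → |empMean D S (fun x => α h x * θ β x) - B (t h) β| ≤ (B β β + s) / 8

namespace CloseMoments

variable {D : Fin T → ρ} {S : Finset (Fin T)} {𝓗 : Set H} {α : H → ρ → ℝ} {θ : E → ρ → ℝ} {r s : ℝ}
  {B : E → E → ℝ} {t : H → E} (hM : CloseMoments D S 𝓗 α θ r s B t)
  (hB : ∀ x y, B x y ≤ 2 * B x x + B y y / 8) (hB0 : ∀ x, 0 ≤ B x x)
include hM hB hB0

/-- The quadratic penalty beats the linear term. Boundedness is what makes the `sSup` in the loss a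
genuine supremum. -/
theorem bddAbove {h : H} (hh : h ∈ 𝓗) :
    BddAbove ((fun θ : ρ → ℝ => empMean D S (fun x => α h x * θ x) - empMean D S (fun x => θ x ^ 2) / 2)
      '' (θ '' {β | ‖β‖ ≤ r})) := by
  refine ⟨2 * B (t h) (t h) + 3 / 16 * s, ?_⟩
  rintro _ ⟨_, ⟨β, hβ, rfl⟩, rfl⟩
  have h1 := abs_le.1 (hM.sq β hβ)
  have h2 := abs_le.1 (hM.mul h hh β hβ)
  have h3 := hB (t h) β
  have h4 := hB0 β
  simp only
  linarith [h1.1, h2.2]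

theorem dualLoss_nonneg (hθ : θ 0 = 0) (hr : 0 ≤ r) {h : H} (hh : h ∈ 𝓗) :
    0 ≤ dualLoss D S (α h) (θ '' {β | ‖β‖ ≤ r}) := by
  refine le_csSup (hM.bddAbove hB hB0 hh) ⟨θ 0, ⟨0, by simpa using hr, rfl⟩, ?_⟩
  simp [hθ, empMean]

/-- Test with β = t h, the population maximizer. The errors cost (B + s)/8 in the linear term and
half of that in the quadratic one, so 1 - 1/2 - 1/8 - 1/16 = 5/16 of B survives. -/
theorem le_dualLoss {h : H} (hh : h ∈ 𝓗) (ht : ‖t h‖ ≤ r) :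
    5 / 16 * B (t h) (t h) - 3 / 16 * s ≤ dualLoss D S (α h) (θ '' {β | ‖β‖ ≤ r}) := by
  refine le_csSup_of_le (hM.bddAbove hB hB0 hh) ⟨θ (t h), ⟨t h, ht, rfl⟩, rfl⟩ ?_
  have h1 := abs_le.1 (hM.sq _ ht)
  have h2 := abs_le.1 (hM.mul h hh _ ht)
  simp only
  linarith [h1.2, h2.1]

omit hB in
-- At a solution the linear term consists of deviation only; the penalty absorbs the multiples of B
-- β β and leaves s/8 + s/16.
theorem dualLoss_le (hr : 0 ≤ r) {h : H} (hh : h ∈ 𝓗) (ht : ∀ β, B (t h) β = 0) :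
    dualLoss D S (α h) (θ '' {β | ‖β‖ ≤ r}) ≤ 3 / 16 * s := by
  refine csSup_le ⟨_, ⟨θ 0, ⟨0, by simpa using hr, rfl⟩, rfl⟩⟩ ?_
  rintro _ ⟨_, ⟨β, hβ, rfl⟩, rfl⟩
  have h1 := abs_le.1 (hM.sq β hβ)
  have h2 := abs_le.1 (hM.mul h hh β hβ)
  have h4 := hB0 β
  have h5 := ht β
  simp only
  linarith [h1.1, h2.2]

end CloseMoments

end DualLoss

section SecondMoment

variable {Ω : Type*} [MeasurableSpace Ω] {μ : Measure Ω} [IsFiniteMeasure μ] {d : ℕ}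
  {ψ : Ω → EuclideanSpace ℝ (Fin d)}

/-- The bilinear form `∫ ⟪x, ψ⟫ ⟪y, ψ⟫ ∂μ`. -/
def secondMoment (μ : Measure Ω) (ψ : Ω → EuclideanSpace ℝ (Fin d))
    (x y : EuclideanSpace ℝ (Fin d)) : ℝ :=
  ∫ ω, inner ℝ x (ψ ω) * inner ℝ y (ψ ω) ∂μ

omit [IsFiniteMeasure μ] in
theorem secondMoment_self_nonneg (x : EuclideanSpace ℝ (Fin d)) : 0 ≤ secondMoment μ ψ x x :=
  integral_nonneg fun _ => mul_self_nonneg _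

theorem integrable_secondMoment (hψ : Measurable ψ) (hb : ∀ ω, ‖ψ ω‖ ≤ 1)
    (x y : EuclideanSpace ℝ (Fin d)) :
    Integrable (fun ω => inner ℝ x (ψ ω) * inner ℝ y (ψ ω)) μ := by
  have h : ∀ (x : EuclideanSpace ℝ (Fin d)) ω, ‖(inner ℝ x (ψ ω) : ℝ)‖ ≤ ‖x‖ := fun x ω =>
    (norm_inner_le_norm _ _).trans (by nlinarith [norm_nonneg x, hb ω])
  refine Integrable.of_bound (Measurable.aestronglyMeasurable (by fun_prop)) (‖x‖ * ‖y‖)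
    (.of_forall fun ω => ?_)
  rw [norm_mul]
  exact mul_le_mul (h x ω) (h y ω) (norm_nonneg _) (norm_nonneg _)

theorem secondMoment_le (hψ : Measurable ψ) (hb : ∀ ω, ‖ψ ω‖ ≤ 1) (x y : EuclideanSpace ℝ (Fin d)) :
    secondMoment μ ψ x y ≤ 2 * secondMoment μ ψ x x + secondMoment μ ψ y y / 8 := by
  unfold secondMoment
  rw [← integral_const_mul, ← integral_div, ← integral_add
    ((integrable_secondMoment hψ hb x x).const_mul 2) ((integrable_secondMoment hψ hb y y).div_const 8)]
  refine integral_mono (integrable_secondMoment hψ hb x y)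
    (((integrable_secondMoment hψ hb x x).const_mul 2).add
      ((integrable_secondMoment hψ hb y y).div_const 8)) fun ω => ?_
  nlinarith [sq_nonneg (4 * inner ℝ x (ψ ω) - inner ℝ y (ψ ω) : ℝ)]

theorem eLpNorm_inner_le (hψ : Measurable ψ) (hb : ∀ ω, ‖ψ ω‖ ≤ 1) {x : EuclideanSpace ℝ (Fin d)}
    {c : ℝ} (hc : 0 ≤ c) (h : secondMoment μ ψ x x ≤ c ^ 2) :
    eLpNorm (fun ω => (inner ℝ x (ψ ω) : ℝ)) 2 μ ≤ ENNReal.ofReal c := by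
  have hm : Measurable fun ω => (inner ℝ x (ψ ω) : ℝ) := by fun_prop
  have hL : MemLp (fun ω => (inner ℝ x (ψ ω) : ℝ)) 2 μ := by
    rw [memLp_two_iff_integrable_sq hm.aestronglyMeasurable]
    exact (integrable_secondMoment hψ hb x x).congr (.of_forall fun ω => (sq _).symm)
  rw [hL.eLpNorm_eq_integral_rpow_norm (by norm_num) (by norm_num)]
  refine ENNReal.ofReal_le_ofReal ?_
  have e : ∫ ω, ‖(inner ℝ x (ψ ω) : ℝ)‖ ^ (ENNReal.toReal 2) ∂μ = secondMoment μ ψ x x := by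
    refine integral_congr_ae (.of_forall fun ω => ?_)
    simp only [ENNReal.toReal_ofNat, Real.rpow_ofNat, Real.norm_eq_abs, sq_abs]
    rw [sq]
  rw [e, ENNReal.toReal_ofNat, ← one_div, ← Real.sqrt_eq_rpow]
  exact Real.sqrt_le_iff.2 ⟨hc, h⟩

end SecondMoment

namespace DTRFeatures

variable {𝒳₁ 𝒜₁ 𝒳₂ 𝒜₂ 𝒰 : Type*} {m₁ m₂ d₁ d₂ : ℕ} (L : DTRFeatures 𝒳₁ 𝒜₁ 𝒳₂ 𝒜₂ m₁ m₂ d₁ d₂)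

/-- The hypothesis with weights `p`. -/
def ofWeights (p : EuclideanSpace ℝ (Fin m₁) × EuclideanSpace ℝ (Fin m₂)) :
    ((𝒜₁ × 𝒜₂) × (ℝ × ℝ) → ℝ) × (DTRHist 𝒳₁ 𝒜₁ 𝒳₂ 𝒜₂ → ℝ) :=
  (fun a => inner ℝ p.1 (L.φ₁ a), L.linG p.2)

/-- Weights of the hypotheses. -/
def weights : Set (EuclideanSpace ℝ (Fin m₁) × EuclideanSpace ℝ (Fin m₂)) :=
  {p | ‖p.1‖ ≤ L.C₁ ∧ ‖p.2‖ ≤ L.C₂}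

/-- The dual function of stage one with coefficients `β`. -/
def dual₁ (β : EuclideanSpace ℝ (Fin d₁)) (r : DTRRecord 𝒳₁ 𝒜₁ 𝒳₂ 𝒜₂) : ℝ := inner ℝ β (L.ψ₁ r.y₁)

/-- The dual function of stage two with coefficients `β`. -/
def dual₂ (β : EuclideanSpace ℝ (Fin d₂)) (r : DTRRecord 𝒳₁ 𝒜₁ 𝒳₂ 𝒜₂) : ℝ :=
  r.onHist fun s => inner ℝ β (L.ψ₂ (s, r.y₁))

theorem image_weights : L.ofWeights '' L.weights = L.hyp := by
  ext h
  constructor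
  · rintro ⟨p, ⟨h₁, h₂⟩, rfl⟩
    exact ⟨⟨p.1, h₁, rfl⟩, ⟨p.2, h₂, rfl⟩⟩
  · obtain ⟨h, g⟩ := h
    rintro ⟨⟨w₁, h₁, e₁⟩, ⟨w₂, h₂, e₂⟩⟩
    exact ⟨(w₁, w₂), ⟨h₁, h₂⟩, Prod.ext e₁.symm e₂.symm⟩

theorem Θ₁_eq : L.Θ₁ = L.dual₁ '' {β | ‖β‖ ≤ L.D₁} := by
  ext θ
  constructor
  · rintro ⟨_, ⟨β, h, rfl⟩, rfl⟩
    exact ⟨β, h, rfl⟩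
  · rintro ⟨β, h, rfl⟩
    exact ⟨_, ⟨β, h, rfl⟩, rfl⟩

theorem Θ₂_eq : L.Θ₂ = L.dual₂ '' {β | ‖β‖ ≤ L.D₂} := by
  ext θ
  constructor
  · rintro ⟨_, ⟨β, h, rfl⟩, rfl⟩
    exact ⟨β, h, rfl⟩
  · rintro ⟨β, h, rfl⟩
    exact ⟨_, ⟨β, h, rfl⟩, rfl⟩

theorem dual₁_zero : L.dual₁ 0 = 0 := by ext r; simp [dual₁]

theorem dual₂_zero : L.dual₂ 0 = 0 := by
  ext r
  simp only [dual₂, inner_zero_left, Pi.zero_apply, DTRRecord.onHist]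
  cases r.hist? <;> rfl

theorem loss_eq {T : ℕ} (D : Fin T → DTRRecord 𝒳₁ 𝒜₁ 𝒳₂ 𝒜₂)
    (h : ((𝒜₁ × 𝒜₂) × (ℝ × ℝ) → ℝ) × (DTRHist 𝒳₁ 𝒜₁ 𝒳₂ 𝒜₂ → ℝ)) :
    L.loss D h = dualLoss D Finset.univ (α₁ h) (L.dual₁ '' {β | ‖β‖ ≤ L.D₁}) +
      dualLoss D (DTRRecord.completeSet D) (α₂ h) (L.dual₂ '' {β | ‖β‖ ≤ L.D₂}) := by
  rw [← Θ₁_eq, ← Θ₂_eq]; rfl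

variable {L} [MeasurableSpace 𝒳₁] [MeasurableSpace 𝒜₁]
  [MeasurableSpace 𝒳₂] [MeasurableSpace 𝒜₂] [MeasurableSpace 𝒰] {M : TwoStageDTR 𝒳₁ 𝒜₁ 𝒳₂ 𝒜₂ 𝒰}

theorem abs_linG_le (hL : L.Regular) (w : EuclideanSpace ℝ (Fin m₂))
    (s : DTRHist 𝒳₁ 𝒜₁ 𝒳₂ 𝒜₂) : ‖L.linG w s‖ ≤ ‖w‖ :=
  (norm_inner_le_norm _ _).trans (by nlinarith [norm_nonneg w, hL.norm_φ₂ s])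

theorem abs_modelValue_linG_le (hL : L.Regular) (w : EuclideanSpace ℝ (Fin m₂))
    (π : DTRPolicy 𝒳₁ 𝒜₁ 𝒳₂ 𝒜₂) : |M.modelValue (L.linG w) π| ≤ ‖w‖ := by
  have h := norm_integral_le_of_norm_le_const (μ := M.visitLaw π)
    (.of_forall fun s => abs_linG_le hL w s)
  simpa [TwoStageDTR.modelValue] using h

/-- The true bridge function belongs to the confidence set, so the pessimistic value of the output
does not exceed its true value. By the choice of the output it is also at least the pessimistic
value of π*. Hence the sub-optimality is at most the largest v(g*, π*) - v(g, π*) over the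
confidence set; only the visitation law of π* has to be covered. -/
theorem subOpt_le [IsProbabilityMeasure M.completeLaw] (hL : L.Regular)
    {Pol : Set (DTRPolicy 𝒳₁ 𝒜₁ 𝒳₂ 𝒜₂)}
    {πs πhat : DTRPolicy 𝒳₁ 𝒜₁ 𝒳₂ 𝒜₂} {b₁ : ℝ → ℝ} {w₁s w₂s β₁ β₂}
    (hbr : L.IsBridge M Pol πs b₁ w₁s w₂s β₁ β₂) (hπs : πs ∈ Pol) {T : ℕ}
    {D : Fin T → DTRRecord 𝒳₁ 𝒜₁ 𝒳₂ 𝒜₂} {s₁ s₂ e : ℝ} (he : 0 < e) (hse : s₁ + s₂ ≤ e)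
    (h₁ : CloseMoments D Finset.univ L.weights (fun p => α₁ (L.ofWeights p)) L.dual₁ L.D₁ s₁
      (secondMoment M.obsLaw fun ω => L.ψ₁ ω.1.y₁) fun p => β₁ p.1)
    (h₂ : CloseMoments D (DTRRecord.completeSet D) L.weights (fun p => α₂ (L.ofWeights p)) L.dual₂
      L.D₂ s₂ (secondMoment M.completeLaw fun ω => L.ψ₂ (ω.1.hist, ω.1.y₁)) fun p => β₂ p.1 p.2)
    (hcap : L.IsCAP M Pol D e πhat) (hs₁ : 0 ≤ s₁) (hs₂ : 0 ≤ s₂) :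
    ENNReal.ofReal (M.value πs - M.value πhat) ≤ ENNReal.ofReal (3 * √e) * M.shiftNorm b₁ := by
  have hD₁ : 0 ≤ L.D₁ := (norm_nonneg _).trans (hbr.norm_coeff₁ _ hbr.norm_fst)
  have hD₂ : 0 ≤ L.D₂ := (norm_nonneg _).trans (hbr.norm_coeff₂ _ _ hbr.norm_fst hbr.norm_snd)
  have mψ₁ : Measurable fun ω : DTRTrial 𝒳₁ 𝒜₁ 𝒳₂ 𝒜₂ 𝒰 => L.ψ₁ ω.1.y₁ :=
    hL.measurable_ψ₁.comp (by fun_prop)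
  have mψ₂ : Measurable fun ω : DTRTrial 𝒳₁ 𝒜₁ 𝒳₂ 𝒜₂ 𝒰 => L.ψ₂ (ω.1.hist, ω.1.y₁) :=
    hL.measurable_ψ₂.comp TwoStageDTR.measurable_histIV
  have bψ₁ : ∀ ω : DTRTrial 𝒳₁ 𝒜₁ 𝒳₂ 𝒜₂ 𝒰, ‖L.ψ₁ ω.1.y₁‖ ≤ 1 := fun ω => hL.norm_ψ₁ _
  have bψ₂ : ∀ ω : DTRTrial 𝒳₁ 𝒜₁ 𝒳₂ 𝒜₂ 𝒰, ‖L.ψ₂ (ω.1.hist, ω.1.y₁)‖ ≤ 1 := fun ω => hL.norm_ψ₂ _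
  have B₁ := secondMoment_le (μ := M.obsLaw) mψ₁ bψ₁
  have B₂ := secondMoment_le (μ := M.completeLaw) mψ₂ bψ₂
  have N₁ := secondMoment_self_nonneg (μ := M.obsLaw)
    (ψ := fun ω : DTRTrial 𝒳₁ 𝒜₁ 𝒳₂ 𝒜₂ 𝒰 => L.ψ₁ ω.1.y₁)
  have N₂ := secondMoment_self_nonneg (μ := M.completeLaw)
    (ψ := fun ω : DTRTrial 𝒳₁ 𝒜₁ 𝒳₂ 𝒜₂ 𝒰 => L.ψ₂ (ω.1.hist, ω.1.y₁))
  have hself : (w₁s, w₂s) ∈ L.weights := ⟨hbr.norm_fst, hbr.norm_snd⟩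
  have hloss0 : ∀ p ∈ L.weights, 0 ≤ L.loss D (L.ofWeights p) := fun p hp => by
    rw [loss_eq]
    exact add_nonneg (h₁.dualLoss_nonneg B₁ N₁ L.dual₁_zero hD₁ hp)
      (h₂.dualLoss_nonneg B₂ N₂ L.dual₂_zero hD₂ hp)
  have hlosss : L.loss D (L.ofWeights (w₁s, w₂s)) ≤ 3 / 16 * (s₁ + s₂) := by
    rw [loss_eq, mul_add]
    exact add_le_add
      (h₁.dualLoss_le N₁ hD₁ hself fun β => by simp [hbr.coeff₁_self, secondMoment])
      (h₂.dualLoss_le N₂ hD₂ hself fun β => by simp [hbr.coeff₂_self, secondMoment])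
  have hinf : sInf (L.loss D '' L.hyp) ≤ 3 / 16 * (s₁ + s₂) := by
    refine csInf_le_of_le ⟨0, ?_⟩ ⟨_, ?_, rfl⟩ hlosss
    · rintro _ ⟨h, hh, rfl⟩
      rw [← image_weights] at hh
      obtain ⟨p, hp, rfl⟩ := hh
      exact hloss0 p hp
    · rw [← image_weights]
      exact ⟨_, hself, rfl⟩
  have hinf0 : 0 ≤ sInf (L.loss D '' L.hyp) := by
    refine Real.sInf_nonneg ?_
    rintro _ ⟨h, hh, rfl⟩
    rw [← image_weights] at hh
    obtain ⟨p, hp, rfl⟩ := hh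
    exact hloss0 p hp
  have hmem : L.linG w₂s ∈ L.confSet D e := by
    refine ⟨L.ofWeights (w₁s, w₂s), ⟨?_, ?_⟩, rfl⟩
    · rw [← image_weights]
      exact ⟨_, hself, rfl⟩
    · linarith
  -- With infinite shift norm the right side is infinite, because √e is positive.
  rcases eq_or_ne (M.shiftNorm b₁) ⊤ with hB | hB
  · rw [hB, ENNReal.mul_top]
    · exact le_top
    · rw [Ne, ENNReal.ofReal_eq_zero, not_le]
      have := Real.sqrt_pos.2 he
      positivity
  have hconf : ∀ g ∈ L.confSet D e, M.modelValue (L.linG w₂s) πs - M.modelValue g πs ≤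
      (ENNReal.ofReal (3 * √e) * M.shiftNorm b₁).toReal := by
    rintro _ ⟨h, ⟨hh, hle⟩, rfl⟩
    rw [← image_weights] at hh
    obtain ⟨p, hp, rfl⟩ := hh
    -- The threshold e plus the infimum, which is at most 3e/16. Together with the lower bound of
    -- each dual loss this gives 5/16 · (B₁ + B₂) ≤ 22/16 · e, so each squared moment norm is below
    -- 9e = (3√e)².
    have hle' : L.loss D (L.ofWeights p) ≤ 19 / 16 * e := by linarith
    rw [loss_eq] at hle'
    have a1 := h₁.dualLoss_nonneg B₁ N₁ L.dual₁_zero hD₁ hp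
    have a2 := h₂.dualLoss_nonneg B₂ N₂ L.dual₂_zero hD₂ hp
    have a3 := h₁.le_dualLoss B₁ N₁ hp (hbr.norm_coeff₁ _ hp.1)
    have a4 := h₂.le_dualLoss B₂ N₂ hp (hbr.norm_coeff₂ _ _ hp.1 hp.2)
    have hsq : (3 * √e) ^ 2 = 9 * e := by rw [mul_pow, Real.sq_sqrt he.le]; norm_num
    have b1 := eLpNorm_inner_le (c := 3 * √e) mψ₁ bψ₁ (by positivity)
      (show secondMoment M.obsLaw (fun ω => L.ψ₁ ω.1.y₁) (β₁ p.1) (β₁ p.1) ≤ _ by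
        rw [hsq]; linarith)
    have b2 := eLpNorm_inner_le (c := 3 * √e) mψ₂ bψ₂ (by positivity)
      (show secondMoment M.completeLaw (fun ω => L.ψ₂ (ω.1.hist, ω.1.y₁)) (β₂ p.1 p.2) (β₂ p.1 p.2)
        ≤ _ by rw [hsq]; linarith)
    refine (ENNReal.ofReal_le_iff_le_toReal (ENNReal.mul_ne_top ENNReal.ofReal_ne_top hB)).1 ?_
    refine (hbr.shift hB p.1 p.2).trans ?_
    rw [TwoStageDTR.shiftNorm, mul_add]
    gcongr
  have hpess : ∀ π : DTRPolicy 𝒳₁ 𝒜₁ 𝒳₂ 𝒜₂, BddBelow ((fun g => M.modelValue g π) '' L.confSet D e) := by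
    intro π
    refine ⟨-L.C₂, ?_⟩
    rintro _ ⟨_, ⟨h, ⟨hh, -⟩, rfl⟩, rfl⟩
    rw [← image_weights] at hh
    obtain ⟨p, hp, rfl⟩ := hh
    have := (abs_le.1 (abs_modelValue_linG_le (M := M) hL p.2 π)).1
    have h3 := hp.2
    simp only [ofWeights]
    linarith
  have p1 : L.pessValue M D e πhat ≤ M.modelValue (L.linG w₂s) πhat :=
    csInf_le (hpess πhat) ⟨_, hmem, rfl⟩
  have p2 := hcap.2 πs hπs
  have p3 : M.modelValue (L.linG w₂s) πs - (ENNReal.ofReal (3 * √e) * M.shiftNorm b₁).toReal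
      ≤ L.pessValue M D e πs := by
    refine le_csInf ⟨_, ⟨_, hmem, rfl⟩⟩ ?_
    rintro _ ⟨g, hg, rfl⟩
    linarith [hconf g hg]
  rw [hbr.value _ hπs, hbr.value _ hcap.1]
  exact (ENNReal.ofReal_le_iff_le_toReal (ENNReal.mul_ne_top ENNReal.ofReal_ne_top hB)).2 (by linarith)

end DTRFeatures

/-! ### Subsamples selected by an event -/

section Selection

variable {ι Ω : Type*} [Fintype ι] [DecidableEq ι] [MeasurableSpace Ω] {P : Measure Ω}
  [IsProbabilityMeasure P] {A : Set Ω}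

theorem pi_restrict_eq_smul_pi_cond (hA : P A ≠ 0) (κ : Type*) [Fintype κ] :
    Measure.pi (fun _ : κ => P.restrict A)
      = P A ^ Fintype.card κ • Measure.pi (fun _ : κ => P[|A]) := by
  have := cond_isProbabilityMeasure hA
  refine Measure.pi_eq fun s hs => ?_
  rw [Measure.smul_apply, Measure.pi_pi, smul_eq_mul, ← Finset.card_univ, ← Finset.prod_const,
    ← Finset.prod_mul_distrib]
  refine Finset.prod_congr rfl fun i _ => ?_
  rw [ProbabilityTheory.cond, Measure.smul_apply, smul_eq_mul, ← mul_assoc,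
    ENNReal.mul_inv_cancel hA (measure_ne_top _ _), one_mul]

/-- If exactly the indices in `S` fall into `A`, the coordinates in and outside `S` separate.
Restricting to `A` inside `S` is P(A)^|S| times the product of conditional laws. -/
theorem measure_pi_selected_le (hAm : MeasurableSet A) (hA : P A ≠ 0) (S : Finset ι)
    {B : Set (S → Ω)} (hB : MeasurableSet B) :
    Measure.pi (fun _ : ι => P) {ω | (∀ i, i ∈ S ↔ ω i ∈ A) ∧ (fun i : S => ω i) ∈ B}
      ≤ P A ^ S.card * P Aᶜ ^ (Fintype.card ι - S.card) * Measure.pi (fun _ : S => P[|A]) B := by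
  have hmp : MeasurePreserving (MeasurableEquiv.piEquivPiSubtypeProd (fun _ : ι => Ω) (· ∈ S))
      (Measure.pi fun _ => P) ((Measure.pi fun _ : S => P).prod
        (Measure.pi fun _ : {i // i ∉ S} => P)) := by
    convert measurePreserving_piEquivPiSubtypeProd (fun _ : ι => P) (fun i => i ∈ S)
  have hm1 : MeasurableSet (Set.univ.pi fun _ : S => A) :=
    MeasurableSet.pi Set.countable_univ fun _ _ => hAm
  have hm2 : MeasurableSet (Set.univ.pi fun _ : {i // i ∉ S} => Aᶜ) :=
    MeasurableSet.pi Set.countable_univ fun _ _ => hAm.compl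
  have hsub : {ω : ι → Ω | (∀ i, i ∈ S ↔ ω i ∈ A) ∧ (fun i : S => ω i) ∈ B}
      ⊆ (MeasurableEquiv.piEquivPiSubtypeProd (fun _ : ι => Ω) (fun i => i ∈ S)) ⁻¹'
        ((B ∩ Set.univ.pi fun _ => A) ×ˢ Set.univ.pi fun _ => Aᶜ) := by
    rintro ω ⟨h1, h2⟩
    refine ⟨⟨h2, fun i _ => (h1 i).1 i.2⟩, fun i _ h => i.2 ((h1 i).2 h)⟩
  refine (measure_mono hsub).trans ?_
  rw [hmp.measure_preimage ((hB.inter hm1).prod hm2).nullMeasurableSet, Measure.prod_prod,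
    Measure.pi_pi, ← Measure.restrict_apply hB, Measure.restrict_pi_pi]
  rw [pi_restrict_eq_smul_pi_cond hA, Measure.smul_apply, smul_eq_mul, Finset.prod_const,
    Finset.card_univ, Fintype.card_coe, Fintype.card_subtype_compl, Fintype.card_coe]
  exact le_of_eq (mul_right_comm _ _ _)

/-- A bound that holds for independent draws from the conditional law, uniformly in the subset,
transfers to the random subsample: the weights of the possible subsets add up to one by the binomial
theorem. Bad sets need not be measurable, hence the measurable hulls. -/
theorem measure_pi_selected_bad_le (hAm : MeasurableSet A) (hA : P A ≠ 0)
    (Bad : (S : Finset ι) → Set (S → Ω)) {ε : ENNReal}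
    (hBad : ∀ S : Finset ι, Measure.pi (fun _ : S => P[|A]) (Bad S) ≤ ε) :
    Measure.pi (fun _ : ι => P) {ω | ∃ S : Finset ι, (∀ i, i ∈ S ↔ ω i ∈ A) ∧
      (fun i : S => ω i) ∈ Bad S} ≤ ε := by
  have hsub : {ω : ι → Ω | ∃ S : Finset ι, (∀ i, i ∈ S ↔ ω i ∈ A) ∧ (fun i : S => ω i) ∈ Bad S}
      ⊆ ⋃ S ∈ (Finset.univ : Finset ι).powerset, {ω | (∀ i, i ∈ S ↔ ω i ∈ A) ∧
        (fun i : S => ω i) ∈ toMeasurable (Measure.pi (fun _ : S => P[|A])) (Bad S)} := by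
    rintro ω ⟨S, h1, h2⟩
    simp only [Set.mem_iUnion]
    exact ⟨S, by simp, h1, subset_toMeasurable _ _ h2⟩
  refine (measure_mono hsub).trans ((measure_biUnion_finset_le _ _).trans ?_)
  calc _ ≤ ∑ S ∈ (Finset.univ : Finset ι).powerset,
        P A ^ S.card * P Aᶜ ^ (Fintype.card ι - S.card) * ε := by
        refine Finset.sum_le_sum fun S _ =>
          (measure_pi_selected_le hAm hA S (measurableSet_toMeasurable _ _)).trans ?_
        rw [measure_toMeasurable]
        gcongr
        exact hBad S
    _ = ε := by
        rw [← Finset.sum_mul, ← Finset.card_univ, Finset.sum_pow_mul_eq_add_pow,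
          prob_add_prob_compl hAm, one_pow, one_mul]

end Selection

/-! ### Samples with accurate moments -/

section Accurate

variable {ι Ω κ₁ κ₂ : Type*} [Fintype ι] [MeasurableSpace Ω] [Fintype κ₁] [Fintype κ₂] {d : ℕ}

/-- A sample on which the moments are accurate at a level `l` which is either the level of the
deviation term or visible in the sample. -/
def AccurateSample (μ : Measure Ω) (ψ : Ω → EuclideanSpace ℝ (Fin d)) (φ₁ : Ω → EuclideanSpace ℝ κ₁)
    (φ₂ : Ω → EuclideanSpace ℝ κ₂) (c τ : ℝ) (ω : ι → Ω) : Prop :=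
  ∃ (e : OrthonormalBasis (Fin d) ℝ (EuclideanSpace ℝ (Fin d))) (s : Fin d → ℝ) (l : ℝ),
    (∀ i, 0 ≤ s i) ∧
    (∀ i j, ∫ x, inner ℝ (e i) (ψ x) * inner ℝ (e j) (ψ x) ∂μ = if i = j then s i else 0) ∧
    16 * τ / (c ^ 2 * Fintype.card ι) ≤ l ∧
    (l = 16 * τ / (c ^ 2 * Fintype.card ι) ∨ c ^ 2 / 2 * Fintype.card ι / 4 * l ≤ effDim s l) ∧
    GoodSample μ e s ψ φ₁ φ₂ l c (16 * τ / (c ^ 2 * Fintype.card ι)) ω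

variable {μ : Measure Ω} [IsProbabilityMeasure μ] {ψ : Ω → EuclideanSpace ℝ (Fin d)}
  {φ₁ : Ω → EuclideanSpace ℝ κ₁} {φ₂ : Ω → EuclideanSpace ℝ κ₂} {c τ : ℝ}

theorem measure_pi_not_accurateSample_le [Nonempty ι]
    (hφ₁ : Measurable φ₁) (hφ₁b : ∀ᵐ x ∂μ, ‖φ₁ x‖ ≤ 1)
    (hφ₂ : Measurable φ₂) (hφ₂b : ∀ᵐ x ∂μ, ‖φ₂ x‖ ≤ 1)
    (hψ : Measurable ψ) (hb : ∀ x, ‖ψ x‖ ≤ 1) (hc : 0 < c) (hc1 : c ≤ 1) (hτ : 1 ≤ τ) :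
    (Measure.pi fun _ : ι => μ) {ω | ¬ AccurateSample μ ψ φ₁ φ₂ c τ ω}
      ≤ ENNReal.ofReal (4 * Real.exp (-τ)) := by
  obtain ⟨e, s, hs, he⟩ := exists_orthonormalBasis_second_moment μ hψ hb
  have hn : (0 : ℝ) < Fintype.card ι := Nat.cast_pos.2 Fintype.card_pos
  obtain ⟨l, hl, hd, hd'⟩ := exists_level hs (κ := c ^ 2 / 2 * Fintype.card ι)
    (l₀ := 16 * τ / (c ^ 2 * Fintype.card ι)) (by positivity) (by positivity)
  have h := measure_pi_not_goodSample_le (ι := ι) hφ₁ hφ₁b hφ₂ hφ₂b hψ hb hs he hc hc1 hτ hl hd hd'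
  refine le_trans (measure_mono ?_) h
  exact fun ω hω h => hω ⟨e, s, l, hs, he, hl, hd', h⟩

/-- The deviation bounds are relative to the whitened norm, and for ‖β‖ ≤ r its square is at most B
β β + l r². So the error level is l r², and 24c ≤ 1 turns the factor 3c into 1/8. The level is then
estimated in two ways: by the dimension, and by the deviation level or any critical radius. -/
theorem AccurateSample.closeMoments [Nonempty ι]
    (hφ₁ : Measurable φ₁) (hφ₁b : ∀ᵐ x ∂μ, ‖φ₁ x‖ ≤ 1)
    (hφ₂ : Measurable φ₂) (hφ₂b : ∀ᵐ x ∂μ, ‖φ₂ x‖ ≤ 1)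
    (hψ : Measurable ψ) (hb : ∀ x, ‖ψ x‖ ≤ 1) (hc : 0 < c) (hc1 : c ≤ 1 / 24) (hτ : 1 ≤ τ)
    {ω : ι → Ω} (hω : AccurateSample μ ψ φ₁ φ₂ c τ ω)
    {ρ H : Type*} {T : ℕ} {D : Fin T → ρ} {S : Finset (Fin T)} (j : ι ≃ S) {𝓗 : Set H}
    {α : H → ρ → ℝ} {θ : EuclideanSpace ℝ (Fin d) → ρ → ℝ} {r R : ℝ} (hr : 0 < r)
    (hcR : c * (24 * R) ≤ r)
    {t : H → EuclideanSpace ℝ (Fin d)} {a₁ : H → EuclideanSpace ℝ κ₁} {a₂ : H → EuclideanSpace ℝ κ₂}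
    (ha : ∀ h ∈ 𝓗, ‖a₁ h‖ + ‖a₂ h‖ ≤ R)
    (hθ : ∀ i β, θ β (D (j i)) = inner ℝ β (ψ (ω i)))
    (hα : ∀ h i, α h (D (j i)) = inner ℝ (a₁ h) (φ₁ (ω i)) + inner ℝ (a₂ h) (φ₂ (ω i)))
    (hmom : ∀ h β, ∫ x, (inner ℝ (a₁ h) (φ₁ x) + inner ℝ (a₂ h) (φ₂ x)) * inner ℝ β (ψ x) ∂μ
      = secondMoment μ ψ (t h) β) :
    ∃ s, 0 ≤ s ∧ CloseMoments D S 𝓗 α θ r s (secondMoment μ ψ) t ∧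
      s ≤ 16 * (τ + d) * r ^ 2 / (c ^ 2 * S.card) ∧
      ∀ δ, IsCriticalRadius D S (θ '' {β | ‖β‖ ≤ r}) r δ →
        s ≤ 16 * τ * r ^ 2 / (c ^ 2 * S.card) ∨ c ^ 2 * s ≤ 256 * δ ^ 2 := by
  obtain ⟨e, s, l, hs, he, hl, hd, hg⟩ := hω
  have hcard : Fintype.card ι = S.card := by rw [Fintype.card_congr j, Fintype.card_coe]
  have hn : (0 : ℝ) < S.card := by
    rw [← hcard]; exact Nat.cast_pos.2 Fintype.card_pos
  have hS : S.Nonempty := Finset.card_pos.1 (by exact_mod_cast hn)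
  have hsum : ∀ F : ρ → ℝ, ∑ x ∈ S, F (D x) = ∑ i, F (D (j i)) := fun F => by
    rw [← Finset.sum_coe_sort S (fun x => F (D x)), ← Equiv.sum_comp j]
  have hl0 : 0 < l := lt_of_lt_of_le (by positivity) hl
  obtain ⟨q1, q2, q3, q4⟩ := hg
  rw [hcard] at hd q1 q2 q3 q4
  set n : ℝ := (S.card : ℝ) with hndef
  have hco := norm_coWhiten_sq e hψ hb he hs hl0
  have hV : ∀ β, ∫ x, inner ℝ β (ψ x) ^ 2 ∂μ = secondMoment μ ψ β β := fun β => by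
    simp only [secondMoment, sq]
  simp only [hV] at hco q1
  have hV0 : ∀ β, 0 ≤ secondMoment μ ψ β β := secondMoment_self_nonneg
  have hco' : ∀ β, ‖β‖ ≤ r → ‖coWhiten e s l β‖ ^ 2 ≤ secondMoment μ ψ β β + l * r ^ 2 := by
    intro β hβ
    rw [hco]
    gcongr
  refine ⟨l * r ^ 2, by positivity, ⟨fun β hβ => ?_, fun h hh β hβ => ?_⟩, ?_, fun δ hδ => ?_⟩
  · rw [empMean, hsum (fun x => θ β x ^ 2)]
    simp only [hθ]
    rw [← hndef, div_sub' hn.ne', abs_div, abs_of_pos hn, div_le_iff₀ hn]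
    refine (q1 β).trans ?_
    have h1 := hco' β hβ
    have h2 : 3 * c * n * ‖coWhiten e s l β‖ ^ 2 ≤ 1 / 8 * n * ‖coWhiten e s l β‖ ^ 2 := by
      gcongr
      linarith
    have h3 := mul_le_mul_of_nonneg_left h1 hn.le
    linarith
  · rw [empMean, hsum (fun x => α h x * θ β x)]
    simp only [hθ, hα]
    rw [← hndef, div_sub' hn.ne', abs_div, abs_of_pos hn, div_le_iff₀ hn, ← hmom]
    have i1 := integrable_inner_mul_inner (μ := μ) hφ₁ hψ hφ₁b (.of_forall hb) (a₁ h) β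
    have i2 := integrable_inner_mul_inner (μ := μ) hφ₂ hψ hφ₂b (.of_forall hb) (a₂ h) β
    simp only [add_mul]
    rw [Finset.sum_add_distrib, integral_add i1 i2]
    have h1 := abs_le.1 (q2 (a₁ h) β)
    have h2 := abs_le.1 (q3 (a₂ h) β)
    set N := ‖coWhiten e s l β‖ with hN
    have hN0 : 0 ≤ N := norm_nonneg _
    have hsl : 0 ≤ √l := Real.sqrt_nonneg _
    have h3 : 3 * c * n * √l * ‖a₁ h‖ * N + 3 * c * n * √l * ‖a₂ h‖ * N ≤
        n / 8 * (√l * r * N) := by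
      have h4 : 3 * c * (‖a₁ h‖ + ‖a₂ h‖) ≤ r / 8 := by
        have := mul_le_mul_of_nonneg_left (ha h hh) hc.le
        linarith
      have h5 : 0 ≤ n * √l * N := by positivity
      have h6 := mul_le_mul_of_nonneg_left h4 h5
      calc _ = n * √l * N * (3 * c * (‖a₁ h‖ + ‖a₂ h‖)) := by ring
        _ ≤ n * √l * N * (r / 8) := h6
        _ = _ := by ring
    have h7 : √l * r * N ≤ secondMoment μ ψ β β + l * r ^ 2 := by
      have h8 := hco' β hβ
      have h9 : (√l * r) ^ 2 = l * r ^ 2 := by rw [mul_pow, Real.sq_sqrt hl0.le]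
      have h10 := hV0 β
      nlinarith [sq_nonneg (√l * r - N)]
    have h11 := mul_le_mul_of_nonneg_left h7 (show 0 ≤ n / 8 by positivity)
    rw [abs_le]
    constructor
    · linarith [h1.1, h2.1]
    · linarith [h1.2, h2.2]
  · rw [le_div_iff₀ (by positivity)]
    -- Either `l` is the deviation level, or c²nl/8 is at most the effective dimension and so at
    -- most `d`.
    rcases hd with hd | hd
    · rw [hd]
      field_simp
      have : (0 : ℝ) ≤ d := Nat.cast_nonneg _
      nlinarith
    · have h1 := hd.trans (effDim_le hs hl0)
      have h2 := mul_le_mul_of_nonneg_right h1 (sq_nonneg r)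
      have h3 : (0 : ℝ) ≤ d * r ^ 2 := by positivity
      have h4 : 0 ≤ τ * r ^ 2 := by positivity
      nlinarith
  · by_cases hne : l = 16 * τ / (c ^ 2 * n)
    · left
      rw [hne]
      exact le_of_eq (by ring)
    · right
      have hd' := hd.resolve_left hne
      classical
      -- The features are extended by zero to indices outside the subsample; these never enter the
      -- sums over `S`.
      set x : Fin T → EuclideanSpace ℝ (Fin d) := fun y =>
        if h : y ∈ S then ψ (ω (j.symm ⟨y, h⟩)) else 0 with hx
      have hxj : ∀ i, x (j i) = ψ (ω i) := fun i => by simp [hx]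
      have hsx : ∀ F : EuclideanSpace ℝ (Fin d) → ℝ, ∑ y ∈ S, F (x y) = ∑ i, F (ψ (ω i)) := fun F => by
        rw [← Finset.sum_coe_sort S (fun y => F (x y)), ← Equiv.sum_comp j]
        simp only [hxj]
      refine level_le_of_isCriticalRadius (c := c) (e := e) D hS θ rfl x ?_ ?_ hs hl0 hc (by linarith) hr ?_ ?_
        ?_ hd' hδ
      · intro y hy β
        have := hθ (j.symm ⟨y, hy⟩) β
        simp only [Equiv.apply_symm_apply] at this
        rw [this, hx]
        simp [hy]
      · intro y
        by_cases hy : y ∈ S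
        · simpa [hx, hy] using hb _
        · simp [hx, hy]
      · intro β
        rw [hco]
        linarith [hV0 β]
      · intro β
        rw [hsx (fun v => inner ℝ β v ^ 2)]
        have h1 := (abs_le.1 (q1 β)).2
        have h2 : secondMoment μ ψ β β ≤ ‖coWhiten e s l β‖ ^ 2 := by
          rw [hco]
          have : 0 ≤ l * ‖β‖ ^ 2 := by positivity
          linarith
        have h3 := mul_le_mul_of_nonneg_left h2 hn.le
        have h4 : 3 * c * n * ‖coWhiten e s l β‖ ^ 2 ≤ 1 / 8 * n * ‖coWhiten e s l β‖ ^ 2 := by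
          gcongr
          linarith
        linarith
      · rw [hsx (fun v => ‖whiten e s l v‖ ^ 2)]
        exact q4 (by rw [hndef] at hne; exact hne)

end Accurate

/-! ### Records of complete trials. -/

namespace TwoStageDTR

variable {𝒳₁ 𝒜₁ 𝒳₂ 𝒜₂ 𝒰 : Type*} [MeasurableSpace 𝒳₁] [MeasurableSpace 𝒜₁]
  [MeasurableSpace 𝒳₂] [MeasurableSpace 𝒜₂] [MeasurableSpace 𝒰]
  (M : TwoStageDTR 𝒳₁ 𝒜₁ 𝒳₂ 𝒜₂ 𝒰)

theorem hist?_observe_of_mem {ω : DTRTrial 𝒳₁ 𝒜₁ 𝒳₂ 𝒜₂ 𝒰} (h : ω ∈ complete) :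
    (M.observe ω).hist? = some ω.1.hist := by
  have h' : ω.2 = (true, true) := h
  simp [observe, DTRRecord.hist?, h']

theorem mem_completeSet_observe {T : ℕ} {ω : Fin T → DTRTrial 𝒳₁ 𝒜₁ 𝒳₂ 𝒜₂ 𝒰} {t : Fin T} :
    t ∈ DTRRecord.completeSet (fun t => M.observe (ω t)) ↔ ω t ∈ complete := by
  simp only [DTRRecord.completeSet, Finset.mem_filter, Finset.mem_univ, true_and]
  constructor
  · intro h
    show (ω t).2 = (true, true)
    rcases e : (ω t).2 with ⟨r₁, r₂⟩
    cases r₁ <;> cases r₂ <;> simp [observe, DTRRecord.hist?, e] at h ⊢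
  · intro h
    simp [M.hist?_observe_of_mem h]

theorem onHist_observe_of_mem {ω : DTRTrial 𝒳₁ 𝒜₁ 𝒳₂ 𝒜₂ 𝒰} (h : ω ∈ complete)
    (F : DTRHist 𝒳₁ 𝒜₁ 𝒳₂ 𝒜₂ → ℝ) : (M.observe ω).onHist F = F ω.1.hist := by
  simp [DTRRecord.onHist, M.hist?_observe_of_mem h]

end TwoStageDTR

/-! ### The event on which the losses of both stages are accurate. -/

namespace DTRFeatures

variable {𝒳₁ 𝒜₁ 𝒳₂ 𝒜₂ 𝒰 : Type*} [MeasurableSpace 𝒳₁] [MeasurableSpace 𝒜₁]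
  [MeasurableSpace 𝒳₂] [MeasurableSpace 𝒜₂] [MeasurableSpace 𝒰]
  {m₁ m₂ d₁ d₂ : ℕ} {L : DTRFeatures 𝒳₁ 𝒜₁ 𝒳₂ 𝒜₂ m₁ m₂ d₁ d₂}
  {M : TwoStageDTR 𝒳₁ 𝒜₁ 𝒳₂ 𝒜₂ 𝒰}

/-- The sample determines the empirical losses of both stages up to small errors `s₁`, `s₂`. -/
def LossesClose (L : DTRFeatures 𝒳₁ 𝒜₁ 𝒳₂ 𝒜₂ m₁ m₂ d₁ d₂) (M : TwoStageDTR 𝒳₁ 𝒜₁ 𝒳₂ 𝒜₂ 𝒰)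
    (β₁ : EuclideanSpace ℝ (Fin m₁) → EuclideanSpace ℝ (Fin d₁))
    (β₂ : EuclideanSpace ℝ (Fin m₁) → EuclideanSpace ℝ (Fin m₂) → EuclideanSpace ℝ (Fin d₂))
    (c τ : ℝ) {T : ℕ} (D : Fin T → DTRRecord 𝒳₁ 𝒜₁ 𝒳₂ 𝒜₂) : Prop :=
  ∃ s₁ s₂ : ℝ, (0 ≤ s₁ ∧
    CloseMoments D Finset.univ L.weights (fun p => α₁ (L.ofWeights p)) L.dual₁ L.D₁ s₁
      (secondMoment M.obsLaw fun ω => L.ψ₁ ω.1.y₁) (fun p => β₁ p.1) ∧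
    s₁ ≤ 16 * (τ + d₁) * L.D₁ ^ 2 / (c ^ 2 * T) ∧
    ∀ δ, IsCriticalRadius D Finset.univ L.Θ₁ L.D₁ δ →
      s₁ ≤ 16 * τ * L.D₁ ^ 2 / (c ^ 2 * T) ∨ c ^ 2 * s₁ ≤ 256 * δ ^ 2) ∧
  0 ≤ s₂ ∧
    CloseMoments D (DTRRecord.completeSet D) L.weights (fun p => α₂ (L.ofWeights p)) L.dual₂
      L.D₂ s₂ (secondMoment M.completeLaw fun ω => L.ψ₂ (ω.1.hist, ω.1.y₁)) (fun p => β₂ p.1 p.2) ∧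
    s₂ ≤ 16 * (τ + d₂) * L.D₂ ^ 2 / (c ^ 2 * (DTRRecord.completeSet D).card) ∧
    ∀ δ, IsCriticalRadius D (DTRRecord.completeSet D) L.Θ₂ L.D₂ δ →
      s₂ ≤ 16 * τ * L.D₂ ^ 2 / (c ^ 2 * (DTRRecord.completeSet D).card) ∨ c ^ 2 * s₂ ≤ 256 * δ ^ 2

variable {Pol : Set (DTRPolicy 𝒳₁ 𝒜₁ 𝒳₂ 𝒜₂)} {πs : DTRPolicy 𝒳₁ 𝒜₁ 𝒳₂ 𝒜₂} {b₁ : ℝ → ℝ}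
  {w₁s w₂s β₁ β₂} {Lα c τ : ℝ}

/-- Stage one uses all trials, stage two the random subsample of complete ones, which conditionally
is an independent sample from the complete law. Each stage fails with probability at most 4 exp(-τ).
-/
theorem measure_pi_not_lossesClose_le (hL : L.Regular) (hbr : L.IsBridge M Pol πs b₁ w₁s w₂s β₁ β₂)
    (hbm : L.BoundsMoments M Lα) (hp : M.obsLaw TwoStageDTR.complete ≠ 0)
    (hLα : 0 < Lα) (hD₁ : 0 < L.D₁) (hD₂ : 0 < L.D₂) (hc : 0 < c) (hc1 : c ≤ 1 / 24)
    (hcD₁ : c * (24 * (L.C₁ + Lα)) ≤ L.D₁) (hcD₂ : c * (24 * (L.C₁ + L.C₂)) ≤ L.D₂) (hτ : 1 ≤ τ)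
    (T : ℕ) :
    Measure.pi (fun _ : Fin T => M.obsLaw)
      {ω | ¬ ((DTRRecord.completeSet fun t => M.observe (ω t)).Nonempty →
        L.LossesClose M β₁ β₂ c τ fun t => M.observe (ω t))} ≤ ENNReal.ofReal (8 * Real.exp (-τ)) := by
  have hC₁ : 0 ≤ L.C₁ := (norm_nonneg _).trans hbr.norm_fst
  have hC₂ : 0 ≤ L.C₂ := (norm_nonneg _).trans hbr.norm_snd
  have hcl : IsProbabilityMeasure M.completeLaw := cond_isProbabilityMeasure hp
  have mφ₁ := hL.measurable_φ₁
  have mφ₂ := hL.measurable_φ₂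
  have mψ₁ := hL.measurable_ψ₁
  set φ₁ : DTRTrial 𝒳₁ 𝒜₁ 𝒳₂ 𝒜₂ 𝒰 → EuclideanSpace ℝ (Fin m₁) := fun ω => L.φ₁ (M.ay ω) with hφ₁
  set φ₂ : DTRTrial 𝒳₁ 𝒜₁ 𝒳₂ 𝒜₂ 𝒰 → EuclideanSpace ℝ (Fin m₂) := fun ω => L.φ₂ ω.1.hist with hφ₂
  -- The reward becomes a one-dimensional feature Y₂/Lα with fixed weight -Lα, so that α₁ is linear
  -- in features of norm at most one.
  set φy : DTRTrial 𝒳₁ 𝒜₁ 𝒳₂ 𝒜₂ 𝒰 → EuclideanSpace ℝ (Fin 1) := fun ω =>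
    EuclideanSpace.single 0 (M.y₂ ω.1 / Lα) with hφy
  set ψ₁ : DTRTrial 𝒳₁ 𝒜₁ 𝒳₂ 𝒜₂ 𝒰 → EuclideanSpace ℝ (Fin d₁) := fun ω => L.ψ₁ ω.1.y₁ with hψ₁
  set ψ₂ : DTRTrial 𝒳₁ 𝒜₁ 𝒳₂ 𝒜₂ 𝒰 → EuclideanSpace ℝ (Fin d₂) := fun ω =>
    L.ψ₂ (ω.1.hist, ω.1.y₁) with hψ₂
  have mf₁ : Measurable φ₁ := by fun_prop
  have mf₂ : Measurable φ₂ := mφ₂.comp (by fun_prop)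
  have mfy : Measurable φy := by
    have : (φy : DTRTrial 𝒳₁ 𝒜₁ 𝒳₂ 𝒜₂ 𝒰 → _) = fun ω =>
        (M.y₂ ω.1 / Lα) • EuclideanSpace.single (0 : Fin 1) (1 : ℝ) := by
      ext ω i; simp [hφy]
    rw [this]
    fun_prop
  have mg₁ : Measurable ψ₁ := by fun_prop
  have mg₂ : Measurable ψ₂ := hL.measurable_ψ₂.comp TwoStageDTR.measurable_histIV
  have bφy : ∀ᵐ ω ∂M.obsLaw, ‖φy ω‖ ≤ 1 := by
    filter_upwards [L.ae_abs_y₂_le hbm hC₁ hC₂] with ω hω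
    rw [hφy, PiLp.norm_single, Real.norm_eq_abs, abs_div, abs_of_pos hLα, div_le_one hLα]
    exact hω
  have bφ₁ : ∀ ω, ‖φ₁ ω‖ ≤ 1 := fun ω => hL.norm_φ₁ _
  have bφ₂ : ∀ ω, ‖φ₂ ω‖ ≤ 1 := fun ω => hL.norm_φ₂ _
  have bψ₁ : ∀ ω, ‖ψ₁ ω‖ ≤ 1 := fun ω => hL.norm_ψ₁ _
  have bψ₂ : ∀ ω, ‖ψ₂ ω‖ ≤ 1 := fun ω => hL.norm_ψ₂ _
  have hexp : (0 : ℝ) ≤ 4 * Real.exp (-τ) := by positivity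
  -- the two bad events
  set E₁ : Set (Fin T → DTRTrial 𝒳₁ 𝒜₁ 𝒳₂ 𝒜₂ 𝒰) :=
    {ω | 0 < T ∧ ¬ AccurateSample M.obsLaw ψ₁ φ₁ φy c τ ω} with hE₁
  set Bad : (S : Finset (Fin T)) → Set (S → DTRTrial 𝒳₁ 𝒜₁ 𝒳₂ 𝒜₂ 𝒰) := fun S =>
    {ω | S.Nonempty ∧ ¬ AccurateSample M.completeLaw ψ₂ φ₁ φ₂ c τ ω} with hBad
  have h₁ : Measure.pi (fun _ : Fin T => M.obsLaw) E₁ ≤ ENNReal.ofReal (4 * Real.exp (-τ)) := by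
    rcases Nat.eq_zero_or_pos T with h0 | h0
    · have : E₁ = ∅ := by ext ω; simp [hE₁, h0]
      rw [this, measure_empty]
      exact zero_le
    · have : Nonempty (Fin T) := ⟨⟨0, h0⟩⟩
      exact (measure_mono fun ω h => h.2).trans (measure_pi_not_accurateSample_le mf₁
        (.of_forall bφ₁) mfy bφy mg₁ bψ₁ hc (by linarith) hτ)
  have h₂ : ∀ S : Finset (Fin T), Measure.pi (fun _ : S => M.obsLaw[|TwoStageDTR.complete]) (Bad S)
      ≤ ENNReal.ofReal (4 * Real.exp (-τ)) := by
    intro S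
    rcases S.eq_empty_or_nonempty with h0 | h0
    · have : Bad S = ∅ := by ext ω; simp [hBad, h0]
      rw [this, measure_empty]
      exact zero_le
    · have : Nonempty S := h0.to_subtype
      exact (measure_mono fun ω h => h.2).trans (measure_pi_not_accurateSample_le
        (μ := M.completeLaw) mf₁ (.of_forall bφ₁) mf₂ (.of_forall bφ₂) mg₂ bψ₂ hc (by linarith) hτ)
  have h₃ := measure_pi_selected_bad_le TwoStageDTR.measurableSet_complete hp Bad h₂
  have h8 : ENNReal.ofReal (8 * Real.exp (-τ)) = ENNReal.ofReal (4 * Real.exp (-τ))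
      + ENNReal.ofReal (4 * Real.exp (-τ)) := by
    rw [← ENNReal.ofReal_add hexp hexp]
    congr 1
    ring
  rw [h8]
  refine le_trans (measure_mono ?_) ((measure_union_le _ _).trans (add_le_add h₁ h₃))
  intro ω hω
  by_contra hnot
  rw [Set.mem_union, not_or] at hnot
  refine hω fun hne => ?_
  obtain ⟨hn1, hn2⟩ := hnot
  have hT : 0 < T := by
    obtain ⟨t, -⟩ := hne
    exact t.pos
  have : Nonempty (Fin T) := ⟨⟨0, hT⟩⟩
  have hacc₁ : AccurateSample M.obsLaw ψ₁ φ₁ φy c τ ω := by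
    by_contra h
    exact hn1 ⟨hT, h⟩
  set S := DTRRecord.completeSet (fun t => M.observe (ω t)) with hS
  have : Nonempty S := hne.to_subtype
  have hacc₂ : AccurateSample M.completeLaw ψ₂ φ₁ φ₂ c τ (fun i : S => ω i) := by
    by_contra h
    exact hn2 ⟨S, fun i => M.mem_completeSet_observe, hne, h⟩
  have hmem : ∀ i : S, ω i ∈ TwoStageDTR.complete := fun i => M.mem_completeSet_observe.1 i.2
  have e1 : ∀ (p : EuclideanSpace ℝ (Fin m₁) × EuclideanSpace ℝ (Fin m₂))
      (x : DTRTrial 𝒳₁ 𝒜₁ 𝒳₂ 𝒜₂ 𝒰), inner ℝ p.1 (φ₁ x)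
        + inner ℝ (EuclideanSpace.single (0 : Fin 1) (-Lα)) (φy x)
      = inner ℝ p.1 (L.φ₁ (M.ay x)) - M.y₂ x.1 := fun p x => by
    simp only [hφy, EuclideanSpace.inner_single_left, hφ₁]
    simp
    field_simp
    ring
  obtain ⟨s₁, a1, a2, a3, a4⟩ := hacc₁.closeMoments (D := fun t => M.observe (ω t))
    (S := Finset.univ) (𝓗 := L.weights) (α := fun p => α₁ (L.ofWeights p)) (θ := L.dual₁)
    (r := L.D₁) (R := L.C₁ + Lα) (t := fun p => β₁ p.1) (a₁ := fun p => p.1)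
    (a₂ := fun _ => EuclideanSpace.single 0 (-Lα))
    mf₁ (.of_forall bφ₁) mfy bφy mg₁ bψ₁ hc hc1 hτ
    (Equiv.subtypeUnivEquiv Finset.mem_univ).symm hD₁ hcD₁
    (fun p h => by
      rw [PiLp.norm_single, norm_neg, Real.norm_of_nonneg hLα.le]
      linarith [h.1])
    (fun i β => rfl) (fun p i => by rw [e1]; rfl)
    (fun p β => by
      simp only [e1]
      exact hbr.moment₁ p.1 β)
  obtain ⟨s₂, c1, c2, c3, c4⟩ := hacc₂.closeMoments (D := fun t => M.observe (ω t))
    (S := S) (𝓗 := L.weights) (α := fun p => α₂ (L.ofWeights p)) (θ := L.dual₂)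
    (r := L.D₂) (R := L.C₁ + L.C₂) (t := fun p => β₂ p.1 p.2) (a₁ := fun p => -p.1)
    (a₂ := fun p => p.2)
    mf₁ (.of_forall bφ₁) mf₂ (.of_forall bφ₂) mg₂ bψ₂ hc hc1 hτ (Equiv.refl _) hD₂ hcD₂
    (fun p h => by
      rw [norm_neg]
      exact add_le_add h.1 h.2)
    (fun i β => by
      simp only [dual₂, Equiv.refl_apply]
      rw [M.onHist_observe_of_mem (hmem i)]
      rfl)
    (fun p i => by
      simp only [α₂, Equiv.refl_apply]
      rw [M.onHist_observe_of_mem (hmem i), inner_neg_left, neg_add_eq_sub]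
      rfl)
    (fun p β => by
      simp only [inner_neg_left, neg_add_eq_sub]
      exact hbr.moment₂ p.1 p.2 β)
  rw [Finset.card_univ, Fintype.card_fin] at a3 a4
  refine ⟨s₁, s₂, ⟨a1, a2, a3, fun δ hδ => a4 δ ?_⟩, c1, c2, c3, fun δ hδ => c4 δ ?_⟩
  · rwa [Θ₁_eq] at hδ
  · rwa [Θ₂_eq] at hδ

end DTRFeatures

/-! ### Error levels in terms of critical radii and of the rate. -/

/-- The two alternatives for the level match the two terms in `η`: the deviation level is absorbed
by K√(log(K/ξ)/n) because K ≥ 4r/c, and the critical radius by Kδ because K ≥ 16/c. -/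
theorem le_sq_of_boundsCriticalRadius {ρ : Type*} {T : ℕ} {D : Fin T → ρ} {S : Finset (Fin T)}
    {Q Θ : Set (ρ → ℝ)} {K ξ c' r η c s : ℝ} (hK4 : 4 ≤ K) (hc : 0 < c) (hr : 0 < r)
    (hK₁ : 4 * r / c ≤ K) (hK₂ : 16 / c ≤ K) (hξ : 0 < ξ) (hξ1 : ξ < 1)
    (h : BoundsCriticalRadius K ξ D S Q Θ c' r η)
    (hs : ∀ δ, IsCriticalRadius D S Θ r δ →
      s ≤ 16 * Real.log (4 / ξ) * r ^ 2 / (c ^ 2 * S.card) ∨ c ^ 2 * s ≤ 256 * δ ^ 2) :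
    s ≤ η ^ 2 ∧ 0 < η := by
  obtain ⟨hS, δ, -, hδ, hη⟩ := h
  have hn : (0 : ℝ) < S.card := Nat.cast_pos.2 hS.card_pos
  have hδ0 := hδ.1
  have hK0 : 0 < K := by linarith
  set x := √(Real.log (K / ξ) / (S.card : ℝ)) with hx
  have hx0 : 0 ≤ x := Real.sqrt_nonneg _
  have hlog4 : 0 ≤ Real.log (4 / ξ) := Real.log_nonneg (by rw [le_div_iff₀ hξ]; linarith)
  have hlog : Real.log (4 / ξ) ≤ Real.log (K / ξ) :=
    Real.log_le_log (by positivity) (by gcongr)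
  have hx2 : x ^ 2 = Real.log (K / ξ) / S.card := Real.sq_sqrt (div_nonneg (hlog4.trans hlog) hn.le)
  have h1 : K * δ ≤ η := by nlinarith
  have h2 : K * x ≤ η := by nlinarith
  refine ⟨?_, lt_of_lt_of_le (by positivity) h1⟩
  rcases hs δ hδ with h3 | h3
  · have h4 : (K * x) ^ 2 ≤ η ^ 2 := pow_le_pow_left₀ (by positivity) h2 2
    have h5 : (4 * r / c) ^ 2 ≤ K ^ 2 := pow_le_pow_left₀ (by positivity) hK₁ 2
    calc s ≤ 16 * Real.log (4 / ξ) * r ^ 2 / (c ^ 2 * S.card) := h3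
      _ = (4 * r / c) ^ 2 * (Real.log (4 / ξ) / S.card) := by field_simp; ring
      _ ≤ K ^ 2 * (Real.log (K / ξ) / S.card) := by gcongr
      _ = (K * x) ^ 2 := by rw [mul_pow, hx2]
      _ ≤ η ^ 2 := h4
  · have h4 : (16 / c * δ) ^ 2 ≤ η ^ 2 := by
      refine pow_le_pow_left₀ (by positivity) (le_trans ?_ h1) 2
      gcongr
    have h5 : (16 / c * δ) ^ 2 = 256 * δ ^ 2 / c ^ 2 := by field_simp; ring
    rw [h5] at h4
    refine le_trans ?_ h4
    rw [le_div_iff₀ (by positivity)]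
    linarith

/-- As log n ≥ 1/2 and log(4/ξ) ≤ 2 + log(1/ξ), each numerator τ + d is at most 4 · rate · n. Stage
one has the larger sample, so its denominator may be lowered to `n`. -/
theorem add_le_mul_rate {m₁ m₂ d₁ d₂ T n : ℕ} {D₁ D₂ c K ξ rate s₁ s₂ : ℝ} (hn : 2 ≤ n) (hnT : n ≤ T)
    (hc : 0 < c) (hξ : 0 < ξ) (hξ1 : ξ < 1) (hK : 64 * (D₁ ^ 2 + D₂ ^ 2) / c ^ 2 ≤ K)
    (hrate : rate = ((m₁ + m₂ + d₁ + d₂ + 1) * Real.log n + Real.log (1 / ξ)) / n)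
    (h₁ : s₁ ≤ 16 * (Real.log (4 / ξ) + d₁) * D₁ ^ 2 / (c ^ 2 * T))
    (h₂ : s₂ ≤ 16 * (Real.log (4 / ξ) + d₂) * D₂ ^ 2 / (c ^ 2 * n)) :
    s₁ + s₂ ≤ K * rate ∧ 0 < rate := by
  have hn2 : (2 : ℝ) ≤ n := by exact_mod_cast hn
  have hn0 : (0 : ℝ) < n := by linarith
  have hnT' : (n : ℝ) ≤ T := by exact_mod_cast hnT
  have hlogn : 1 / 2 ≤ Real.log n := by
    have := Real.log_le_log (by norm_num) hn2
    linarith [Real.log_two_gt_d9]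
  have hlogξ : 0 ≤ Real.log (1 / ξ) := Real.log_nonneg (by rw [le_div_iff₀ hξ]; linarith)
  have hlog4 : Real.log (4 / ξ) ≤ 2 + Real.log (1 / ξ) := by
    have e : (4 : ℝ) / ξ = 2 ^ 2 * (1 / ξ) := by ring
    rw [e, Real.log_mul (by norm_num) (by positivity), Real.log_pow]
    push_cast
    linarith [Real.log_two_lt_d9]
  have hm : (0 : ℝ) ≤ m₁ + m₂ := by positivity
  have hd₁ : (0 : ℝ) ≤ d₁ := by positivity
  have hd₂ : (0 : ℝ) ≤ d₂ := by positivity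
  have hrn : (d₁ + d₂ + 1) / 2 + Real.log (1 / ξ) ≤ rate * n := by
    rw [hrate, div_mul_cancel₀ _ hn0.ne']
    nlinarith
  have hlog40 : 0 ≤ Real.log (4 / ξ) := Real.log_nonneg (by rw [le_div_iff₀ hξ]; linarith)
  set τ := Real.log (4 / ξ) with hτ
  have hrate0 : 0 < rate := by
    have : 0 < rate * n := by linarith
    exact pos_of_mul_pos_left this hn0.le
  refine ⟨?_, hrate0⟩
  have h₁' : s₁ ≤ 16 * (4 * (rate * n)) * D₁ ^ 2 / (c ^ 2 * n) := by
    refine h₁.trans ?_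
    gcongr
    linarith
  have h₂' : s₂ ≤ 16 * (4 * (rate * n)) * D₂ ^ 2 / (c ^ 2 * n) := by
    refine h₂.trans ?_
    gcongr
    linarith
  calc s₁ + s₂ ≤ 16 * (4 * (rate * n)) * D₁ ^ 2 / (c ^ 2 * n)
        + 16 * (4 * (rate * n)) * D₂ ^ 2 / (c ^ 2 * n) := add_le_add h₁' h₂'
    _ = 64 * (D₁ ^ 2 + D₂ ^ 2) / c ^ 2 * rate := by field_simp; ring
    _ ≤ K * rate := by gcongr

namespace DTRFeatures

variable {𝒳₁ 𝒜₁ 𝒳₂ 𝒜₂ 𝒰 : Type*} [MeasurableSpace 𝒳₁] [MeasurableSpace 𝒜₁]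
  [MeasurableSpace 𝒳₂] [MeasurableSpace 𝒜₂] [MeasurableSpace 𝒰]
  {m₁ m₂ d₁ d₂ : ℕ} {L : DTRFeatures 𝒳₁ 𝒜₁ 𝒳₂ 𝒜₂ m₁ m₂ d₁ d₂}
  {M : TwoStageDTR 𝒳₁ 𝒜₁ 𝒳₂ 𝒜₂ 𝒰} [IsProbabilityMeasure M.completeLaw]
  {Pol : Set (DTRPolicy 𝒳₁ 𝒜₁ 𝒳₂ 𝒜₂)} {πs πhat : DTRPolicy 𝒳₁ 𝒜₁ 𝒳₂ 𝒜₂} {b₁ : ℝ → ℝ}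
  {w₁s w₂s β₁ β₂} {c ξ K : ℝ} {T : ℕ} {D : Fin T → DTRRecord 𝒳₁ 𝒜₁ 𝒳₂ 𝒜₂}

theorem subOpt_le_of_boundsCriticalRadius (hL : L.Regular)
    (hbr : L.IsBridge M Pol πs b₁ w₁s w₂s β₁ β₂) (hπs : πs ∈ Pol)
    (hD : L.LossesClose M β₁ β₂ c (Real.log (4 / ξ)) D)
    (hc : 0 < c) (hξ : 0 < ξ) (hξ1 : ξ < 1) (hK4 : 4 ≤ K) (hD₁ : 0 < L.D₁) (hD₂ : 0 < L.D₂)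
    (hK₁ : 4 * L.D₁ / c ≤ K) (hK₂ : 4 * L.D₂ / c ≤ K) (hK₃ : 16 / c ≤ K) {Lα η₁ η₂ e c₁ c₂ : ℝ}
    (hη₁ : BoundsCriticalRadius K ξ D Finset.univ L.Q₁ L.Θ₁ c₁ L.D₁ η₁)
    (hη₂ : BoundsCriticalRadius K ξ D (DTRRecord.completeSet D) L.Q₂ L.Θ₂ c₂ L.D₂ η₂)
    (he : (2 * Lα ^ 2 + 5 / 4) * (η₁ ^ 2 + η₂ ^ 2) < e) (hcap : L.IsCAP M Pol D e πhat) :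
    ENNReal.ofReal (M.value πs - M.value πhat) ≤
      ENNReal.ofReal (3 * (√e + √(η₁ ^ 2 + η₂ ^ 2))) * M.shiftNorm b₁ := by
  obtain ⟨s₁, s₂, ⟨a1, a2, -, a4⟩, c1, c2, -, c4⟩ := hD
  obtain ⟨g1, g2⟩ := le_sq_of_boundsCriticalRadius hK4 hc hD₁ hK₁ hK₃ hξ hξ1 hη₁
    (by simpa using a4)
  obtain ⟨g3, g4⟩ := le_sq_of_boundsCriticalRadius hK4 hc hD₂ hK₂ hK₃ hξ hξ1 hη₂ c4
  have hη : 0 < η₁ ^ 2 + η₂ ^ 2 := by positivity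
  -- The factor in the threshold is at least one, which suffices for the levels s₁ ≤ η₁² and s₂ ≤
  -- η₂² to add up to at most e.
  have he' : η₁ ^ 2 + η₂ ^ 2 ≤ e := by nlinarith [mul_nonneg (sq_nonneg Lα) hη.le]
  refine (subOpt_le hL hbr hπs (hη.trans_le he') (by linarith) a2 c2 hcap a1 c1).trans ?_
  gcongr
  linarith [Real.sqrt_nonneg (η₁ ^ 2 + η₂ ^ 2)]

theorem subOpt_le_rate (hL : L.Regular)
    (hbr : L.IsBridge M Pol πs b₁ w₁s w₂s β₁ β₂) (hπs : πs ∈ Pol)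
    (hD : L.LossesClose M β₁ β₂ c (Real.log (4 / ξ)) D)
    (hc : 0 < c) (hξ : 0 < ξ) (hξ1 : ξ < 1) (hK9 : 9 ≤ K)
    (hK : 64 * (L.D₁ ^ 2 + L.D₂ ^ 2) / c ^ 2 ≤ K) {rate : ℝ}
    (hn : 2 ≤ (DTRRecord.completeSet D).card)
    (hrate : rate = ((m₁ + m₂ + d₁ + d₂ + 1) * Real.log (DTRRecord.completeSet D).card
      + Real.log (1 / ξ)) / (DTRRecord.completeSet D).card)
    (hcap : L.IsCAP M Pol D (K * rate) πhat) :
    ENNReal.ofReal (M.value πs - M.value πhat) ≤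
      ENNReal.ofReal (K * √rate) * M.shiftNorm b₁ := by
  obtain ⟨s₁, s₂, ⟨a1, a2, a3, -⟩, c1, c2, c3, -⟩ := hD
  have hnT : (DTRRecord.completeSet D).card ≤ T := by
    simpa using Finset.card_le_univ (DTRRecord.completeSet D)
  obtain ⟨g1, g2⟩ := add_le_mul_rate hn hnT hc hξ hξ1 hK hrate a3 c3
  have hK0 : 0 < K := by linarith
  refine (subOpt_le hL hbr hπs (by positivity) g1 a2 c2 hcap a1 c1).trans ?_
  refine mul_le_mul_left (ENNReal.ofReal_le_ofReal ?_) _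
  rw [Real.sqrt_mul hK0.le, ← mul_assoc]
  refine mul_le_mul_of_nonneg_right ?_ (Real.sqrt_nonneg _)
  -- K ≥ 9 absorbs the factor 3: 3√(K · rate) ≤ K√rate.
  have h1 : 3 ≤ √K := Real.le_sqrt_of_sq_le (by linarith)
  nlinarith [Real.sq_sqrt hK0.le]

end DTRFeatures

/-! ### Order of the critical radii -/

theorem abs_inner_le_of_norm_le_one {E : Type*} [NormedAddCommGroup E] [InnerProductSpace ℝ E]
    (w : E) {x : E} (hx : ‖x‖ ≤ 1) : |inner ℝ w x| ≤ ‖w‖ :=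
  (abs_real_inner_le_norm _ _).trans (mul_le_of_le_one_right (norm_nonneg _) hx)

theorem norm_toLp_le_of_abs_le {κ : Type*} [Fintype κ] {v : EuclideanSpace ℝ κ} {h : ℝ}
    (hv : ∀ i, |v i| ≤ h) : ‖v‖ ≤ h * Fintype.card κ := by
  have h1 : ‖v‖ ≤ ∑ i, |v i| := by
    rw [EuclideanSpace.norm_eq]
    refine Real.sqrt_le_iff.2 ⟨Finset.sum_nonneg fun i _ => abs_nonneg _, ?_⟩
    simpa using Finset.sum_sq_le_sq_sum_of_nonneg (s := Finset.univ) (f := fun i => |v i|)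
      fun i _ => abs_nonneg _
  calc ‖v‖ ≤ ∑ i, |v i| := h1
    _ ≤ ∑ _i : κ, h := Finset.sum_le_sum fun i _ => hv i
    _ = h * Fintype.card κ := by rw [Finset.sum_const, Finset.card_univ, nsmul_eq_mul, mul_comm]

/-- On every record of the sample the class is the product of an affine function of (w₁, w₂) and a
linear function of β, hence Lipschitz in the joint parameter. All four classes of part (b) are
instances, with index types of size zero for absent parameters. -/
theorem isCriticalRadius_bilinear {ρ κ₁ κ₂ κ₃ : Type*} [Fintype κ₁] [Fintype κ₂] [Fintype κ₃] {T : ℕ}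
    (D : Fin T → ρ) (S : Finset (Fin T)) (hS : 2 ≤ S.card) {r₁ r₂ r₃ Y c K A : ℝ} (h₁ : 0 ≤ r₁)
    (h₂ : 0 ≤ r₂) (h₃ : 0 ≤ r₃) (hY : 0 ≤ Y) (hc : 0 < c)
    (hK : critConst (r₁ + r₂ + r₃) ((r₁ + r₂ + Y + 1) * (r₃ + 1)) c ≤ K)
    (hA : Fintype.card κ₁ + Fintype.card κ₂ + Fintype.card κ₃ + 1 ≤ A)
    (α : EuclideanSpace ℝ κ₁ → EuclideanSpace ℝ κ₂ → ρ → ℝ) (θ : EuclideanSpace ℝ κ₃ → ρ → ℝ)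
    (hαθ : ∀ t ∈ S, (∃ (x₁ : EuclideanSpace ℝ κ₁) (x₂ : EuclideanSpace ℝ κ₂) (y : ℝ),
      ‖x₁‖ ≤ 1 ∧ ‖x₂‖ ≤ 1 ∧ |y| ≤ Y ∧
        ∀ w₁ w₂, α w₁ w₂ (D t) = inner ℝ w₁ x₁ + inner ℝ w₂ x₂ + y) ∧
      ∃ z : EuclideanSpace ℝ κ₃, ‖z‖ ≤ 1 ∧ ∀ β, θ β (D t) = inner ℝ β z)
    {F : Set (ρ → ℝ)} (hF : ∀ f ∈ F, ∃ w₁ w₂ β, ‖w₁‖ ≤ r₁ ∧ ‖w₂‖ ≤ r₂ ∧ ‖β‖ ≤ r₃ ∧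
      f = fun r => α w₁ w₂ r * θ β r) :
    IsCriticalRadius D S F c (K * √(A * Real.log S.card / S.card)) := by
  -- the parameters
  set u₁ : (κ₁ ⊕ (κ₂ ⊕ κ₃) → ℝ) → EuclideanSpace ℝ κ₁ := fun p =>
    WithLp.toLp 2 fun i => p (.inl i) with hu₁
  set u₂ : (κ₁ ⊕ (κ₂ ⊕ κ₃) → ℝ) → EuclideanSpace ℝ κ₂ := fun p =>
    WithLp.toLp 2 fun i => p (.inr (.inl i)) with hu₂
  set u₃ : (κ₁ ⊕ (κ₂ ⊕ κ₃) → ℝ) → EuclideanSpace ℝ κ₃ := fun p =>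
    WithLp.toLp 2 fun i => p (.inr (.inr i)) with hu₃
  have hΛ : 0 ≤ (r₁ + r₂ + Y + 1) * (r₃ + 1) := by positivity
  refine isCriticalRadius_of_lipschitz (R := r₁ + r₂ + r₃) (by positivity) hΛ hc hK D S hS
    (ι := κ₁ ⊕ (κ₂ ⊕ κ₃)) (A := A) (by simp only [Fintype.card_sum]; push_cast; linarith)
    {p | ‖u₁ p‖ ≤ r₁ ∧ ‖u₂ p‖ ≤ r₂ ∧ ‖u₃ p‖ ≤ r₃}
    (fun p r => α (u₁ p) (u₂ p) r * θ (u₃ p) r) ?_ ?_ ?_ ?_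
  · intro f hf
    obtain ⟨w₁, w₂, β, a1, a2, a3, rfl⟩ := hF f hf
    exact ⟨Sum.elim w₁ (Sum.elim w₂ β), ⟨a1, a2, a3⟩, rfl⟩
  · rintro p ⟨a1, a2, a3⟩ (i | i | i)
    · have := (PiLp.norm_apply_le (u₁ p) i).trans a1
      rw [Real.norm_eq_abs] at this
      exact this.trans (by linarith)
    · have := (PiLp.norm_apply_le (u₂ p) i).trans a2
      rw [Real.norm_eq_abs] at this
      exact this.trans (by linarith)
    · have := (PiLp.norm_apply_le (u₃ p) i).trans a3
      rw [Real.norm_eq_abs] at this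
      exact this.trans (by linarith)
  · rintro p ⟨a1, a2, a3⟩ t ht
    obtain ⟨⟨x₁, x₂, y, b1, b2, b3, hα⟩, z, b4, hθ⟩ := hαθ t ht
    simp only [hα, hθ]
    rw [abs_mul]
    have c1 := abs_inner_le_of_norm_le_one (u₁ p) b1
    have c2 := abs_inner_le_of_norm_le_one (u₂ p) b2
    have c3 := abs_inner_le_of_norm_le_one (u₃ p) b4
    refine mul_le_mul ?_ (by linarith) (abs_nonneg _) (by positivity)
    refine (abs_add_three _ _ _).trans (by linarith)
  · rintro p ⟨a1, a2, a3⟩ p' h hh hN hpp t ht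
    obtain ⟨⟨x₁, x₂, y, b1, b2, b3, hα⟩, z, b4, hθ⟩ := hαθ t ht
    simp only [hα, hθ]
    set N : ℝ := h * Fintype.card (κ₁ ⊕ (κ₂ ⊕ κ₃)) with hNdef
    have hcard : (Fintype.card (κ₁ ⊕ (κ₂ ⊕ κ₃)) : ℝ)
        = Fintype.card κ₁ + (Fintype.card κ₂ + Fintype.card κ₃) := by
      simp only [Fintype.card_sum]; push_cast; ring
    rw [hcard] at hNdef
    have k1 : 0 ≤ h * (Fintype.card κ₁ : ℝ) := by positivity
    have k2 : 0 ≤ h * (Fintype.card κ₂ : ℝ) := by positivity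
    have k3 : 0 ≤ h * (Fintype.card κ₃ : ℝ) := by positivity
    have d1 : ‖u₁ p - u₁ p'‖ ≤ h * Fintype.card κ₁ := norm_toLp_le_of_abs_le fun i => hpp _
    have d2 : ‖u₂ p - u₂ p'‖ ≤ h * Fintype.card κ₂ := norm_toLp_le_of_abs_le fun i => hpp _
    have d3 : ‖u₃ p - u₃ p'‖ ≤ h * Fintype.card κ₃ := norm_toLp_le_of_abs_le fun i => hpp _
    have c1 := abs_inner_le_of_norm_le_one (u₁ p - u₁ p') b1
    have c2 := abs_inner_le_of_norm_le_one (u₂ p - u₂ p') b2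
    have c3 := abs_inner_le_of_norm_le_one (u₃ p - u₃ p') b4
    have c4 := abs_inner_le_of_norm_le_one (u₃ p) b4
    have c5 := abs_inner_le_of_norm_le_one (u₁ p) b1
    have c6 := abs_inner_le_of_norm_le_one (u₂ p) b2
    rw [inner_sub_left] at c1 c2 c3
    have hN0 : 0 ≤ N := by rw [hNdef]; linarith
    set a := inner ℝ (u₁ p) x₁ + inner ℝ (u₂ p) x₂ + y with ha
    set a' := inner ℝ (u₁ p') x₁ + inner ℝ (u₂ p') x₂ + y with ha'
    set b := inner ℝ (u₃ p) z with hb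
    set b' := inner ℝ (u₃ p') z with hb'
    have g1 : |a - a'| ≤ N := by
      have e : a - a' = (inner ℝ (u₁ p) x₁ - inner ℝ (u₁ p') x₁)
        + (inner ℝ (u₂ p) x₂ - inner ℝ (u₂ p') x₂) := by rw [ha, ha']; ring
      rw [e]
      refine (abs_add_le _ _).trans ?_
      rw [hNdef]
      linarith
    have g2 : |a| ≤ r₁ + r₂ + Y := (abs_add_three _ _ _).trans (by linarith)
    -- The rounded parameter may leave the class, but moves the affine factor by at most one; this
    -- is the extra 1 in the Lipschitz constant.
    have g3 : |a'| ≤ r₁ + r₂ + Y + 1 := by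
      have e : a' = a - (a - a') := by ring
      rw [e]
      exact (abs_sub _ _).trans (by linarith)
    have g4 : |b - b'| ≤ N := c3.trans (by rw [hNdef]; linarith)
    have g5 : |b| ≤ r₃ := c4.trans a3
    have e : a * b - a' * b' = (a - a') * b + a' * (b - b') := by ring
    rw [e]
    refine (abs_add_le _ _).trans ?_
    rw [abs_mul, abs_mul]
    have l1 := mul_le_mul g1 g5 (abs_nonneg _) hN0
    have l2 := mul_le_mul g3 g4 (abs_nonneg _) (by positivity)
    have l3 : 0 ≤ N * r₃ * (r₁ + r₂ + Y) := by positivity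
    nlinarith

namespace DTRFeatures

variable {𝒳₁ 𝒜₁ 𝒳₂ 𝒜₂ 𝒰 : Type*} [MeasurableSpace 𝒳₁] [MeasurableSpace 𝒜₁]
  [MeasurableSpace 𝒳₂] [MeasurableSpace 𝒜₂] [MeasurableSpace 𝒰]
  {m₁ m₂ d₁ d₂ : ℕ} {L : DTRFeatures 𝒳₁ 𝒜₁ 𝒳₂ 𝒜₂ m₁ m₂ d₁ d₂}
  {M : TwoStageDTR 𝒳₁ 𝒜₁ 𝒳₂ 𝒜₂ 𝒰} {T : ℕ}

/-- The affine part is -Y₂, bounded by `Lα`; `g` does not enter the first moment, hence the empty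
second parameter. -/
theorem isCriticalRadius_Q₁ (hL : L.Regular) {ω : Fin T → DTRTrial 𝒳₁ 𝒜₁ 𝒳₂ 𝒜₂ 𝒰} {Lα K c : ℝ}
    (hy : ∀ t, |M.y₂ (ω t).1| ≤ Lα) (hT : 2 ≤ T) (hC₁ : 0 ≤ L.C₁) (hD₁ : 0 ≤ L.D₁) (hLα : 0 ≤ Lα)
    (hc : 0 < c) (hK : critConst (L.C₁ + 0 + L.D₁) ((L.C₁ + 0 + Lα + 1) * (L.D₁ + 1)) c ≤ K) :
    IsCriticalRadius (fun t => M.observe (ω t)) Finset.univ L.Q₁ c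
      (K * √((m₁ + d₁ + 1) * Real.log T / T)) := by
  have h := isCriticalRadius_bilinear (κ₁ := Fin m₁) (κ₂ := Fin 0) (κ₃ := Fin d₁)
    (fun t => M.observe (ω t)) Finset.univ (by simpa using hT) hC₁ le_rfl hD₁ hLα hc hK
    (A := m₁ + d₁ + 1) (by simp)
    (fun w₁ _ r => α₁ (L.ofWeights (w₁, 0)) r) L.dual₁
    (fun t _ => ⟨⟨L.φ₁ (M.ay (ω t)), 0, -M.y₂ (ω t).1, hL.norm_φ₁ _, by simp, by simpa using hy t,
      fun w₁ w₂ => by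
        rw [inner_zero_right, add_zero, ← sub_eq_add_neg]; rfl⟩,
      ⟨L.ψ₁ (ω t).1.y₁, hL.norm_ψ₁ _, fun β => rfl⟩⟩)
    (F := L.Q₁) (by
      rintro _ ⟨h, hh, θ, hθ, rfl⟩
      rw [← image_weights] at hh
      rw [Θ₁_eq] at hθ
      obtain ⟨p, hp, rfl⟩ := hh
      obtain ⟨β, hβ, rfl⟩ := hθ
      exact ⟨p.1, 0, β, hp.1, by simp, hβ, rfl⟩)
  simpa using h

/-- The affine factor is the constant 1, with no weights at all. -/
theorem isCriticalRadius_Θ₁ (hL : L.Regular) {ω : Fin T → DTRTrial 𝒳₁ 𝒜₁ 𝒳₂ 𝒜₂ 𝒰} {K c : ℝ}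
    (hT : 2 ≤ T) (hD₁ : 0 ≤ L.D₁)
    (hc : 0 < c) (hK : critConst (0 + 0 + L.D₁) ((0 + 0 + 1 + 1) * (L.D₁ + 1)) c ≤ K) :
    IsCriticalRadius (fun t => M.observe (ω t)) Finset.univ L.Θ₁ c
      (K * √((m₁ + d₁ + 1) * Real.log T / T)) := by
  have h := isCriticalRadius_bilinear (κ₁ := Fin 0) (κ₂ := Fin 0) (κ₃ := Fin d₁)
    (fun t => M.observe (ω t)) Finset.univ (by simpa using hT) le_rfl le_rfl hD₁ zero_le_one hc hK
    (A := m₁ + d₁ + 1) (by simp)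
    (fun _ _ _ => 1) L.dual₁
    (fun t _ => ⟨⟨0, 0, 1, by simp, by simp, by simp, fun w₁ w₂ => by simp⟩,
      ⟨L.ψ₁ (ω t).1.y₁, hL.norm_ψ₁ _, fun β => rfl⟩⟩)
    (F := L.Θ₁) (by
      intro θ hθ
      rw [Θ₁_eq] at hθ
      obtain ⟨β, hβ, rfl⟩ := hθ
      exact ⟨0, 0, β, by simp, by simp, hβ, by simp⟩)
  simpa using h

theorem isCriticalRadius_Q₂ (hL : L.Regular) {ω : Fin T → DTRTrial 𝒳₁ 𝒜₁ 𝒳₂ 𝒜₂ 𝒰} {K c : ℝ}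
    (hn : 2 ≤ (DTRRecord.completeSet fun t => M.observe (ω t)).card) (hC₁ : 0 ≤ L.C₁)
    (hC₂ : 0 ≤ L.C₂) (hD₂ : 0 ≤ L.D₂) (hc : 0 < c)
    (hK : critConst (L.C₁ + L.C₂ + L.D₂) ((L.C₁ + L.C₂ + 0 + 1) * (L.D₂ + 1)) c ≤ K) :
    IsCriticalRadius (fun t => M.observe (ω t)) (DTRRecord.completeSet fun t => M.observe (ω t))
      L.Q₂ c (K * √((m₁ + m₂ + d₂ + 1) *
        Real.log (DTRRecord.completeSet fun t => M.observe (ω t)).card /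
          (DTRRecord.completeSet fun t => M.observe (ω t)).card)) := by
  refine isCriticalRadius_bilinear (κ₁ := Fin m₁) (κ₂ := Fin m₂) (κ₃ := Fin d₂)
    (fun t => M.observe (ω t)) _ hn hC₁ hC₂ hD₂ le_rfl hc hK (by simp)
    (fun w₁ w₂ r => α₂ (L.ofWeights (w₁, w₂)) r) L.dual₂ (fun t ht => ?_) (F := L.Q₂) ?_
  · have hm := M.mem_completeSet_observe.1 ht
    refine ⟨⟨-L.φ₁ (M.ay (ω t)), L.φ₂ (ω t).1.hist, 0, by simpa using hL.norm_φ₁ _, hL.norm_φ₂ _,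
      by simp, fun w₁ w₂ => ?_⟩, ⟨L.ψ₂ ((ω t).1.hist, (ω t).1.y₁), hL.norm_ψ₂ _, fun β => ?_⟩⟩
    · simp only [α₂]
      rw [M.onHist_observe_of_mem hm, inner_neg_right, add_zero, neg_add_eq_sub]
      rfl
    · simp only [dual₂]
      rw [M.onHist_observe_of_mem hm]
      rfl
  · rintro _ ⟨h, hh, θ, hθ, rfl⟩
    rw [← image_weights] at hh
    rw [Θ₂_eq] at hθ
    obtain ⟨p, hp, rfl⟩ := hh
    obtain ⟨β, hβ, rfl⟩ := hθ
    exact ⟨p.1, p.2, β, hp.1, hp.2, hβ, rfl⟩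

theorem isCriticalRadius_Θ₂ (hL : L.Regular) {ω : Fin T → DTRTrial 𝒳₁ 𝒜₁ 𝒳₂ 𝒜₂ 𝒰} {K c : ℝ}
    (hn : 2 ≤ (DTRRecord.completeSet fun t => M.observe (ω t)).card) (hD₂ : 0 ≤ L.D₂) (hc : 0 < c)
    (hK : critConst (0 + 0 + L.D₂) ((0 + 0 + 1 + 1) * (L.D₂ + 1)) c ≤ K) :
    IsCriticalRadius (fun t => M.observe (ω t)) (DTRRecord.completeSet fun t => M.observe (ω t))
      L.Θ₂ c (K * √((m₁ + m₂ + d₂ + 1) *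
        Real.log (DTRRecord.completeSet fun t => M.observe (ω t)).card /
          (DTRRecord.completeSet fun t => M.observe (ω t)).card)) := by
  refine isCriticalRadius_bilinear (κ₁ := Fin 0) (κ₂ := Fin 0) (κ₃ := Fin d₂)
    (fun t => M.observe (ω t)) _ hn le_rfl le_rfl hD₂ zero_le_one hc hK
    (by simp; positivity) (fun _ _ _ => 1) L.dual₂ (fun t ht => ?_) (F := L.Θ₂) ?_
  · have hm := M.mem_completeSet_observe.1 ht
    refine ⟨⟨0, 0, 1, by simp, by simp, by simp, fun w₁ w₂ => by simp⟩,
      ⟨L.ψ₂ ((ω t).1.hist, (ω t).1.y₁), hL.norm_ψ₂ _, fun β => ?_⟩⟩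
    simp only [dual₂]
    rw [M.onHist_observe_of_mem hm]
    rfl
  · intro θ hθ
    rw [Θ₂_eq] at hθ
    obtain ⟨β, hβ, rfl⟩ := hθ
    exact ⟨0, 0, β, by simp, by simp, hβ, by simp⟩

end DTRFeatures

/-- A constant exceeding every requirement of the proof. -/
def capConst (C₁ C₂ D₁ D₂ Lα c : ℝ) : ℝ :=
  9 + |4 * D₁ / c| + |4 * D₂ / c| + |16 / c| + |64 * (D₁ ^ 2 + D₂ ^ 2) / c ^ 2|
    + |critConst (C₁ + 0 + D₁) ((C₁ + 0 + Lα + 1) * (D₁ + 1)) (Lα * D₁)|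
    + |critConst (0 + 0 + D₁) ((0 + 0 + 1 + 1) * (D₁ + 1)) D₁|
    + |critConst (C₁ + C₂ + D₂) ((C₁ + C₂ + 0 + 1) * (D₂ + 1)) (Lα * D₂)|
    + |critConst (0 + 0 + D₂) ((0 + 0 + 1 + 1) * (D₂ + 1)) D₂|

end

/-! ### Choice of the constants and the three conclusions. -/

theorem mainTheorem8 :
    ∃ C : ℝ, 0 < C ∧
    ∀ C₁ C₂ D₁ D₂ Lα : ℝ, 0 < Lα →
    ∃ K : ℝ, 1 ≤ K ∧
    ∀ (𝒳₁ 𝒜₁ 𝒳₂ 𝒜₂ 𝒰 : Type*) [MeasurableSpace 𝒳₁] [MeasurableSpace 𝒜₁]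
      [MeasurableSpace 𝒳₂] [MeasurableSpace 𝒜₂] [MeasurableSpace 𝒰]
      [StandardBorelSpace 𝒳₂] [StandardBorelSpace 𝒰] [Nonempty 𝒰]
      (M : TwoStageDTR 𝒳₁ 𝒜₁ 𝒳₂ 𝒜₂ 𝒰)
      (m₁ m₂ d₁ d₂ : ℕ) (L : DTRFeatures 𝒳₁ 𝒜₁ 𝒳₂ 𝒜₂ m₁ m₂ d₁ d₂)
      (Pol : Set (DTRPolicy 𝒳₁ 𝒜₁ 𝒳₂ 𝒜₂)) (πs : DTRPolicy 𝒳₁ 𝒜₁ 𝒳₂ 𝒜₂)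
      (b₁ : ℝ → ℝ) (T : ℕ) (ξ : ℝ),
    -- radii of the linear classes, regularity
    L.C₁ = C₁ → L.C₂ = C₂ → L.D₁ = D₁ → L.D₂ = D₂ →
    L.Regular → L.BoundsMoments M Lα →
    Integrable (fun ω => ω.1.eps) M.obsLaw →
    (∀ π ∈ Pol, Integrable M.y₂ (M.intLaw π)) →
    -- the first-stage reward is a complete instrument
    M.IVComplete →
    -- linear bridge functions and linear conditional moments
    L.LinearBridge M Pol → L.LinearMoments M →
    -- optimal policy and shift functions
    πs ∈ Pol → (∀ π ∈ Pol, M.value π ≤ M.value πs) →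
    Measurable b₁ → M.IsShift πs b₁ →
    M.obsLaw.map (fun ω => (ω.1.hist, ω.1.y₁)) ≪
      M.completeLaw.map (fun ω => (ω.1.hist, ω.1.y₁)) →
    0 < ξ → ξ < 1 →
    -- sub-optimality bound, with probability at least `1 - 4ξ`
    (Measure.pi (fun _ : Fin T => M.obsLaw)
        {ω | ¬ ∀ (η₁ η₂ e : ℝ) (πhat : DTRPolicy 𝒳₁ 𝒜₁ 𝒳₂ 𝒜₂),
          BoundsCriticalRadius K ξ (fun t => M.observe (ω t)) Finset.univ
            L.Q₁ L.Θ₁ (Lα * D₁) D₁ η₁ →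
          BoundsCriticalRadius K ξ (fun t => M.observe (ω t))
            (DTRRecord.completeSet fun t => M.observe (ω t)) L.Q₂ L.Θ₂ (Lα * D₂) D₂ η₂ →
          (2 * Lα ^ 2 + 5 / 4) * (η₁ ^ 2 + η₂ ^ 2) < e →
          L.IsCAP M Pol (fun t => M.observe (ω t)) e πhat →
          ENNReal.ofReal (M.value πs - M.value πhat) ≤
            ENNReal.ofReal (C * (√e + √(η₁ ^ 2 + η₂ ^ 2))) * M.shiftNorm b₁}
      ≤ ENNReal.ofReal (4 * ξ)) ∧
    -- order of the critical radii
    (∀ᵐ ω ∂(Measure.pi (fun _ : Fin T => M.obsLaw)),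
      ∀ n : ℕ, n = (DTRRecord.completeSet fun t => M.observe (ω t)).card →
      ∀ δ₁ δ₂ : ℝ, δ₁ = K * √((m₁ + d₁ + 1) * Real.log T / T) →
        δ₂ = K * √((m₁ + m₂ + d₂ + 1) * Real.log n / n) →
      (2 ≤ T →
        IsCriticalRadius (fun t => M.observe (ω t)) Finset.univ L.Q₁ (Lα * D₁) δ₁ ∧
        IsCriticalRadius (fun t => M.observe (ω t)) Finset.univ L.Θ₁ D₁ δ₁) ∧
      (2 ≤ n →
        IsCriticalRadius (fun t => M.observe (ω t))
          (DTRRecord.completeSet fun t => M.observe (ω t)) L.Q₂ (Lα * D₂) δ₂ ∧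
        IsCriticalRadius (fun t => M.observe (ω t))
          (DTRRecord.completeSet fun t => M.observe (ω t)) L.Θ₂ D₂ δ₂)) ∧
    -- resulting rate in the number `n` of complete records, with probability at least `1 - 4ξ`
    (Measure.pi (fun _ : Fin T => M.obsLaw)
        {ω | ¬ ∀ (n : ℕ) (rate : ℝ) (πhat : DTRPolicy 𝒳₁ 𝒜₁ 𝒳₂ 𝒜₂),
          n = (DTRRecord.completeSet fun t => M.observe (ω t)).card → 2 ≤ n →
          rate = ((m₁ + m₂ + d₁ + d₂ + 1) * Real.log n + Real.log (1 / ξ)) / n →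
          L.IsCAP M Pol (fun t => M.observe (ω t)) (K * rate) πhat →
          ENNReal.ofReal (M.value πs - M.value πhat) ≤
            ENNReal.ofReal (K * √rate) * M.shiftNorm b₁}
      ≤ ENNReal.ofReal (4 * ξ)) := by
  refine ⟨3, by norm_num, fun C₁ C₂ D₁ D₂ Lα hLα => ?_⟩
  -- The relative accuracy of the moments: 24c ≤ 1, and 24c times the size of the weights stays
  -- below both dual radii, as `AccurateSample.closeMoments` demands.
  set c : ℝ := min (1 / 24) (min (D₁ / (24 * (C₁ + C₂ + Lα))) (D₂ / (24 * (C₁ + C₂ + Lα)))) with hc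
  -- The constants precede the model, so the signs of the radii are not yet known; the absolute
  -- values in `capConst` make `K` dominate every requirement in all cases.
  set K := capConst C₁ C₂ D₁ D₂ Lα c with hK
  have hKall : 9 ≤ K ∧ 4 * D₁ / c ≤ K ∧ 4 * D₂ / c ≤ K ∧ 16 / c ≤ K ∧
      64 * (D₁ ^ 2 + D₂ ^ 2) / c ^ 2 ≤ K ∧
      critConst (C₁ + 0 + D₁) ((C₁ + 0 + Lα + 1) * (D₁ + 1)) (Lα * D₁) ≤ K ∧
      critConst (0 + 0 + D₁) ((0 + 0 + 1 + 1) * (D₁ + 1)) D₁ ≤ K ∧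
      critConst (C₁ + C₂ + D₂) ((C₁ + C₂ + 0 + 1) * (D₂ + 1)) (Lα * D₂) ≤ K ∧
      critConst (0 + 0 + D₂) ((0 + 0 + 1 + 1) * (D₂ + 1)) D₂ ≤ K := by
    rw [hK, capConst]
    generalize 4 * D₁ / c = x₁
    generalize 4 * D₂ / c = x₂
    generalize 16 / c = x₃
    generalize 64 * (D₁ ^ 2 + D₂ ^ 2) / c ^ 2 = x₄
    generalize critConst (C₁ + 0 + D₁) ((C₁ + 0 + Lα + 1) * (D₁ + 1)) (Lα * D₁) = x₅
    generalize critConst (0 + 0 + D₁) ((0 + 0 + 1 + 1) * (D₁ + 1)) D₁ = x₆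
    generalize critConst (C₁ + C₂ + D₂) ((C₁ + C₂ + 0 + 1) * (D₂ + 1)) (Lα * D₂) = x₇
    generalize critConst (0 + 0 + D₂) ((0 + 0 + 1 + 1) * (D₂ + 1)) D₂ = x₈
    have a₁ := abs_nonneg x₁
    have a₂ := abs_nonneg x₂
    have a₃ := abs_nonneg x₃
    have a₄ := abs_nonneg x₄
    have a₅ := abs_nonneg x₅
    have a₆ := abs_nonneg x₆
    have a₇ := abs_nonneg x₇
    have a₈ := abs_nonneg x₈
    have b₁ := le_abs_self x₁
    have b₂ := le_abs_self x₂
    have b₃ := le_abs_self x₃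
    have b₄ := le_abs_self x₄
    have b₅ := le_abs_self x₅
    have b₆ := le_abs_self x₆
    have b₇ := le_abs_self x₇
    have b₈ := le_abs_self x₈
    refine ⟨?_, ?_, ?_, ?_, ?_, ?_, ?_, ?_, ?_⟩ <;> linarith
  clear_value K
  obtain ⟨hK9, hK₁, hK₂, hK₃, hK₄, hK₅, hK₆, hK₇, hK₈⟩ := hKall
  refine ⟨K, by linarith, ?_⟩
  intro 𝒳₁ 𝒜₁ 𝒳₂ 𝒜₂ 𝒰 _ _ _ _ _ _ _ _ M m₁ m₂ d₁ d₂ L Pol πs b₁ T ξ eC₁ eC₂ eD₁ eD₂ hL hbm hε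
    hint hIV hlb hlm hπs hopt hb hs hac hξ hξ1
  subst eC₁ eC₂ eD₁ eD₂
  obtain ⟨w₁s, w₂s, β₁, β₂, hbr⟩ := DTRFeatures.exists_isBridge hL hbm hε hint hIV hlb hlm hb hs hac
  have hC₁ : 0 ≤ L.C₁ := (norm_nonneg _).trans hbr.norm_fst
  have hC₂ : 0 ≤ L.C₂ := (norm_nonneg _).trans hbr.norm_snd
  have hD : 0 < L.D₁ ∧ 0 < L.D₂ := by
    obtain ⟨W₁, W₂, W₃, -, -, -, h₁, h₂⟩ := hlm
    have f₁ : 0 ≤ frobNorm W₁ := Real.sqrt_nonneg _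
    have f₂ : 0 ≤ frobNorm W₂ := Real.sqrt_nonneg _
    have f₃ : 0 ≤ frobNorm W₃ := Real.sqrt_nonneg _
    exact ⟨lt_of_le_of_lt (by positivity) h₁, lt_of_le_of_lt (by positivity) h₂⟩
  obtain ⟨hD₁, hD₂⟩ := hD
  have hR : 0 < 24 * (L.C₁ + L.C₂ + Lα) := by linarith
  have hc0 : 0 < c := by
    rw [hc]
    exact lt_min (by norm_num) (lt_min (by positivity) (by positivity))
  have hc1 : c ≤ 1 / 24 := min_le_left _ _
  have hcD₁ : c * (24 * (L.C₁ + L.C₂ + Lα)) ≤ L.D₁ :=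
    (le_div_iff₀ hR).1 ((min_le_right _ _).trans (min_le_left _ _))
  have hcD₂ : c * (24 * (L.C₁ + L.C₂ + Lα)) ≤ L.D₂ :=
    (le_div_iff₀ hR).1 ((min_le_right _ _).trans (min_le_right _ _))
  have hcC₂ : 0 ≤ c * L.C₂ := by positivity
  have hcLα : 0 ≤ c * Lα := by positivity
  have hp := M.obsLaw_complete_ne_zero hac
  have hcl := M.isProbabilityMeasure_completeLaw hac
  have hτ : 1 ≤ Real.log (4 / ξ) := by
    have h1 : (4 : ℝ) ≤ 4 / ξ := by rw [le_div_iff₀ hξ]; linarith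
    have h2 := Real.log_le_log (by norm_num) h1
    have h3 : Real.log 4 = 2 * Real.log 2 := by
      rw [show (4 : ℝ) = 2 ^ 2 by norm_num, Real.log_pow]; norm_num
    linarith [Real.log_two_gt_d9]
  have hbad := DTRFeatures.measure_pi_not_lossesClose_le hL hbr hbm hp hLα hD₁ hD₂ hc0 hc1
    (by linarith) (by linarith) hτ T
  -- With τ = log(4/ξ) the failure probability is 8 · ξ/4 = 2ξ.
  have hexp : ENNReal.ofReal (8 * Real.exp (-Real.log (4 / ξ))) ≤ ENNReal.ofReal (4 * ξ) := by
    refine ENNReal.ofReal_le_ofReal ?_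
    rw [Real.exp_neg, Real.exp_log (by positivity), inv_div]
    linarith
  refine ⟨?_, ?_, ?_⟩
  -- The event is fixed before the radii, the threshold and the output are chosen, so these are
  -- arbitrary on it. A bound on the critical radius of stage two includes that some record is
  -- complete.
  · refine (measure_mono ?_).trans (hbad.trans hexp)
    intro ω hω hgood
    refine hω fun η₁ η₂ e πhat h₁ h₂ he hcap => ?_
    exact DTRFeatures.subOpt_le_of_boundsCriticalRadius hL hbr hπs (hgood h₂.1) hc0 hξ hξ1
      (by linarith) hD₁ hD₂ hK₁ hK₂ hK₃ h₁ h₂ he hcap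
  · have hy : ∀ᵐ ω ∂(Measure.pi (fun _ : Fin T => M.obsLaw)), ∀ t, |M.y₂ (ω t).1| ≤ Lα := by
      rw [ae_all_iff]
      intro t
      exact (measurePreserving_eval (fun _ : Fin T => M.obsLaw) t).quasiMeasurePreserving.ae
        (DTRFeatures.ae_abs_y₂_le hbm hC₁ hC₂)
    filter_upwards [hy] with ω hω
    rintro n rfl δ₁ δ₂ rfl rfl
    refine ⟨fun hT => ⟨?_, ?_⟩, fun hn => ⟨?_, ?_⟩⟩
    · exact DTRFeatures.isCriticalRadius_Q₁ hL hω hT hC₁ hD₁.le hLα.le (by positivity) hK₅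
    · exact DTRFeatures.isCriticalRadius_Θ₁ hL hT hD₁.le hD₁ hK₆
    · exact DTRFeatures.isCriticalRadius_Q₂ hL hn hC₁ hC₂ hD₂.le (by positivity) hK₇
    · exact DTRFeatures.isCriticalRadius_Θ₂ hL hn hD₂.le hD₂ hK₈
  · refine (measure_mono ?_).trans (hbad.trans hexp)
    intro ω hω hgood
    refine hω ?_
    rintro n rate πhat rfl hn hrate hcap
    exact DTRFeatures.subOpt_le_rate hL hbr hπs (hgood (Finset.card_pos.1 (by omega))) hc0 hξ hξ1 hK9
      hK₄ hn hrate hcap
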